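/- Let $n\ge 3$ be an integer and let $C<3/4$ be a real number. Then there exist a connected, complete $n$-dimensional Riemannian manifold $N$ (a smooth manifold with a $C^2$ Riemannian metric), with Riemannian volume measure $|\cdot|$, and a nonempty compact set $K\subset N$ such that, writing $M:=N\setminus K$, $r(x):=d(x,K)$ and $B_\rho(K):=\{x\in N: r(x)<\rho\}$, the following hold. 1. There is a constant $E\ge 1$ with $|B_\rho(K)|\le E\rho^3$ for all sufficiently small $\rho>0$. 2. There is $u\in C^2(M)\cap L^2(M)$, not almost everywhere zero, such that $(-\Delta+C/r^2)u=0$ on $M$, both pointwise and in the sense of distributions, i.e. $\int_M u\,(-\Delta+C/r^2)\psi\,\mathrm{dv}=0$ for every $\psi\in C_c^\infty(M)$. 3. The operator $-\Delta+C/r^2:C_c^\infty(M)\subset L^2(M)\to L^2(M)$ is not essentially self-adjoint. (An operator is essentially self-adjoint if it is symmetric and its closure is self-adjoint.) Moreover, if $C=b^2-b$ with $b\in(1,3/2)$ (that is, if $0<C<3/4$), then $N$, $K$ and $u$ can be taken as follows: $N=N^3\times\mathbb T^{n-3}$ is the Riemannian product of the model manifold $N^3=[0,+\infty)\times_\sigma\mathbb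 S^2$, with metric $dr^2+\sigma(r)^2g_{\mathbb S^2}$ and $$\sigma(r)=r(1+r^2)\Bigl(1+\bigl(\tfrac2b+1\bigr)r^2\Bigr)^{-\frac{3}{2(2+b)}},$$ with the flat torus $\mathbb T^{n-3}=\mathbb R^{n-3}/\mathbb Z^{n-3}$ (a point if $n=3$); $K=\{0\}\times\mathbb T^{n-3}$, where $0$ is the pole of $N^3$; and $u=r^{-b}(1+r^2)^{-1}$ on $M$. -/

import Mathlib

open Set Filter Topology MeasureTheory Manifold Bundle
open scoped ENNReal ContDiff

noncomputable section

namespace Riem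

section Geometry

variable {n : ℕ} {N : Type*} [TopologicalSpace N] [ChartedSpace (EuclideanSpace ℝ (Fin n)) N]
  [RiemannianBundle (fun x : N ↦ TangentSpace (𝓡 n) x)]

/-- The coordinate vector field `∂ᵢ` of the chart `e`, at the point with coordinates `y`. -/
def coordVec (e : OpenPartialHomeomorph N (EuclideanSpace ℝ (Fin n)))
    (y : EuclideanSpace ℝ (Fin n)) (i : Fin n) : TangentSpace (𝓡 n) (e.symm y) :=
  mfderiv (𝓡 n) (𝓡 n) e.symm y (EuclideanSpace.single i (1 : ℝ) : EuclideanSpace ℝ (Fin n))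

/-- The matrix `gᵢⱼ = g(∂ᵢ, ∂ⱼ)` of the Riemannian metric in the chart `e`. -/
def gram (e : OpenPartialHomeomorph N (EuclideanSpace ℝ (Fin n)))
    (y : EuclideanSpace ℝ (Fin n)) : Matrix (Fin n) (Fin n) ℝ :=
  Matrix.of fun i j ↦ inner ℝ (coordVec e y i) (coordVec e y j)

/-- The Riemannian density `√(det g)` in the chart `e`. -/
def density (e : OpenPartialHomeomorph N (EuclideanSpace ℝ (Fin n)))
    (y : EuclideanSpace ℝ (Fin n)) : ℝ :=
  √ (gram e y).det

/-- `vol` is the Riemannian volume measure: in every chart it has density `√(det g)` with respect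
to Lebesgue measure. On a second countable manifold this determines `vol`. -/
def IsRiemannianVolume (n : ℕ) {N : Type*} [TopologicalSpace N]
    [ChartedSpace (EuclideanSpace ℝ (Fin n)) N]
    [RiemannianBundle (fun x : N ↦ TangentSpace (𝓡 n) x)] [MeasurableSpace N]
    (vol : Measure N) : Prop :=
  ∀ e ∈ atlas (EuclideanSpace ℝ (Fin n)) N, ∀ A : Set N, MeasurableSet A → A ⊆ e.source →
    vol A = ∫⁻ y in e '' A, ENNReal.ofReal (density e y)

/-- The Laplace–Beltrami operator
`Δu = (√det g)⁻¹ ∑ᵢ ∂ᵢ (√det g ∑ⱼ gⁱʲ ∂ⱼ u)`, computed at `x` in the preferred chart at `x`. -/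
def laplacian (n : ℕ) {N : Type*} [TopologicalSpace N]
    [ChartedSpace (EuclideanSpace ℝ (Fin n)) N]
    [RiemannianBundle (fun x : N ↦ TangentSpace (𝓡 n) x)] (u : N → ℝ) (x : N) : ℝ :=
  let e := chartAt (EuclideanSpace ℝ (Fin n)) x
  (density e (e x))⁻¹ * ∑ i : Fin n,
    fderiv ℝ (fun y ↦ density e y * ∑ j : Fin n,
      (gram e y)⁻¹ i j * fderiv ℝ (u ∘ e.symm) y (EuclideanSpace.single j (1 : ℝ)))
      (e x) (EuclideanSpace.single i (1 : ℝ))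

/-- The Schrödinger operator `-Δ + V` acting on a function. -/
def schrodinger (n : ℕ) {N : Type*} [TopologicalSpace N]
    [ChartedSpace (EuclideanSpace ℝ (Fin n)) N]
    [RiemannianBundle (fun x : N ↦ TangentSpace (𝓡 n) x)] (V u : N → ℝ) (x : N) : ℝ :=
  -laplacian n u x + V x * u x

/-- `ψ ∈ C_c^∞(Ω)` for an open set `Ω ⊆ N` (extended by zero to `N`). -/
structure IsTest (n : ℕ) {N : Type*} [TopologicalSpace N]
    [ChartedSpace (EuclideanSpace ℝ (Fin n)) N] (Ω : Set N) (ψ : N → ℝ) : Prop where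
  smooth : ContMDiff (𝓡 n) 𝓘(ℝ) ∞ ψ
  compact : HasCompactSupport ψ
  subset : tsupport ψ ⊆ Ω

/-- `T` is the operator `-Δ + V : C_c^∞(Ω) ⊆ L²(Ω) → L²(Ω)`. The description of its graph
determines `T`. -/
def IsSchrodingerOnTest (n : ℕ) {N : Type*} [TopologicalSpace N]
    [ChartedSpace (EuclideanSpace ℝ (Fin n)) N]
    [RiemannianBundle (fun x : N ↦ TangentSpace (𝓡 n) x)] [MeasurableSpace N]
    (vol : Measure N) (Ω : Set N) (V : N → ℝ)
    (T : Lp ℝ 2 (vol.restrict Ω) →ₗ.[ℝ] Lp ℝ 2 (vol.restrict Ω)) : Prop :=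
  ∀ f g : Lp ℝ 2 (vol.restrict Ω), (f, g) ∈ T.graph ↔
    ∃ ψ : N → ℝ, IsTest n Ω ψ ∧ f =ᵐ[vol.restrict Ω] ψ ∧
      g =ᵐ[vol.restrict Ω] schrodinger n V ψ

/-- The polar description of `ℝ³_σ × 𝕋^{n-3}`. Here `ℝ³_σ` is the model manifold
`[0, ∞) ×_σ 𝕊²` with metric `dr² + σ(r)² g_{𝕊²}`, written on `ℝ³` by identifying `(r, θ)` with
`r θ`, and `𝕋^{n-3} = ℝ^{n-3} / ℤ^{n-3}` is the flat torus. The map `P` is the universal covering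
`ℝ³ × ℝ^{n-3} → N`, and `K` is the image of `{0} × ℝ^{n-3}`, i.e. `{pole} × 𝕋^{n-3}`.
The vector `a θ + r η`, with `η ⊥ θ`, at the point `r θ` is `a ∂_r + η` in polar coordinates. -/
structure IsModelTimesTorus (n : ℕ) {N : Type*} [TopologicalSpace N]
    [ChartedSpace (EuclideanSpace ℝ (Fin n)) N]
    [RiemannianBundle (fun x : N ↦ TangentSpace (𝓡 n) x)] (σ : ℝ → ℝ) (K : Set N)
    (P : EuclideanSpace ℝ (Fin 3) × EuclideanSpace ℝ (Fin (n - 3)) → N) : Prop where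
  localDiffeo : IsLocalDiffeomorph
    𝓘(ℝ, EuclideanSpace ℝ (Fin 3) × EuclideanSpace ℝ (Fin (n - 3))) (𝓡 n) ∞ P
  surjective : Function.Surjective P
  fiber : ∀ p q, P p = P q ↔ p.1 = q.1 ∧ ∀ i, ∃ m : ℤ, p.2 i - q.2 i = m
  metric : ∀ (r a : ℝ) (θ η : EuclideanSpace ℝ (Fin 3)) (t τ : EuclideanSpace ℝ (Fin (n - 3))),
    0 < r → ‖θ‖ = 1 → inner ℝ θ η = 0 →
    ‖mfderiv 𝓘(ℝ, EuclideanSpace ℝ (Fin 3) × EuclideanSpace ℝ (Fin (n - 3))) (𝓡 n) P (r • θ, t)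
      ((a • θ + r • η, τ) : EuclideanSpace ℝ (Fin 3) × EuclideanSpace ℝ (Fin (n - 3)))‖ ^ 2
      = a ^ 2 + σ r ^ 2 * ‖η‖ ^ 2 + ‖τ‖ ^ 2
  core : K = P '' {p | p.1 = 0}

end Geometry

/-- An unbounded operator is essentially self-adjoint if it is symmetric and its closure is
self-adjoint. -/
def EssentiallySelfAdjoint {H : Type*} [NormedAddCommGroup H] [InnerProductSpace ℝ H]
    [CompleteSpace H] (T : H →ₗ.[ℝ] H) : Prop :=
  T.IsFormalAdjoint T ∧ IsSelfAdjoint T.closure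

/-- The warping function `σ(r) = r (1 + r²) (1 + (2/b + 1) r²)^{-3/(2(2+b))}`. -/
def warp (b r : ℝ) : ℝ :=
  r * (1 + r ^ 2) * (1 + (2 / b + 1) * r ^ 2) ^ (-(3 / (2 * (2 + b))))

end Riem

end

/-!
The manifold is `ℝ³ × 𝕋ᵏ`, with `n = k + 3`, realised as the quotient of `ℝ^{k+3}` by the lattice
`0 × ℤᵏ`. Its metric is the product of the flat metric of the torus and of a rotationally symmetric
metric `dr² + σ(r)² g_{𝕊²}` on `ℝ³`, with `σ(r)² = r² φ(r²)`. Writing `φ(s) = 1 - s κ(s)`, this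
metric is `φ |dx|² + κ (x · dx)²` in Cartesian coordinates, so it is `C²` at the pole if `κ` is. The
core `K` is the zero set of the projection to `ℝ³`, the distance to `K` is `r = |x|`, since `dr` has
norm one and radial segments have length `r` (`Model.infDist_core`), and the volume is `φ` times
the invariant measure of the group `ℝ³ × 𝕋ᵏ` (`Model.isRiemannianVolume_vol`). The space is proper,
hence complete.

On radial functions `Δ u = (r² φ)⁻¹ (r² φ u')'` (`Model.laplacian_radial`), so everything reduces to
the ordinary differential equation `(r² φ u')' = C φ u`, with the norm `∫ u² r² φ dr`
(`Model.integrable_radial`). What is needed is a profile `φ`, a solution `u` which is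
square-integrable on `(0, ∞)`, and a second solution `u₁` which is square-integrable near `0`, with
non-zero Wronskian `w = r² φ (u u₁' - u₁ u')` (`exists_of_radial`). Indeed, let `g` be `u₁` times a
cut-off. Then `u` and `g` belong to the domain of the adjoint of `-Δ + C / r²` on test functions, by
Green's identity (`Model.integral_green`), which follows from the divergence theorem on the group
(`Model.integral_pd`). However, `∫ u (-Δ + C / r²) g` is a non-zero multiple of `w`, while
`(-Δ + C / r²) u = 0`. The boundary form of the adjoint is thus not zero, which is impossible if the
closure is self-adjoint (`not_isSelfAdjoint_closure`).

If `C ≥ -1/4`, let `b ∈ [1/2, 3/2)` be the larger root of `b² - b = C`, take for `σ` the warping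
function of the statement with this `b`, and `u = r^{-b} (1 + r²)⁻¹`. Reduction of order gives the
second solution `u₁ = u ∫ 1 / (r² φ u²)`, which near `0` is at most of the order of `r^{-b}`, up to
a logarithm if `b = 1/2`. If `C = -1/4 - ν²` with `ν > 0`, the metric is chosen flat for `r ≤ 1`, where
`r^{-1/2} cos (ν log r)` and `r^{-1/2} sin (ν log r)` are solutions, both square-integrable near `0`.
The profile for `r ≥ 1` is chosen so that the first of them extends by
`r^{-1/2} exp (-ν² (log r)² / 2)`, which decays fast enough.
-/

noncomputable section

/-! ### The quotient of `ℝ^{k+3}` by a lattice of rank `k` -/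

namespace CodimThree

/-- Euclidean `ℝ³`. -/
abbrev E3 : Type := EuclideanSpace ℝ (Fin 3)

/-- Euclidean space of dimension `k + 3`: the universal cover of `ℝ³ × 𝕋ᵏ`. -/
abbrev Cover (k : ℕ) : Type := EuclideanSpace ℝ (Fin (k + 3))

/-- The projection of the universal cover onto its first three coordinates. -/
def proj (k : ℕ) : Cover k →L[ℝ] E3 :=
  LinearMap.toContinuousLinearMap
    { toFun := fun x ↦ WithLp.toLp 2 fun i ↦ x (Fin.castLE (Nat.le_add_left 3 k) i)
      map_add' := fun _ _ ↦ rfl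
      map_smul' := fun _ _ ↦ rfl }

lemma proj_apply {k : ℕ} (x : Cover k) (i : Fin 3) :
    proj k x i = x (Fin.castLE (Nat.le_add_left 3 k) i) := rfl

/-- The lattice `0 × ℤᵏ` of deck transformations. -/
def lattice (k : ℕ) : AddSubgroup (Cover k) where
  carrier := {x | proj k x = 0 ∧ ∀ i, ∃ m : ℤ, x i = m}
  zero_mem' := ⟨map_zero _, fun _ ↦ ⟨0, by simp⟩⟩
  add_mem' := by
    rintro x y ⟨hx, hx'⟩ ⟨hy, hy'⟩
    refine ⟨by rw [map_add, hx, hy, add_zero], fun i ↦ ?_⟩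
    obtain ⟨m, hm⟩ := hx' i
    obtain ⟨l, hl⟩ := hy' i
    exact ⟨m + l, by simp [hm, hl]⟩
  neg_mem' := by
    rintro x ⟨hx, hx'⟩
    refine ⟨by rw [map_neg, hx, neg_zero], fun i ↦ ?_⟩
    obtain ⟨m, hm⟩ := hx' i
    exact ⟨-m, by simp [hm]⟩

variable {k : ℕ}

lemma mem_lattice {x : Cover k} : x ∈ lattice k ↔ proj k x = 0 ∧ ∀ i, ∃ m : ℤ, x i = m := Iff.rfl

lemma eq_zero_of_mem_lattice_of_norm_lt {x : Cover k} (hx : x ∈ lattice k) (h : ‖x‖ < 1) :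
    x = 0 := by
  ext i
  obtain ⟨m, hm⟩ := hx.2 i
  have h1 : ‖x i‖ < 1 := (PiLp.norm_apply_le x i).trans_lt h
  rw [hm, Real.norm_eq_abs, ← Int.cast_abs] at h1
  have h2 : |m| < 1 := by exact_mod_cast h1
  have h3 : m = 0 := Int.abs_lt_one_iff.mp h2
  simp [hm, h3]

instance isClosed_lattice : IsClosed (lattice k : Set (Cover k)) := by
  have h : (lattice k : Set (Cover k)) =
      proj k ⁻¹' {0} ∩ ⋂ i, (fun x : Cover k ↦ x i) ⁻¹' range ((↑) : ℤ → ℝ) := by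
    ext x
    simp [mem_lattice, eq_comm]
  rw [h]
  refine (isClosed_singleton.preimage (proj k).continuous).inter (isClosed_iInter fun i ↦ ?_)
  exact Int.isClosedEmbedding_coe_real.isClosed_range.preimage (by fun_prop)

instance countable_lattice : Countable (lattice k) := by
  choose f hf using fun x : lattice k ↦ x.2.2
  refine Function.Injective.countable (f := f) fun x y hxy ↦ ?_
  ext i
  rw [hf x i, hf y i, hxy]

/-- The warping data of a rotationally symmetric metric `dr² + σ(r)² g_{𝕊²}` on `ℝ³`, in the form
`σ(r)² = r² (1 - r² κ(r²))`. In Cartesian coordinates this metric is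
`(1 - s κ(s)) |dx|² + κ(s) (x · dx)²` with `s = |x|²`, so it is `C²` as soon as `κ` is. -/
structure Profile where
  /-- The coefficient `κ`, a function of `s = r²`. -/
  kappa : ℝ → ℝ
  contDiffAt_kappa : ∀ s, 0 ≤ s → ContDiffAt ℝ 2 kappa s
  one_sub_pos : ∀ s, 0 ≤ s → 0 < 1 - s * kappa s

/-- The manifold `ℝ³ × 𝕋ᵏ`, as a quotient of its universal cover. The profile `p` is a phantom
parameter, which selects the Riemannian metric. -/
def Model (k : ℕ) (_p : Profile) : Type := Cover k ⧸ lattice k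

variable {p : Profile}

namespace Model

instance : AddCommGroup (Model k p) := inferInstanceAs (AddCommGroup (Cover k ⧸ lattice k))
instance : TopologicalSpace (Model k p) :=
  inferInstanceAs (TopologicalSpace (Cover k ⧸ lattice k))
instance : IsTopologicalAddGroup (Model k p) :=
  inferInstanceAs (IsTopologicalAddGroup (Cover k ⧸ lattice k))
instance : T3Space (Model k p) := inferInstanceAs (T3Space (Cover k ⧸ lattice k))
instance : SecondCountableTopology (Model k p) :=
  inferInstanceAs (SecondCountableTopology (Cover k ⧸ lattice k))
instance : MeasurableSpace (Model k p) :=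
  inferInstanceAs (MeasurableSpace (Cover k ⧸ lattice k))
instance : BorelSpace (Model k p) := inferInstanceAs (BorelSpace (Cover k ⧸ lattice k))

/-- The universal covering `ℝ³ × ℝᵏ → ℝ³ × 𝕋ᵏ`. -/
def mk (k : ℕ) (p : Profile) : Cover k →+ Model k p := QuotientAddGroup.mk' (lattice k)

lemma continuous_mk : Continuous (mk k p) := continuous_quotient_mk'

lemma isOpenMap_mk : IsOpenMap (mk k p) := QuotientAddGroup.isOpenMap_coe

lemma mk_surjective : Function.Surjective (mk k p) := QuotientAddGroup.mk'_surjective _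

lemma mk_eq_mk {x y : Cover k} : mk k p x = mk k p y ↔ y - x ∈ lattice k := by
  rw [← neg_add_eq_sub]
  exact QuotientAddGroup.eq

lemma isQuotientMap_mk : IsQuotientMap (mk k p) :=
  isOpenMap_mk.isQuotientMap continuous_mk mk_surjective

instance : ConnectedSpace (Model k p) :=
  mk_surjective.connectedSpace continuous_mk

lemma injOn_mk_ball (c : Cover k) : InjOn (mk k p) (Metric.ball c (1 / 2)) := by
  intro x hx y hy hxy
  have h1 : ‖y - x‖ < 1 := by
    have := dist_triangle_right y x c
    rw [Metric.mem_ball] at hx hy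
    rw [← dist_eq_norm]
    linarith
  exact (sub_eq_zero.mp (eq_zero_of_mem_lattice_of_norm_lt (mk_eq_mk.mp hxy) h1)).symm

/-- The inverse of the chart centred at the image of `c`: the covering map on the ball of radius
`1 / 2` around `c`. As a function, it is the covering map on the whole cover. -/
def chartSymm (p : Profile) (c : Cover k) : OpenPartialHomeomorph (Cover k) (Model k p) :=
  OpenPartialHomeomorph.ofContinuousOpen
    ((injOn_mk_ball c).toPartialEquiv (mk k p) (Metric.ball c (1 / 2)))
    continuous_mk.continuousOn isOpenMap_mk Metric.isOpen_ball

/-- The chart centred at the image of `c`. -/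
def chart (p : Profile) (c : Cover k) : OpenPartialHomeomorph (Model k p) (Cover k) :=
  (chartSymm p c).symm

@[simp] lemma coe_chart_symm (c : Cover k) : ((chart p c).symm : Cover k → Model k p) = mk k p := rfl

@[simp] lemma chart_source (c : Cover k) :
    (chart p c).source = mk k p '' Metric.ball c (1 / 2) := rfl

lemma chart_mk {c x : Cover k} (hx : x ∈ Metric.ball c (1 / 2)) : chart p c (mk k p x) = x :=
  (chart p c).right_inv hx

/-- A representative in the cover of a point of the model. -/
def rep (x : Model k p) : Cover k := Function.surjInv mk_surjective x

@[simp] lemma mk_rep (x : Model k p) : mk k p (rep x) = x := Function.surjInv_eq _ _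

instance : ChartedSpace (Cover k) (Model k p) where
  atlas := range (chart p)
  chartAt x := chart p (rep x)
  mem_chart_source x := ⟨rep x, Metric.mem_ball_self (by norm_num), mk_rep x⟩
  chart_mem_atlas x := mem_range_self _

lemma chartAt_eq (x : Model k p) : chartAt (Cover k) x = chart p (rep x) := rfl

lemma chartAt_self (x : Model k p) : chartAt (Cover k) x x = rep x := by
  nth_rewrite 2 [← mk_rep x]
  exact chart_mk (Metric.mem_ball_self (by norm_num))

/-- In every chart the covering map is locally a lattice translation. -/
lemma exists_chart_mk_eventuallyEq {c y : Cover k} (hy : mk k p y ∈ (chart p c).source) :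
    ∃ γ ∈ lattice k, (fun z ↦ chart p c (mk k p z)) =ᶠ[𝓝 y] fun z ↦ z + γ := by
  rw [chart_source] at hy
  obtain ⟨y', hy', h⟩ := hy
  have hγ : y' - y ∈ lattice k := mk_eq_mk.mp h.symm
  have hc : ContinuousAt (fun z : Cover k ↦ z + (y' - y)) y :=
    continuousAt_id.add continuousAt_const
  have hb : Metric.ball c (1 / 2) ∈ 𝓝 (y + (y' - y)) := by
    rw [add_sub_cancel]
    exact Metric.isOpen_ball.mem_nhds hy'
  refine ⟨y' - y, hγ, Filter.mem_of_superset (hc.preimage_mem_nhds hb) fun z hz ↦ ?_⟩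
  have h2 : mk k p z = mk k p (z + (y' - y)) := mk_eq_mk.mpr (by rwa [add_sub_cancel_left])
  exact (congrArg (chart p c) h2).trans (chart_mk hz)

instance : IsManifold (𝓡 (k + 3)) ∞ (Model k p) := by
  refine isManifold_of_contDiffOn _ _ _ ?_
  rintro _ _ ⟨c, rfl⟩ ⟨d, rfl⟩ y hy
  obtain ⟨γ, -, h⟩ := exists_chart_mk_eventuallyEq (p := p) (c := d) (y := y) (by
    have := hy.1
    simp only [mfld_simps] at this
    simpa using this.2)
  refine ContDiffAt.contDiffWithinAt ?_
  refine ContDiffAt.congr_of_eventuallyEq (f := fun z ↦ z + γ) (by fun_prop) ?_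
  exact h

lemma contMDiff_mk : ContMDiff (𝓡 (k + 3)) (𝓡 (k + 3)) ∞ (mk k p) := by
  intro y
  rw [contMDiffAt_iff]
  refine ⟨continuous_mk.continuousAt, ?_⟩
  obtain ⟨γ, -, h⟩ := exists_chart_mk_eventuallyEq (p := p) (c := rep (mk k p y)) (y := y)
    (mem_chart_source (Cover k) (mk k p y))
  refine ContDiffAt.contDiffWithinAt ?_
  exact ContDiffAt.congr_of_eventuallyEq (f := fun z ↦ z + γ) (by fun_prop) h

/-- In the trivialisation of the tangent spaces by the preferred charts, the derivative of the
covering map is the identity. -/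
lemma hasMFDerivAt_mk (y : Cover k) :
    HasMFDerivAt (𝓡 (k + 3)) (𝓡 (k + 3)) (mk k p) y (ContinuousLinearMap.id ℝ (Cover k)) := by
  refine ⟨continuous_mk.continuousAt, ?_⟩
  obtain ⟨γ, -, h⟩ := exists_chart_mk_eventuallyEq (p := p) (c := rep (mk k p y)) (y := y)
    (mem_chart_source (Cover k) (mk k p y))
  refine HasFDerivAt.hasFDerivWithinAt ?_
  exact ((hasFDerivAt_id y).add_const γ).congr_of_eventuallyEq h

lemma mfderiv_mk (y : Cover k) :
    mfderiv (𝓡 (k + 3)) (𝓡 (k + 3)) (mk k p) y = ContinuousLinearMap.id ℝ (Cover k) :=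
  (hasMFDerivAt_mk y).mfderiv

end Model
end CodimThree

/-! ### The Riemannian metric -/

namespace CodimThree

/-- The function `φ(s) = 1 - s κ(s)`, so that `σ(r)² = r² φ(r²)`. -/
def Profile.phi (p : Profile) (s : ℝ) : ℝ := 1 - s * p.kappa s

lemma Profile.phi_pos (p : Profile) {s : ℝ} (hs : 0 ≤ s) : 0 < p.phi s := p.one_sub_pos s hs

lemma Profile.contDiffAt_phi (p : Profile) {s : ℝ} (hs : 0 ≤ s) : ContDiffAt ℝ 2 p.phi s :=
  contDiffAt_const.sub (contDiffAt_id.mul (p.contDiffAt_kappa s hs))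

variable {k : ℕ} {p : Profile}

/-- The inner product of a Euclidean space as a continuous bilinear map. -/
def innerBilin (ι : Type) [Fintype ι] :
    EuclideanSpace ℝ ι →L[ℝ] EuclideanSpace ℝ ι →L[ℝ] ℝ := innerSL ℝ

/-- The metric at a point with first three coordinates `a`: on the last `k` coordinates it is
Euclidean, and on the first three it is `φ |v|² + κ (a · v)²`. -/
def metricForm (k : ℕ) (p : Profile) (a : E3) : Cover k →L[ℝ] Cover k →L[ℝ] ℝ :=
  innerBilin _ + p.kappa (‖a‖ ^ 2) •
    (((innerBilin _ a).comp (proj k)).smulRight ((innerBilin _ a).comp (proj k)) -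
      ‖a‖ ^ 2 • (innerBilin _).bilinearComp (proj k) (proj k))

lemma metricForm_apply (a : E3) (v w : Cover k) :
    metricForm k p a v w = inner ℝ v w + p.kappa (‖a‖ ^ 2) *
      (inner ℝ a (proj k v) * inner ℝ a (proj k w) - ‖a‖ ^ 2 * inner ℝ (proj k v) (proj k w)) := by
  simp only [metricForm, innerBilin, add_apply, smul_apply, sub_apply, ContinuousLinearMap.smulRight_apply,
    ContinuousLinearMap.comp_apply, ContinuousLinearMap.bilinearComp_apply, smul_eq_mul]
  rfl

lemma contDiff_kappa_norm_sq : ContDiff ℝ 2 fun a : E3 ↦ p.kappa (‖a‖ ^ 2) :=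
  contDiff_iff_contDiffAt.2 fun a ↦
    (p.contDiffAt_kappa _ (by positivity)).comp a (contDiff_norm_sq ℝ).contDiffAt

lemma contDiff_phi_norm_sq : ContDiff ℝ 2 fun a : E3 ↦ p.phi (‖a‖ ^ 2) :=
  contDiff_iff_contDiffAt.2 fun a ↦
    (p.contDiffAt_phi (by positivity)).comp a (contDiff_norm_sq ℝ).contDiffAt

lemma ContDiff.real_smul {V W : Type*} [NormedAddCommGroup V] [NormedSpace ℝ V]
    [NormedAddCommGroup W] [NormedSpace ℝ W] {m : WithTop ℕ∞} {f : W → ℝ} {g : W → V}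
    (hf : ContDiff ℝ m f) (hg : ContDiff ℝ m g) : ContDiff ℝ m fun a ↦ f a • g a := hf.smul hg

lemma contDiff_metricForm : ContDiff ℝ 2 (metricForm k p) := by
  have h1 : ContDiff ℝ 2 fun a : E3 ↦ (innerBilin _ a).comp (proj k) :=
    (innerBilin (Fin 3)).contDiff.clm_comp contDiff_const
  exact contDiff_const.add (ContDiff.real_smul contDiff_kappa_norm_sq ((h1.smulRight h1).sub
    (ContDiff.real_smul (contDiff_norm_sq ℝ) contDiff_const)))

@[to_additive]
lemma prod_split {M : Type*} [CommMonoid M] (f : Fin (k + 3) → M) :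
    ∏ i, f i = (∏ i : Fin 3, f (Fin.castLE (Nat.le_add_left 3 k) i)) *
      ∏ j : Fin k, f j.succ.succ.succ := by
  simp only [Fin.prod_univ_succ, Fin.prod_univ_zero, ← mul_assoc, mul_one]
  rfl

lemma norm_proj_le (v : Cover k) : ‖proj k v‖ ≤ ‖v‖ := by
  refine le_of_sq_le_sq ?_ (norm_nonneg v)
  rw [EuclideanSpace.norm_sq_eq, EuclideanSpace.norm_sq_eq v,
    sum_split fun i ↦ ‖v i‖ ^ 2]
  exact le_add_of_nonneg_right (a := ∑ i, ‖proj k v i‖ ^ 2)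
    (Finset.sum_nonneg fun j : Fin k ↦ fun _ ↦ sq_nonneg ‖v j.succ.succ.succ‖)

lemma metricForm_symm (a : E3) (v w : Cover k) :
    metricForm k p a v w = metricForm k p a w v := by
  rw [metricForm_apply, metricForm_apply, real_inner_comm v w,
    real_inner_comm (proj k v) (proj k w), mul_comm (inner ℝ a (proj k v))]

/-- The metric is bounded below by `min 1 φ` times the Euclidean metric. -/
lemma le_metricForm_self (a : E3) (v : Cover k) :
    min 1 (p.phi (‖a‖ ^ 2)) * ‖v‖ ^ 2 ≤ metricForm k p a v v := by
  rw [metricForm_apply, real_inner_self_eq_norm_sq, real_inner_self_eq_norm_sq]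
  have hcs : inner ℝ a (proj k v) * inner ℝ a (proj k v) ≤ ‖a‖ ^ 2 * ‖proj k v‖ ^ 2 := by
    rw [← mul_pow, ← sq, ← sq_abs]
    gcongr
    exact abs_real_inner_le_norm _ _
  have hp : ‖proj k v‖ ^ 2 ≤ ‖v‖ ^ 2 := by
    gcongr
    exact norm_proj_le v
  have hv := sq_nonneg ‖v‖
  rcases le_total (p.kappa (‖a‖ ^ 2)) 0 with hk | hk
  · have h1 : min 1 (p.phi (‖a‖ ^ 2)) * ‖v‖ ^ 2 ≤ 1 * ‖v‖ ^ 2 := by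
      gcongr
      exact min_le_left _ _
    nlinarith [mul_nonneg_of_nonpos_of_nonpos hk (sub_nonpos.2 hcs)]
  · have h1 : min 1 (p.phi (‖a‖ ^ 2)) * ‖v‖ ^ 2 ≤ p.phi (‖a‖ ^ 2) * ‖v‖ ^ 2 := by
      gcongr
      exact min_le_right _ _
    have h2 := mul_le_mul_of_nonneg_left hp (mul_nonneg hk (sq_nonneg ‖a‖))
    have h3 := mul_nonneg hk (mul_self_nonneg (inner ℝ a (proj k v)))
    rw [Profile.phi] at h1 ⊢
    nlinarith

lemma metricForm_self_pos (a : E3) {v : Cover k} (hv : v ≠ 0) : 0 < metricForm k p a v v :=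
  lt_of_lt_of_le (mul_pos (lt_min one_pos (p.phi_pos (by positivity)))
    (by positivity)) (le_metricForm_self a v)

namespace Model

/-- The projection of `ℝ³ × 𝕋ᵏ` onto `ℝ³`. -/
def toE3 (k : ℕ) (p : Profile) : Model k p →+ E3 :=
  QuotientAddGroup.lift (lattice k) (proj k).toLinearMap.toAddMonoidHom fun _ hx ↦ hx.1

@[simp] lemma toE3_mk (x : Cover k) : toE3 k p (mk k p x) = proj k x := rfl

lemma continuous_toE3 : Continuous (toE3 k p) :=
  isQuotientMap_mk.continuous_iff.2 (proj k).continuous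

lemma proj_rep (x : Model k p) : proj k (rep x) = toE3 k p x := by
  rw [← toE3_mk (p := p), mk_rep]

/-- A function on the model is differentiable of class `C^m` if and only if its lift to the
universal cover is. -/
lemma contMDiffAt_iff_comp_mk {F : Type*} [NormedAddCommGroup F] [NormedSpace ℝ F]
    {f : Model k p → F} {m : WithTop ℕ∞} (hm : m ≤ (∞ : ℕ∞ω)) {y : Cover k} :
    ContMDiffAt (𝓡 (k + 3)) 𝓘(ℝ, F) m f (mk k p y) ↔ ContDiffAt ℝ m (f ∘ mk k p) y := by
  constructor
  · intro h
    exact (h.comp y (contMDiff_mk.of_le hm).contMDiffAt).contDiffAt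
  · intro h
    have hy : y ∈ Metric.ball y (1 / 2 : ℝ) := Metric.mem_ball_self (by norm_num)
    have hsrc : mk k p y ∈ (chart p y).source := ⟨y, hy, rfl⟩
    have h1 : ContMDiffAt (𝓡 (k + 3)) (𝓡 (k + 3)) ∞ (chart p y) (mk k p y) :=
      contMDiffAt_of_mem_maximalAtlas (IsManifold.subset_maximalAtlas (mem_range_self y)) hsrc
    have h2 : ContMDiffAt (𝓡 (k + 3)) 𝓘(ℝ, F) m (f ∘ mk k p) (chart p y (mk k p y)) := by
      rw [chart_mk hy]
      exact h.contMDiffAt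
    refine (h2.comp _ (h1.of_le hm)).congr_of_eventuallyEq ?_
    filter_upwards [(chart p y).open_source.mem_nhds hsrc] with z hz
    exact congrArg f ((chart p y).left_inv hz).symm

lemma contMDiff_toE3 : ContMDiff (𝓡 (k + 3)) 𝓘(ℝ, E3) ∞ (toE3 k p) := by
  intro x
  obtain ⟨y, rfl⟩ := mk_surjective x
  exact (contMDiffAt_iff_comp_mk le_rfl).2 (proj k).contDiff.contDiffAt

lemma symmL_trivializationAt {x₀ x : Model k p} (hx : x ∈ (chartAt (Cover k) x₀).source) :
    (trivializationAt (Cover k) (TangentSpace (𝓡 (k + 3))) x₀).symmL ℝ x =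
      ContinuousLinearMap.id ℝ (Cover k) := by
  rw [TangentBundle.symmL_trivializationAt hx]
  have h : mfderiv (𝓡 (k + 3)) (𝓡 (k + 3)) (mk k p) (extChartAt (𝓡 (k + 3)) x₀ x) =
      ContinuousLinearMap.id ℝ (Cover k) := mfderiv_mk _
  simp only [modelWithCornersSelf_coe, range_id, mfderivWithin_univ]
  exact h

/-- The Riemannian metric of `ℝ³_σ × 𝕋ᵏ` as a bilinear form on the tangent spaces. -/
def metricAt (k : ℕ) (p : Profile) (x : Model k p) :
    TangentSpace (𝓡 (k + 3)) x →L[ℝ] TangentSpace (𝓡 (k + 3)) x →L[ℝ] ℝ :=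
  metricForm k p (toE3 k p x)

/-- The Riemannian metric of `ℝ³_σ × 𝕋ᵏ`. -/
def metric (k : ℕ) (p : Profile) : ContMDiffRiemannianMetric (𝓡 (k + 3)) 2 (Cover k)
    (fun x : Model k p ↦ TangentSpace (𝓡 (k + 3)) x) where
  inner x := metricAt k p x
  symm x v w := metricForm_symm _ _ _
  pos x v hv := metricForm_self_pos _ hv
  isVonNBounded x := by
    change Bornology.IsVonNBounded ℝ {v : Cover k | metricForm k p (toE3 k p x) v v < 1}
    set c := min 1 (p.phi (‖toE3 k p x‖ ^ 2)) with hc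
    have hc0 : 0 < c := lt_min one_pos (p.phi_pos (by positivity))
    refine (NormedSpace.isVonNBounded_closedBall ℝ (Cover k) (√(1 / c))).subset fun v hv ↦ ?_
    rw [mem_closedBall_zero_iff]
    refine Real.le_sqrt_of_sq_le ?_
    rw [le_div_iff₀ hc0, mul_comm]
    exact (le_metricForm_self _ _).trans (le_of_lt hv)
  contMDiff := by
    intro x
    refine (contMDiffAt_section _).2 ?_
    have h1 : ContMDiffAt (𝓡 (k + 3)) 𝓘(ℝ, Cover k →L[ℝ] Cover k →L[ℝ] ℝ) 2
        (fun y ↦ metricForm k p (toE3 k p y)) x :=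
      contDiff_metricForm.contMDiff.contMDiffAt.comp x (contMDiff_toE3.of_le ENat.LEInfty.out).contMDiffAt
    refine h1.congr_of_eventuallyEq ?_
    filter_upwards [(chartAt (Cover k) x).open_source.mem_nhds (mem_chart_source _ x)] with y hy
    have hb : y ∈ (trivializationAt (Cover k) (TangentSpace (𝓡 (k + 3))) x).baseSet := hy
    ext v w
    have h2 := inCoordinates_apply_eq₂ (𝕜 := ℝ) (F₃ := ℝ) (E₃ := Bundle.Trivial (Model k p) ℝ)
      (ϕ := metricAt k p y) (v := v) (w := w) hb hb (mem_univ _)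
    refine h2.trans ?_
    have h3 : ∀ v, (trivializationAt (Cover k) (TangentSpace (𝓡 (k + 3))) x).symm y v = v :=
      fun v ↦ (Trivialization.symmL_apply _ hb v).symm.trans
        (DFunLike.congr_fun (symmL_trivializationAt hy) v)
    rw [h3, h3]
    exact DFunLike.congr_fun (Bundle.Trivial.linearMapAt_trivialization ℝ (Model k p) ℝ y) _

instance : RiemannianBundle (fun x : Model k p ↦ TangentSpace (𝓡 (k + 3)) x) :=
  ⟨(metric k p).toRiemannianMetric⟩

end Model
end CodimThree

/-! ### The Riemannian distance -/

namespace CodimThree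

variable {k : ℕ} {p : Profile}

/-- The splitting `ℝ³ × ℝᵏ ≃ ℝ^{k+3}`. -/
def splitEquiv (k : ℕ) : (E3 × EuclideanSpace ℝ (Fin k)) ≃L[ℝ] Cover k :=
  LinearEquiv.toContinuousLinearEquiv
    { toFun := fun q ↦ WithLp.toLp 2 fun i ↦
        if h : i.val < 3 then q.1 ⟨i, h⟩ else q.2 ⟨i - 3, by omega⟩
      map_add' := fun x y ↦ by
        ext i
        simp only [Prod.fst_add, Prod.snd_add, PiLp.add_apply]
        split_ifs <;> rfl
      map_smul' := fun c x ↦ by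
        ext i
        simp only [Prod.smul_fst, Prod.smul_snd, PiLp.smul_apply, RingHom.id_apply]
        split_ifs <;> rfl
      invFun := fun x ↦ (proj k x, WithLp.toLp 2 fun j ↦ x j.succ.succ.succ)
      left_inv := fun q ↦ by
        refine Prod.ext ?_ ?_
        · ext i
          simp [proj_apply, i.isLt]
        · ext j
          simp
      right_inv := fun x ↦ by
        ext i
        by_cases h : i.val < 3
        · simp [h, proj_apply]
        · simp only [h, dite_false]
          refine congrArg x (Fin.ext ?_)
          simp only [Fin.val_succ]
          omega }

@[simp] lemma proj_splitEquiv (q : E3 × EuclideanSpace ℝ (Fin k)) :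
    proj k (splitEquiv k q) = q.1 :=
  congrArg Prod.fst ((splitEquiv k).symm_apply_apply q)

@[simp] lemma splitEquiv_apply_succ (q : E3 × EuclideanSpace ℝ (Fin k)) (j : Fin k) :
    splitEquiv k q j.succ.succ.succ = q.2 j := by
  have h := congrArg Prod.snd ((splitEquiv k).symm_apply_apply q)
  exact congrArg (fun t : EuclideanSpace ℝ (Fin k) ↦ t j) h

lemma norm_sq_splitEquiv (q : E3 × EuclideanSpace ℝ (Fin k)) :
    ‖splitEquiv k q‖ ^ 2 = ‖q.1‖ ^ 2 + ‖q.2‖ ^ 2 := by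
  rw [EuclideanSpace.norm_sq_eq, sum_split fun i ↦ ‖splitEquiv k q i‖ ^ 2,
    EuclideanSpace.norm_sq_eq q.1, EuclideanSpace.norm_sq_eq q.2]
  simp only [← proj_apply, proj_splitEquiv, splitEquiv_apply_succ]

/-- The metric dominates `dr²`, in a form without division by `r`. -/
lemma inner_sq_le_norm_sq_mul_metricForm (a : E3) (v : Cover k) :
    inner ℝ a (proj k v) ^ 2 ≤ ‖a‖ ^ 2 * metricForm k p a v v := by
  rw [metricForm_apply, real_inner_self_eq_norm_sq, real_inner_self_eq_norm_sq]
  have hcs : inner ℝ a (proj k v) ^ 2 ≤ ‖a‖ ^ 2 * ‖proj k v‖ ^ 2 := by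
    rw [← mul_pow, ← sq_abs]
    gcongr
    exact abs_real_inner_le_norm _ _
  have hp : ‖a‖ ^ 2 * ‖proj k v‖ ^ 2 ≤ ‖a‖ ^ 2 * ‖v‖ ^ 2 := by
    gcongr
    exact norm_proj_le v
  have hφ := mul_nonneg (p.phi_pos (sq_nonneg ‖a‖)).le (sub_nonneg.2 hcs)
  rw [Profile.phi] at hφ
  nlinarith

/-- A `C¹` function whose derivative is bounded by `1` in the Riemannian norm is `1`-Lipschitz for
the Riemannian distance. -/
lemma enorm_sub_le_riemannianEDist {E H M : Type*} [NormedAddCommGroup E] [NormedSpace ℝ E]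
    [TopologicalSpace H] {I : ModelWithCorners ℝ E H} [TopologicalSpace M] [ChartedSpace H M]
    [RiemannianBundle (fun x : M ↦ TangentSpace I x)]
    {f : M → ℝ} {f' : ∀ x : M, TangentSpace I x →L[ℝ] ℝ} (hf : ContMDiff I 𝓘(ℝ, ℝ) 1 f)
    (hf' : ∀ x, HasMFDerivAt I 𝓘(ℝ, ℝ) f x (f' x)) (hle : ∀ x v, |f' x v| ≤ ‖v‖) (x y : M) :
    ‖f y - f x‖ₑ ≤ riemannianEDist I x y := by
  refine le_of_forall_gt fun r hr ↦ ?_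
  obtain ⟨γ, h0, h1, hγ, hlen, -, -⟩ :=
    exists_lt_locally_constant_of_riemannianEDist_lt hr zero_lt_one
  refine lt_of_le_of_lt ?_ hlen
  have hd : ContDiff ℝ 1 (f ∘ γ) := (hf.comp hγ).contDiff
  have key := enorm_sub_le_lintegral_deriv_of_contDiffOn_Icc (f := f ∘ γ) (a := 0) (b := 1)
    hd.contDiffOn zero_le_one
  simp only [Function.comp_apply, h0, h1] at key
  refine key.trans ?_
  rw [pathELength_eq_lintegral_mfderiv_Icc]
  refine lintegral_mono fun t ↦ ?_
  have h2 : deriv (f ∘ γ) t = f' (γ t) (mfderiv 𝓘(ℝ, ℝ) I γ t (1 : ℝ)) := by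
    let L : ℝ →L[ℝ] ℝ := (f' (γ t)).comp (mfderiv 𝓘(ℝ, ℝ) I γ t)
    have h3 : HasFDerivAt (f ∘ γ) L t :=
      ((hf' (γ t)).comp t (hγ.mdifferentiable one_ne_zero t).hasMFDerivAt).hasFDerivAt
    exact h3.hasDerivAt.deriv
  refine (congrArg enorm h2).trans_le ?_
  rw [Real.enorm_eq_ofReal_abs, ← ofReal_norm]
  exact ENNReal.ofReal_le_ofReal (hle _ _)

namespace Model

instance : IsContMDiffRiemannianBundle (𝓡 (k + 3)) 2 (Cover k)
    (fun x : Model k p ↦ TangentSpace (𝓡 (k + 3)) x) :=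
  ⟨(metric k p).inner, (metric k p).contMDiff, fun _ _ _ ↦ rfl⟩

instance : IsContinuousRiemannianBundle (Cover k)
    (fun x : Model k p ↦ TangentSpace (𝓡 (k + 3)) x) :=
  ⟨(metric k p).inner, (metric k p).contMDiff.continuous, fun _ _ _ ↦ rfl⟩

lemma norm_sq_eq (x : Model k p) (v : TangentSpace (𝓡 (k + 3)) x) :
    ‖v‖ ^ 2 = metricForm k p (toE3 k p x) v v := by
  rw [← real_inner_self_eq_norm_sq]
  rfl

lemma norm_eq (x : Model k p) (v : TangentSpace (𝓡 (k + 3)) x) :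
    ‖v‖ = √(metricForm k p (toE3 k p x) v v) := by
  rw [← norm_sq_eq, Real.sqrt_sq (norm_nonneg _)]

lemma enorm_eq (x : Model k p) (v : TangentSpace (𝓡 (k + 3)) x) :
    ‖v‖ₑ = ENNReal.ofReal √(metricForm k p (toE3 k p x) v v) := by
  rw [← ofReal_norm, norm_eq]

lemma hasMFDerivAt_toE3 (x : Model k p) :
    HasMFDerivAt (𝓡 (k + 3)) 𝓘(ℝ, E3) (toE3 k p) x (proj k) :=
  ⟨continuous_toE3.continuousAt, (proj k).hasFDerivAt.hasFDerivWithinAt⟩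

/-- The length of the image in the model of a segment in the cover. -/
lemma pathELength_segment (x v : Cover k) :
    pathELength (𝓡 (k + 3)) (fun t : ℝ ↦ mk k p (x + t • v)) 0 1 =
      ∫⁻ t in Icc (0 : ℝ) 1, ENNReal.ofReal √(metricForm k p (proj k x + t • proj k v) v v) := by
  rw [pathELength_eq_lintegral_mfderiv_Icc]
  refine lintegral_congr fun t ↦ ?_
  have h1 : HasMFDerivAt 𝓘(ℝ, ℝ) (𝓡 (k + 3)) (fun t : ℝ ↦ x + t • v) t
      ((1 : ℝ →L[ℝ] ℝ).smulRight v) :=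
    (((hasFDerivAt_id t).smul_const v).const_add x).hasMFDerivAt
  have h2 := ((hasMFDerivAt_mk (p := p) (x + t • v)).comp t h1).mfderiv
  have h3 : mfderiv 𝓘(ℝ, ℝ) (𝓡 (k + 3)) (fun t : ℝ ↦ mk k p (x + t • v)) t (1 : ℝ) = v := by
    refine (DFunLike.congr_fun h2 (1 : ℝ)).trans ?_
    change (1 : ℝ) • v = v
    exact one_smul _ _
  refine (congrArg enorm h3).trans ((enorm_eq _ _).trans ?_)
  rw [toE3_mk, map_add, map_smul]

lemma riemannianEDist_segment_le (x v : Cover k) :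
    riemannianEDist (𝓡 (k + 3)) (mk k p x) (mk k p (x + v)) ≤
      ∫⁻ t in Icc (0 : ℝ) 1, ENNReal.ofReal √(metricForm k p (proj k x + t • proj k v) v v) := by
  rw [← pathELength_segment]
  refine riemannianEDist_le_pathELength ?_ (by simp) (by simp) zero_le_one
  refine ContMDiff.contMDiffOn ?_
  have h : ContMDiff 𝓘(ℝ, ℝ) (𝓡 (k + 3)) 1 fun t : ℝ ↦ x + t • v :=
    ContDiff.contMDiff (by fun_prop)
  exact (contMDiff_mk.of_le ENat.LEInfty.out).comp h

lemma riemannianEDist_ne_top (x y : Model k p) : riemannianEDist (𝓡 (k + 3)) x y ≠ ⊤ := by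
  obtain ⟨x, rfl⟩ := mk_surjective x
  obtain ⟨y, rfl⟩ := mk_surjective y
  have h := riemannianEDist_segment_le (p := p) x (y - x)
  rw [add_sub_cancel] at h
  refine (h.trans_lt ?_).ne
  have hc : Continuous fun t : ℝ ↦
      √(metricForm k p (proj k x + t • proj k (y - x)) (y - x) (y - x)) := by
    have := (contDiff_metricForm (k := k) (p := p)).continuous
    fun_prop
  exact (hc.integrableOn_Icc (μ := volume)).lintegral_lt_top

instance : MetricSpace (Model k p) :=
  letI : EMetricSpace (Model k p) := EMetricSpace.ofRiemannianMetric (𝓡 (k + 3)) (Model k p)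
  EMetricSpace.toMetricSpace riemannianEDist_ne_top

instance : IsRiemannianManifold (𝓡 (k + 3)) (Model k p) := ⟨fun _ _ ↦ rfl⟩

end Model
end CodimThree

/-! ### The core and the distance to it -/

namespace CodimThree

variable {k : ℕ} {p : Profile}

lemma mem_lattice_iff {x : Cover k} :
    x ∈ lattice k ↔ proj k x = 0 ∧ ∀ j : Fin k, ∃ m : ℤ, x j.succ.succ.succ = m := by
  refine ⟨fun h ↦ ⟨h.1, fun j ↦ h.2 _⟩, fun h ↦ ⟨h.1, fun i ↦ ?_⟩⟩
  by_cases hi : i.val < 3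
  · refine ⟨0, ?_⟩
    rw [Int.cast_zero]
    exact congrArg (fun a : E3 ↦ a ⟨i, hi⟩) h.1
  · obtain ⟨m, hm⟩ := h.2 ⟨i - 3, by omega⟩
    refine ⟨m, hm ▸ congrArg x (Fin.ext ?_)⟩
    simp only [Fin.val_succ]
    omega

namespace Model

lemma edist_eq (x y : Model k p) : edist x y = riemannianEDist (𝓡 (k + 3)) x y := rfl

/-- The functions `√(r² + ε²)`, which unlike `r` are smooth at the core, are `1`-Lipschitz. -/
lemma enorm_sqrt_sub_le {ε : ℝ} (hε : 0 < ε) (x y : Model k p) :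
    ‖√(‖toE3 k p y‖ ^ 2 + ε ^ 2) - √(‖toE3 k p x‖ ^ 2 + ε ^ 2)‖ₑ ≤
      riemannianEDist (𝓡 (k + 3)) x y := by
  have hpos : ∀ a : E3, 0 < ‖a‖ ^ 2 + ε ^ 2 := fun a ↦ by positivity
  let F : E3 → ℝ := fun a ↦ √(‖a‖ ^ 2 + ε ^ 2)
  have hF : ContDiff ℝ 1 F :=
    ContDiff.sqrt ((contDiff_norm_sq ℝ).add contDiff_const) fun a ↦ (hpos a).ne'
  have hF' : ∀ a, HasFDerivAt F ((1 / (2 * √(‖a‖ ^ 2 + ε ^ 2))) • (2 • innerSL ℝ a)) a :=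
    fun a ↦ (((hasStrictFDerivAt_norm_sq a).hasFDerivAt).add_const _).sqrt (hpos a).ne'
  refine enorm_sub_le_riemannianEDist
    (f := fun x : Model k p ↦ √(‖toE3 k p x‖ ^ 2 + ε ^ 2))
    (f' := fun x ↦ ((1 / (2 * √(‖toE3 k p x‖ ^ 2 + ε ^ 2))) •
      (2 • innerSL ℝ (toE3 k p x)) : E3 →L[ℝ] ℝ).comp (proj k))
    (hF.contMDiff.comp (contMDiff_toE3.of_le ENat.LEInfty.out))
    (fun x ↦ ((hF' (toE3 k p x)).hasMFDerivAt).comp x (hasMFDerivAt_toE3 x)) (fun x v ↦ ?_) x y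
  set a := toE3 k p x with ha
  have hs : 0 < √(‖a‖ ^ 2 + ε ^ 2) := Real.sqrt_pos.2 (hpos a)
  have key : |(1 / (2 * √(‖a‖ ^ 2 + ε ^ 2))) * (2 * inner ℝ a (proj k v))| ≤
      √(metricForm k p a v v) := by
    refine Real.abs_le_sqrt ?_
    have h1 : ((1 / (2 * √(‖a‖ ^ 2 + ε ^ 2))) * (2 * inner ℝ a (proj k v))) ^ 2 =
        inner ℝ a (proj k v) ^ 2 / (‖a‖ ^ 2 + ε ^ 2) := by
      rw [← Real.sq_sqrt (hpos a).le]
      field_simp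
      rw [Real.sqrt_sq hs.le]
    rw [h1, div_le_iff₀ (hpos a)]
    have h2 := inner_sq_le_norm_sq_mul_metricForm (p := p) a v
    have h3 : 0 ≤ metricForm k p a v v :=
      (mul_nonneg (lt_min one_pos (p.phi_pos (sq_nonneg _))).le (sq_nonneg _)).trans
        (le_metricForm_self a v)
    nlinarith [sq_nonneg ε]
  rw [norm_eq, ← ha]
  refine le_trans (le_of_eq (congrArg abs ?_)) key
  change (1 / (2 * √(‖a‖ ^ 2 + ε ^ 2))) * (2 • inner ℝ a (proj k v)) = _
  rw [nsmul_eq_mul, Nat.cast_ofNat]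

/-- The distance to the core is `1`-Lipschitz: `|r(y) - r(x)| ≤ d(x, y)`. -/
lemma abs_norm_toE3_sub_le (x y : Model k p) :
    |‖toE3 k p y‖ - ‖toE3 k p x‖| ≤ dist x y := by
  have h1 : ∀ ε : ℝ, 0 < ε →
      |√(‖toE3 k p y‖ ^ 2 + ε ^ 2) - √(‖toE3 k p x‖ ^ 2 + ε ^ 2)| ≤ dist x y := by
    intro ε hε
    have h := enorm_sqrt_sub_le hε x y
    rw [← edist_eq, edist_dist, Real.enorm_eq_ofReal_abs] at h
    exact (ENNReal.ofReal_le_ofReal_iff dist_nonneg).1 h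
  have h2 : Tendsto (fun ε : ℝ ↦
      |√(‖toE3 k p y‖ ^ 2 + ε ^ 2) - √(‖toE3 k p x‖ ^ 2 + ε ^ 2)|) (𝓝[>] 0)
      (𝓝 |‖toE3 k p y‖ - ‖toE3 k p x‖|) := by
    have hc : Continuous fun ε : ℝ ↦
      |√(‖toE3 k p y‖ ^ 2 + ε ^ 2) - √(‖toE3 k p x‖ ^ 2 + ε ^ 2)| := by fun_prop
    have := hc.tendsto 0
    simp only [ne_eq, OfNat.ofNat_ne_zero, not_false_eq_true, zero_pow, add_zero,
      Real.sqrt_sq (norm_nonneg _)] at this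
    exact this.mono_left nhdsWithin_le_nhds
  refine le_of_tendsto h2 ?_
  filter_upwards [self_mem_nhdsWithin] with ε hε using h1 ε hε

/-- The core `{0} × 𝕋ᵏ`. -/
def core (k : ℕ) (p : Profile) : Set (Model k p) := {x | toE3 k p x = 0}

lemma exists_mem_core_dist_le (x : Model k p) : ∃ y ∈ core k p, dist x y ≤ ‖toE3 k p x‖ := by
  obtain ⟨x, rfl⟩ := mk_surjective x
  set a := proj k x with ha
  set v := splitEquiv k (-a, 0) with hv
  have hπ : proj k v = -a := by simp [hv]
  refine ⟨mk k p (x + v), ?_, ?_⟩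
  · change toE3 k p _ = 0
    rw [toE3_mk, map_add, hπ, ← ha, add_neg_cancel]
  have h := riemannianEDist_segment_le (p := p) x v
  have h1 : ∀ t : ℝ, √(metricForm k p (proj k x + t • proj k v) v v) = ‖a‖ := by
    intro t
    have h2 : proj k x + t • proj k v = (1 - t) • a := by
      rw [hπ, ← ha]
      module
    have h3 : ‖v‖ ^ 2 = ‖a‖ ^ 2 := by simp [hv, norm_sq_splitEquiv]
    have h4 : metricForm k p ((1 - t) • a) v v = ‖a‖ ^ 2 := by
      rw [metricForm_apply, hπ, real_inner_self_eq_norm_sq, real_inner_self_eq_norm_sq, h3,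
        inner_neg_right, inner_smul_left, real_inner_self_eq_norm_sq, norm_neg, norm_smul,
        mul_pow, Real.norm_eq_abs, sq_abs]
      simp only [conj_trivial]
      ring
    rw [h2, h4, Real.sqrt_sq (norm_nonneg a)]
  simp only [h1] at h
  rw [← edist_eq, edist_dist] at h
  simp only [lintegral_const, Measure.restrict_apply_univ, Real.volume_Icc, sub_zero,
    ENNReal.ofReal_one, mul_one] at h
  exact (ENNReal.ofReal_le_ofReal_iff (norm_nonneg _)).1 h

lemma core_nonempty : (core k p).Nonempty := ⟨0, map_zero _⟩

/-- The distance to the core is the radial coordinate. -/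
lemma infDist_core (x : Model k p) : Metric.infDist x (core k p) = ‖toE3 k p x‖ := by
  refine le_antisymm ?_ ?_
  · obtain ⟨y, hy, h⟩ := exists_mem_core_dist_le x
    exact (Metric.infDist_le_dist_of_mem hy).trans h
  · refine (Metric.le_infDist core_nonempty).2 fun {y} hy ↦ ?_
    have h := abs_norm_toE3_sub_le x y
    rw [show toE3 k p y = 0 from hy, norm_zero, zero_sub, abs_neg, abs_norm] at h
    exact h

/-- The closed tubes around the core are compact. -/
lemma isCompact_tube (R : ℝ) : IsCompact {x : Model k p | ‖toE3 k p x‖ ≤ R} := by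
  have h1 : IsCompact (WithLp.toLp 2 '' (univ.pi fun _ : Fin k ↦ Icc (0 : ℝ) 1)) :=
    (isCompact_univ_pi fun _ ↦ isCompact_Icc).image (PiLp.continuous_toLp 2 _)
  have h2 := (((isCompact_closedBall (0 : E3) R).prod h1).image
    (splitEquiv k).continuous).image (continuous_mk (p := p))
  refine h2.of_isClosed_subset (isClosed_le continuous_toE3.norm continuous_const) ?_
  intro x hx
  obtain ⟨x, rfl⟩ := mk_surjective x
  let t : EuclideanSpace ℝ (Fin k) := WithLp.toLp 2 fun j ↦ Int.fract (x j.succ.succ.succ)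
  have ht : t ∈ WithLp.toLp 2 '' (univ.pi fun _ : Fin k ↦ Icc (0 : ℝ) 1) :=
    mem_image_of_mem _ fun j _ ↦ ⟨Int.fract_nonneg _, (Int.fract_lt_one _).le⟩
  have hmem : x - splitEquiv k (proj k x, t) ∈ lattice k := by
    refine mem_lattice_iff.2 ⟨by rw [map_sub, proj_splitEquiv, sub_self], fun j ↦
      ⟨⌊x j.succ.succ.succ⌋, ?_⟩⟩
    rw [PiLp.sub_apply, splitEquiv_apply_succ]
    exact Int.self_sub_fract _
  have hq : mk k p (splitEquiv k (proj k x, t)) = mk k p x := mk_eq_mk.2 hmem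
  rw [← hq]
  exact mem_image_of_mem _ (mem_image_of_mem _ ⟨mem_closedBall_zero_iff.2 hx, ht⟩)

instance : ProperSpace (Model k p) := by
  refine ProperSpace.of_isCompact_closedBall_of_le 0 fun x r _ ↦ ?_
  refine (isCompact_tube (‖toE3 k p x‖ + r)).of_isClosed_subset Metric.isClosed_closedBall ?_
  intro y hy
  have h := abs_le.1 (abs_norm_toE3_sub_le y x)
  have h2 := Metric.mem_closedBall.1 hy
  change ‖toE3 k p y‖ ≤ _
  linarith [h.1]

lemma isCompact_core : IsCompact (core k p) := by
  have h := isCompact_tube (k := k) (p := p) 0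
  simp only [norm_le_zero_iff] at h
  exact h

lemma isClosed_core : IsClosed (core k p) := isClosed_eq continuous_toE3 continuous_const

lemma thickening_core (r : ℝ) :
    Metric.thickening r (core k p) = {x | ‖toE3 k p x‖ < r} := by
  ext x
  rw [Metric.mem_thickening_iff_infDist_lt core_nonempty, infDist_core]
  rfl

end Model
end CodimThree

/-! ### The invariant measure -/

namespace CodimThree

variable {k : ℕ} {p : Profile}

/-- The fundamental domain `ℝ³ × [0, 1)ᵏ` of the covering. -/
def fundDomain (k : ℕ) : Set (Cover k) := {x | ∀ j : Fin k, x j.succ.succ.succ ∈ Ico (0 : ℝ) 1}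

lemma measurableSet_fundDomain : MeasurableSet (fundDomain k) := by
  have h : fundDomain k = ⋂ j : Fin k, (fun x : Cover k ↦ x j.succ.succ.succ) ⁻¹' Ico 0 1 := by
    ext x
    simp [fundDomain]
  rw [h]
  exact MeasurableSet.iInter fun j ↦ measurableSet_Ico.preimage
    (by fun_prop : Continuous fun x : Cover k ↦ x j.succ.succ.succ).measurable

lemma eq_zero_of_mem_lattice {x : Cover k} (hx : x ∈ lattice k)
    (h : ∀ j : Fin k, |x j.succ.succ.succ| < 1) : x = 0 := by
  have h0 : (splitEquiv k).symm x = 0 := by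
    refine Prod.ext hx.1 ?_
    ext j
    obtain ⟨m, hm⟩ : ∃ m : ℤ, x j.succ.succ.succ = (m : ℝ) := hx.2 j.succ.succ.succ
    have h1 : |(m : ℝ)| < 1 := hm ▸ h j
    have h2 : |m| < 1 := by exact_mod_cast h1
    change x j.succ.succ.succ = (0 : ℝ)
    rw [hm, Int.abs_lt_one_iff.mp h2, Int.cast_zero]
  exact (splitEquiv k).symm.map_eq_zero_iff.1 h0

lemma isAddFundamentalDomain_fundDomain :
    IsAddFundamentalDomain (lattice k).op (fundDomain k) (volume : Measure (Cover k)) := by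
  refine IsAddFundamentalDomain.mk' measurableSet_fundDomain.nullMeasurableSet fun x ↦ ?_
  let v : Cover k := splitEquiv k (0, WithLp.toLp 2 fun j ↦ -(⌊x j.succ.succ.succ⌋ : ℝ))
  have hv : v ∈ lattice k := by
    refine mem_lattice_iff.2 ⟨proj_splitEquiv _, fun j ↦ ⟨-⌊x j.succ.succ.succ⌋, ?_⟩⟩
    rw [splitEquiv_apply_succ, Int.cast_neg]
  refine ⟨⟨AddOpposite.op v, hv⟩, fun j ↦ ?_, fun g hg ↦ ?_⟩
  · have h : (x + v) j.succ.succ.succ = Int.fract (x j.succ.succ.succ) := by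
      rw [PiLp.add_apply, splitEquiv_apply_succ]
      exact Int.self_sub_floor _
    change (x + v) j.succ.succ.succ ∈ _
    rw [h]
    exact ⟨Int.fract_nonneg _, Int.fract_lt_one _⟩
  · obtain ⟨g, hg'⟩ := g
    have hg2 : g.unop ∈ lattice k := hg'
    have hd : g.unop - v = 0 := by
      refine eq_zero_of_mem_lattice (sub_mem hg2 hv) fun j ↦ ?_
      have h1 : x j.succ.succ.succ + g.unop j.succ.succ.succ ∈ Ico (0 : ℝ) 1 := hg j
      have h2 : v j.succ.succ.succ = -(⌊x j.succ.succ.succ⌋ : ℝ) := splitEquiv_apply_succ _ _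
      have h3 := Int.fract_nonneg (x j.succ.succ.succ)
      have h4 := Int.fract_lt_one (x j.succ.succ.succ)
      rw [← Int.self_sub_floor] at h3 h4
      rw [PiLp.sub_apply, h2, abs_lt]
      constructor <;> linarith [h1.1, h1.2]
    exact Subtype.ext (AddOpposite.unop_injective (sub_eq_zero.1 hd))

/-- The push-forward of Lebesgue measure on a fundamental domain. It is an invariant measure on the
group `ℝ³ × 𝕋ᵏ`. -/
def haar (k : ℕ) (p : Profile) : Measure (Model k p) :=
  Measure.map (Model.mk k p) (volume.restrict (fundDomain k))

namespace Model

lemma haar_apply {A : Set (Model k p)} (hA : MeasurableSet A) :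
    haar k p A = volume (mk k p ⁻¹' A ∩ fundDomain k) := by
  rw [haar, Measure.map_apply continuous_mk.measurable hA,
    Measure.restrict_apply (continuous_mk.measurable hA)]

instance : (haar k p).IsAddLeftInvariant := by
  have hF := isAddFundamentalDomain_fundDomain (k := k)
  have : HasAddFundamentalDomain (lattice k).op (Cover k) volume := ⟨⟨_, hF⟩⟩
  have : AddQuotientMeasureEqMeasurePreimage (volume : Measure (Cover k))
      (Measure.map (QuotientAddGroup.mk (s := lattice k)) (volume.restrict (fundDomain k))) :=
    hF.addQuotientMeasureEqMeasurePreimage_addQuotientMeasure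
  exact AddQuotientMeasureEqMeasurePreimage.addInvariantMeasure_quotient
    (μ := Measure.map (QuotientAddGroup.mk (s := lattice k)) (volume.restrict (fundDomain k)))
    (volume : Measure (Cover k))

open scoped Pointwise in
/-- On the domain of a chart the invariant measure is Lebesgue measure. -/
lemma haar_apply_of_subset_ball {A : Set (Model k p)} (hA : MeasurableSet A) {c : Cover k}
    (hAc : A ⊆ mk k p '' Metric.ball c (1 / 2)) :
    haar k p A = volume (mk k p ⁻¹' A ∩ Metric.ball c (1 / 2)) := by
  set W := mk k p ⁻¹' A ∩ Metric.ball c (1 / 2) with hW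
  have hWm : MeasurableSet W := (continuous_mk.measurable hA).inter measurableSet_ball
  rw [haar_apply hA, isAddFundamentalDomain_fundDomain.measure_eq_tsum W]
  have hsm : ∀ g : (lattice k).op, g +ᵥ W = (fun x ↦ x - g.1.unop) ⁻¹' W := by
    intro g
    ext x
    rw [mem_vadd_set]
    constructor
    · rintro ⟨y, hy, rfl⟩
      change y + g.1.unop - g.1.unop ∈ W
      rwa [add_sub_cancel_right]
    · intro hx
      refine ⟨_, hx, ?_⟩
      change x - g.1.unop + g.1.unop = x
      rw [sub_add_cancel]
  rw [← measure_iUnion]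
  · congr 1
    ext x
    simp only [mem_inter_iff, mem_iUnion, hsm, mem_preimage]
    constructor
    · rintro ⟨hxA, hxF⟩
      obtain ⟨y, hy, hyx⟩ := hAc hxA
      refine ⟨⟨AddOpposite.op (x - y), mk_eq_mk.1 hyx⟩, ⟨?_, ?_⟩, hxF⟩
      · change mk k p (x - (x - y)) ∈ A
        rw [sub_sub_cancel, hyx]
        exact hxA
      · change x - (x - y) ∈ _
        rwa [sub_sub_cancel]
    · rintro ⟨g, ⟨h1, -⟩, hxF⟩
      refine ⟨?_, hxF⟩
      have h2 : mk k p (x - g.1.unop) = mk k p x := by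
        rw [mk_eq_mk, sub_sub_cancel]
        exact g.2
      rwa [mem_preimage, h2] at h1
  · intro g g' hgg'
    refine Set.disjoint_left.2 fun x hx hx' ↦ hgg' ?_
    simp only [hsm] at hx hx'
    have h1 : mk k p (x - g.1.unop) = mk k p (x - g'.1.unop) := by
      rw [mk_eq_mk, sub_sub_sub_cancel_left]
      exact sub_mem (show g.1.unop ∈ lattice k from g.2) (show g'.1.unop ∈ lattice k from g'.2)
    have h2 := injOn_mk_ball c hx.1.2 hx'.1.2 h1
    exact Subtype.ext (AddOpposite.unop_injective (sub_right_injective h2))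
  · intro g
    rw [hsm]
    exact ((measurable_id.sub_const _) hWm).inter measurableSet_fundDomain

instance : IsFiniteMeasureOnCompacts (haar k p) where
  lt_top_of_isCompact K hK := by
    obtain ⟨R, hR⟩ := hK.exists_bound_of_continuousOn
      (continuous_toE3 (k := k) (p := p)).continuousOn
    refine (measure_mono (t := {x | ‖toE3 k p x‖ ≤ R}) hR).trans_lt ?_
    rw [haar_apply (isCompact_tube R).measurableSet]
    have h1 : IsCompact (WithLp.toLp 2 '' (univ.pi fun _ : Fin k ↦ Icc (0 : ℝ) 1)) :=
      (isCompact_univ_pi fun _ ↦ isCompact_Icc).image (PiLp.continuous_toLp 2 _)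
    refine (measure_mono ?_).trans_lt (((isCompact_closedBall (0 : E3) R).prod h1).image
      (splitEquiv k).continuous).measure_lt_top
    rintro x ⟨hx, hxF⟩
    refine ⟨(proj k x, WithLp.toLp 2 fun j ↦ x j.succ.succ.succ),
      ⟨mem_closedBall_zero_iff.2 hx, mem_image_of_mem _ fun j _ ↦ Ico_subset_Icc_self (hxF j)⟩, ?_⟩
    exact (splitEquiv k).apply_symm_apply x

instance : (haar k p).IsOpenPosMeasure where
  open_pos U hU hne := by
    obtain ⟨x, hx⟩ := hne
    obtain ⟨c, rfl⟩ := mk_surjective x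
    have hVo : IsOpen (mk k p '' Metric.ball c (1 / 2)) := isOpenMap_mk _ Metric.isOpen_ball
    have hm : MeasurableSet (U ∩ mk k p '' Metric.ball c (1 / 2)) := (hU.inter hVo).measurableSet
    have hc : c ∈ Metric.ball c (1 / 2 : ℝ) := Metric.mem_ball_self (by norm_num)
    refine (lt_of_lt_of_le ?_ (measure_mono (inter_subset_left
      (t := mk k p '' Metric.ball c (1 / 2))))).ne'
    rw [haar_apply_of_subset_ball hm inter_subset_right]
    exact (((hU.inter hVo).preimage continuous_mk).inter Metric.isOpen_ball).measure_pos _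
      ⟨c, ⟨hx, c, hc, rfl⟩, hc⟩

instance : (haar k p).IsAddHaarMeasure where

lemma toE3_surjective : Function.Surjective (toE3 k p) := fun a ↦
  ⟨mk k p (splitEquiv k (a, 0)), by rw [toE3_mk, proj_splitEquiv]⟩

/-- The push-forward of the invariant measure to `ℝ³` is a multiple of Lebesgue measure. -/
instance : (Measure.map (toE3 k p) (haar k p)).IsAddHaarMeasure := by
  refine Measure.isAddHaarMeasure_map _ (toE3 k p) continuous_toE3 toE3_surjective ?_
  refine hasBasis_cocompact.tendsto_right_iff.2 fun K hK ↦ ?_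
  obtain ⟨R, hR⟩ := hK.isBounded.exists_norm_le
  exact mem_cocompact.2 ⟨_, isCompact_tube R, fun x hx hxK ↦ hx (hR _ hxK)⟩

end Model
end CodimThree

/-! ### The Riemannian volume -/

namespace CodimThree

variable {k : ℕ} {p : Profile}

/-- The standard basis of the cover. -/
def basisVec (i : Fin (k + 3)) : Cover k := EuclideanSpace.single i (1 : ℝ)

/-- The coordinates of a vector of `ℝ³`, extended by zero. -/
def headCoord (a : E3) (i : Fin (k + 3)) : ℝ := inner ℝ a (proj k (basisVec i))

/-- The indicator function of the first three indices. -/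
def headInd (i : Fin (k + 3)) : ℝ := if i.val < 3 then 1 else 0

lemma proj_basisVec_of_lt {i : Fin (k + 3)} (h : i.val < 3) :
    proj k (basisVec i) = EuclideanSpace.single ⟨i, h⟩ 1 := by
  ext j
  rw [proj_apply, basisVec, PiLp.single_apply, PiLp.single_apply]
  simp only [Fin.ext_iff, Fin.val_castLE]

lemma proj_basisVec_of_not_lt {i : Fin (k + 3)} (h : ¬ i.val < 3) : proj k (basisVec i) = 0 := by
  ext j
  rw [proj_apply, basisVec, PiLp.single_apply, if_neg]
  · rfl
  · intro hij
    rw [← hij] at h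
    exact h j.isLt

lemma headCoord_castLE (a : E3) (i : Fin 3) :
    headCoord a (Fin.castLE (Nat.le_add_left 3 k) i) = a i := by
  rw [headCoord, proj_basisVec_of_lt (by simp), EuclideanSpace.inner_single_right, one_mul]
  rfl

lemma headCoord_succ (a : E3) (j : Fin k) : headCoord a j.succ.succ.succ = 0 := by
  rw [headCoord, proj_basisVec_of_not_lt (by simp), inner_zero_right]

lemma headInd_castLE (i : Fin 3) : headInd (Fin.castLE (Nat.le_add_left 3 k) i) = 1 := by
  simp [headInd]

lemma headInd_succ (j : Fin k) : headInd j.succ.succ.succ = 0 := by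
  simp [headInd]

lemma headInd_mul_headCoord (a : E3) (i : Fin (k + 3)) :
    headInd i * headCoord a i = headCoord a i := by
  rw [headInd]
  split_ifs with h
  · rw [one_mul]
  · rw [headCoord, proj_basisVec_of_not_lt h, inner_zero_right, mul_zero]

lemma headInd_mul_self (i : Fin (k + 3)) : headInd i * headInd i = headInd i := by
  rw [headInd]
  split_ifs <;> simp

lemma sum_headCoord_mul_self (a : E3) :
    ∑ i : Fin (k + 3), headCoord a i * headCoord a i = ‖a‖ ^ 2 := by
  rw [sum_split, EuclideanSpace.norm_sq_eq]
  simp only [headCoord_castLE, headCoord_succ, mul_zero, Finset.sum_const_zero, add_zero,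
    Real.norm_eq_abs, sq_abs]
  simp only [sq]

lemma sum_headInd : ∑ i : Fin (k + 3), headInd i = 3 := by
  rw [sum_split]
  simp only [headInd_castLE, headInd_succ, Finset.sum_const_zero, add_zero, Finset.sum_const,
    Finset.card_univ, Fintype.card_fin, nsmul_eq_mul, mul_one, Nat.cast_ofNat]

lemma inner_proj_basisVec (i j : Fin (k + 3)) :
    inner ℝ (proj k (basisVec i)) (proj k (basisVec j)) = if i = j then headInd i else (0 : ℝ) := by
  by_cases hi : i.val < 3
  · by_cases hj : j.val < 3
    · rw [proj_basisVec_of_lt hi, proj_basisVec_of_lt hj, headInd, if_pos hi,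
        EuclideanSpace.inner_single_right, one_mul]
      simp [PiLp.single_apply, Fin.ext_iff, eq_comm]
    · rw [proj_basisVec_of_not_lt hj, inner_zero_right, if_neg]
      rintro rfl
      exact hj hi
  · rw [proj_basisVec_of_not_lt hi, inner_zero_left, headInd, if_neg hi, ite_self]

/-- The matrix `a aᵀ - |a|² Q`, where `Q` is the projection onto the first three coordinates. It
annihilates `a`, and its square is `-|a|²` times itself. -/
def rotMatrix (k : ℕ) (a : E3) : Matrix (Fin (k + 3)) (Fin (k + 3)) ℝ :=
  Matrix.of fun i j ↦ headCoord a i * headCoord a j - ‖a‖ ^ 2 * if i = j then headInd i else 0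

lemma sum_rotMatrix_mul (a : E3) (i : Fin (k + 3)) (v : Fin (k + 3) → ℝ) :
    ∑ j, rotMatrix k a i j * v j =
      headCoord a i * ∑ j, headCoord a j * v j - ‖a‖ ^ 2 * headInd i * v i := by
  simp only [rotMatrix, Matrix.of_apply, sub_mul, Finset.sum_sub_distrib, mul_assoc,
    ← Finset.mul_sum, ite_mul, zero_mul, Finset.sum_ite_eq, Finset.mem_univ, if_true]

lemma sum_rotMatrix_mul_headCoord (a : E3) (i : Fin (k + 3)) :
    ∑ j, rotMatrix k a i j * headCoord a j = 0 := by
  rw [sum_rotMatrix_mul, sum_headCoord_mul_self, mul_assoc, headInd_mul_headCoord]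
  ring

lemma rotMatrix_mul_self (a : E3) :
    rotMatrix k a * rotMatrix k a = -(‖a‖ ^ 2) • rotMatrix k a := by
  ext i l
  have h : ∑ j, headCoord a j * rotMatrix k a j l = 0 := by
    rw [← sum_rotMatrix_mul_headCoord a l]
    refine Finset.sum_congr rfl fun j _ ↦ ?_
    rw [mul_comm]
    congr 1
    simp only [rotMatrix, Matrix.of_apply]
    rw [mul_comm (headCoord a j)]
    by_cases hjl : j = l
    · rw [hjl]
    · rw [if_neg hjl, if_neg (Ne.symm hjl)]
  rw [Matrix.mul_apply, sum_rotMatrix_mul, h, Matrix.smul_apply, smul_eq_mul, mul_zero, zero_sub,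
    mul_assoc, neg_mul]
  congr 2
  simp only [rotMatrix, Matrix.of_apply]
  rw [mul_sub, ← mul_assoc, headInd_mul_headCoord, mul_left_comm]
  by_cases hil : i = l
  · simp only [if_pos hil, headInd_mul_self]
  · simp only [if_neg hil, mul_zero]

/-- The Gram matrix of the metric in the coordinates of the cover. -/
lemma metricForm_basisVec (a : E3) :
    (Matrix.of fun i j ↦ metricForm k p a (basisVec i) (basisVec j)) =
      1 + p.kappa (‖a‖ ^ 2) • rotMatrix k a := by
  ext i j
  rw [Matrix.of_apply, metricForm_apply, inner_proj_basisVec, Matrix.add_apply, Matrix.smul_apply,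
    smul_eq_mul, rotMatrix, Matrix.of_apply, Matrix.one_apply]
  congr 1
  rw [basisVec, basisVec, EuclideanSpace.inner_single_right, one_mul]
  simp [PiLp.single_apply, eq_comm]

/-- The coefficients of the divergence form of the Laplacian: `√(det g) gⁱʲ`. -/
def coeff (k : ℕ) (p : Profile) (a : E3) : Matrix (Fin (k + 3)) (Fin (k + 3)) ℝ :=
  p.phi (‖a‖ ^ 2) • 1 - p.kappa (‖a‖ ^ 2) • rotMatrix k a

lemma inv_gramMatrix (a : E3) :
    (1 + p.kappa (‖a‖ ^ 2) • rotMatrix k a)⁻¹ = (p.phi (‖a‖ ^ 2))⁻¹ • coeff k p a := by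
  have hφ : p.phi (‖a‖ ^ 2) ≠ 0 := (p.phi_pos (sq_nonneg _)).ne'
  refine Matrix.inv_eq_right_inv ?_
  have h : (1 + p.kappa (‖a‖ ^ 2) • rotMatrix k a) * coeff k p a = p.phi (‖a‖ ^ 2) • 1 := by
    rw [coeff, add_mul, one_mul, mul_sub, Matrix.mul_smul, Matrix.mul_one, Matrix.smul_mul,
      Matrix.mul_smul, rotMatrix_mul_self, Profile.phi]
    module
  rw [Matrix.mul_smul, h, smul_smul, inv_mul_cancel₀ hφ, one_smul]

lemma det_gramMatrix (a : E3) :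
    (1 + p.kappa (‖a‖ ^ 2) • rotMatrix k a).det = p.phi (‖a‖ ^ 2) ^ 2 := by
  have hφ : p.phi (‖a‖ ^ 2) ≠ 0 := (p.phi_pos (sq_nonneg _)).ne'
  set φ := p.phi (‖a‖ ^ 2) with hφd
  let d : Fin (k + 3) → ℝ := fun i ↦ if i.val < 3 then φ else 1
  have hd : ∀ i, d i ≠ 0 := fun i ↦ by
    simp only [d]
    split_ifs
    exacts [hφ, one_ne_zero]
  have hsplit : 1 + p.kappa (‖a‖ ^ 2) • rotMatrix k a = Matrix.diagonal d +
      Matrix.replicateCol Unit (p.kappa (‖a‖ ^ 2) • headCoord a) *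
        Matrix.replicateRow Unit (headCoord a) := by
    ext i j
    simp only [Matrix.add_apply, Matrix.smul_apply, rotMatrix, Matrix.of_apply, Matrix.one_apply,
      Matrix.diagonal_apply, Matrix.mul_apply, Matrix.replicateCol_apply,
      Matrix.replicateRow_apply, Finset.univ_unique, Finset.sum_singleton, Pi.smul_apply,
      smul_eq_mul, headInd, d]
    split_ifs <;> first | (simp only [hφd, Profile.phi]; ring) | ring
  have hprod : ∏ i, d i = φ ^ 3 := by
    have h3 : ∀ j : Fin k, ¬ j.val + 1 + 1 + 1 < 3 := fun j ↦ by omega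
    rw [prod_split]
    simp [d, h3]
  have hdet : IsUnit (Matrix.diagonal d).det := by
    rw [Matrix.det_diagonal, hprod]
    exact (pow_ne_zero 3 hφ).isUnit
  rw [hsplit, Matrix.det_add_replicateCol_mul_replicateRow hdet, Matrix.det_diagonal, hprod,
    Matrix.det_unique]
  have hsum : ∑ i : Fin (k + 3), headCoord a i * (d i)⁻¹ * (p.kappa (‖a‖ ^ 2) * headCoord a i) =
      φ⁻¹ * p.kappa (‖a‖ ^ 2) * ‖a‖ ^ 2 := by
    rw [← sum_headCoord_mul_self (k := k), Finset.mul_sum]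
    refine Finset.sum_congr rfl fun i _ ↦ ?_
    by_cases hi : i.val < 3
    · simp only [d, if_pos hi]
      ring
    · rw [headCoord, proj_basisVec_of_not_lt hi, inner_zero_right]
      ring
  have hinv : (Matrix.diagonal d)⁻¹ = Matrix.diagonal fun i ↦ (d i)⁻¹ := by
    refine Matrix.inv_eq_right_inv ?_
    rw [Matrix.diagonal_mul_diagonal]
    simp [hd]
  rw [Matrix.add_apply, hinv, Matrix.mul_apply, Matrix.one_apply_eq]
  simp only [Matrix.mul_diagonal, Matrix.replicateRow_apply, Matrix.replicateCol_apply,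
    Pi.smul_apply, smul_eq_mul, hsum]
  have h1 : p.kappa (‖a‖ ^ 2) * ‖a‖ ^ 2 = 1 - φ := by
    rw [hφd, Profile.phi]
    ring
  rw [mul_assoc, h1]
  field_simp
  ring

namespace Model

lemma gram_chart (c y : Cover k) :
    Riem.gram (chart p c) y = 1 + p.kappa (‖proj k y‖ ^ 2) • rotMatrix k (proj k y) := by
  rw [← metricForm_basisVec]
  ext i j
  have h : ∀ i, Riem.coordVec (chart p c) y i = basisVec i := fun i ↦
    DFunLike.congr_fun (mfderiv_mk (p := p) y) (basisVec i)
  rw [Riem.gram, Matrix.of_apply, Matrix.of_apply, h, h]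
  rfl

lemma density_chart (c y : Cover k) :
    Riem.density (chart p c) y = p.phi (‖proj k y‖ ^ 2) := by
  rw [Riem.density, gram_chart, det_gramMatrix, Real.sqrt_sq (p.phi_pos (sq_nonneg _)).le]

/-- The Riemannian volume measure of `ℝ³_σ × 𝕋ᵏ`. -/
def vol (k : ℕ) (p : Profile) : Measure (Model k p) :=
  (haar k p).withDensity fun x ↦ ENNReal.ofReal (p.phi (‖toE3 k p x‖ ^ 2))

lemma continuous_phi_toE3 : Continuous fun x : Model k p ↦ p.phi (‖toE3 k p x‖ ^ 2) :=
  contDiff_phi_norm_sq.continuous.comp continuous_toE3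

lemma isRiemannianVolume_vol : Riem.IsRiemannianVolume (k + 3) (vol k p) := by
  rintro _ ⟨c, rfl⟩ A hA hAc
  have hd : Measurable fun x : Model k p ↦ ENNReal.ofReal (p.phi (‖toE3 k p x‖ ^ 2)) :=
    continuous_phi_toE3.measurable.ennreal_ofReal
  have himg : chart p c '' A = mk k p ⁻¹' A ∩ Metric.ball c (1 / 2) := by
    ext y
    constructor
    · rintro ⟨x, hx, rfl⟩
      refine ⟨?_, (chart p c).map_source (hAc hx)⟩
      rw [mem_preimage, ← coe_chart_symm (p := p) c, (chart p c).left_inv (hAc hx)]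
      exact hx
    · rintro ⟨hy, hyb⟩
      exact ⟨mk k p y, hy, chart_mk hyb⟩
  have hmap : (haar k p).restrict A =
      Measure.map (mk k p) (volume.restrict (mk k p ⁻¹' A ∩ Metric.ball c (1 / 2))) := by
    ext B hB
    rw [Measure.restrict_apply hB, Measure.map_apply continuous_mk.measurable hB,
      Measure.restrict_apply (continuous_mk.measurable hB),
      haar_apply_of_subset_ball (hB.inter hA) (inter_subset_right.trans hAc), preimage_inter,
      inter_assoc]
  rw [vol, withDensity_apply _ hA, hmap, lintegral_map hd continuous_mk.measurable, himg]
  simp only [density_chart, toE3_mk]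

end Model
end CodimThree

/-! ### The Laplacian in the coordinates of the cover -/

namespace CodimThree

variable {k : ℕ} {p : Profile}

lemma coeff_symm (a : E3) (i j : Fin (k + 3)) : coeff k p a i j = coeff k p a j i := by
  simp only [coeff, rotMatrix, Matrix.sub_apply, Matrix.smul_apply, Matrix.one_apply,
    Matrix.of_apply, smul_eq_mul]
  by_cases h : i = j
  · rw [h]
  · rw [if_neg h, if_neg (Ne.symm h), if_neg h, if_neg (Ne.symm h)]
    ring

/-- The radial direction is an eigenvector of the coefficient matrix, with eigenvalue `φ`. -/
lemma sum_coeff_mul_headCoord (a : E3) (i : Fin (k + 3)) :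
    ∑ j, coeff k p a i j * headCoord a j = p.phi (‖a‖ ^ 2) * headCoord a i := by
  have h := sum_rotMatrix_mul_headCoord a i
  simp only [coeff, Matrix.sub_apply, Matrix.smul_apply, Matrix.one_apply, smul_eq_mul, sub_mul,
    mul_assoc, Finset.sum_sub_distrib, ← Finset.mul_sum, h, ite_mul, one_mul, zero_mul,
    Finset.sum_ite_eq, Finset.mem_univ, if_true, mul_zero, sub_zero]

lemma contDiff_headCoord (i : Fin (k + 3)) {m : WithTop ℕ∞} :
    ContDiff ℝ m fun a : E3 ↦ headCoord a i :=
  contDiff_id.inner ℝ contDiff_const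

lemma contDiff_coeff (i j : Fin (k + 3)) : ContDiff ℝ 2 fun a : E3 ↦ coeff k p a i j := by
  simp only [coeff, rotMatrix, Matrix.sub_apply, Matrix.smul_apply, Matrix.of_apply, smul_eq_mul]
  exact (contDiff_phi_norm_sq.mul contDiff_const).sub (contDiff_kappa_norm_sq.mul
    (((contDiff_headCoord i).mul (contDiff_headCoord j)).sub
      ((contDiff_norm_sq ℝ).mul contDiff_const)))

lemma hasFDerivAt_norm {a : E3} (ha : a ≠ 0) :
    HasFDerivAt (fun a : E3 ↦ ‖a‖) (‖a‖⁻¹ • innerSL ℝ a) a := by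
  have h0 : ‖a‖ ^ 2 ≠ 0 := by positivity
  have h1 := (hasStrictFDerivAt_norm_sq a).hasFDerivAt.sqrt h0
  simp only [Real.sqrt_sq (norm_nonneg _)] at h1
  refine h1.congr_fderiv ?_
  have : ‖a‖ ≠ 0 := norm_ne_zero_iff.2 ha
  ext v
  simp only [smul_apply, innerSL_apply_apply, smul_eq_mul, nsmul_eq_mul, Nat.cast_ofNat]
  field_simp

namespace Model

/-- The `i`-th partial derivative of a function on the model, in the coordinates of the cover. -/
def pd (i : Fin (k + 3)) (f : Model k p → ℝ) (x : Model k p) : ℝ :=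
  fderiv ℝ (f ∘ mk k p) (rep x) (basisVec i)

lemma pd_mk (i : Fin (k + 3)) (f : Model k p → ℝ) (y : Cover k) :
    pd i f (mk k p y) = fderiv ℝ (f ∘ mk k p) y (basisVec i) := by
  set γ := rep (mk k p y) - y with hγ
  have hmem : γ ∈ lattice k := mk_eq_mk.1 (mk_rep (mk k p y)).symm
  have h1 : (fun z ↦ (f ∘ mk k p) (z + γ)) = f ∘ mk k p := by
    ext z
    refine congrArg f (mk_eq_mk.2 ?_).symm
    rwa [add_sub_cancel_left]
  have h2 := fderiv_comp_add_right (𝕜 := ℝ) (f := f ∘ mk k p) (x := y) γ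
  rw [h1, hγ, add_sub_cancel] at h2
  rw [pd, h2]

lemma pd_comp_mk (i : Fin (k + 3)) (f : Model k p → ℝ) :
    pd i f ∘ mk k p = fun y ↦ fderiv ℝ (f ∘ mk k p) y (basisVec i) :=
  funext fun y ↦ pd_mk i f y

/-- The components of the vector field `√(det g) ∇f`. -/
def flux (f : Model k p → ℝ) (i : Fin (k + 3)) (x : Model k p) : ℝ :=
  ∑ j, coeff k p (toE3 k p x) i j * pd j f x

/-- The Laplacian is `φ⁻¹ ∑ᵢ ∂ᵢ (√(det g) gⁱʲ ∂ⱼ f)`, in the coordinates of the cover, since all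
charts are local inverses of the covering map. -/
lemma laplacian_eq (f : Model k p → ℝ) (x : Model k p) :
    Riem.laplacian (k + 3) f x = (p.phi (‖toE3 k p x‖ ^ 2))⁻¹ * ∑ i, pd i (flux f i) x := by
  rw [Riem.laplacian]
  have hx : chart p (rep x) x = rep x := chartAt_self x
  simp only [chartAt_eq, density_chart, gram_chart, coe_chart_symm, hx, proj_rep]
  congr 1
  refine Finset.sum_congr rfl fun i _ ↦ ?_
  rw [pd]
  congr 2
  ext y
  have hφ : p.phi (‖proj k y‖ ^ 2) ≠ 0 := (p.phi_pos (sq_nonneg _)).ne'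
  rw [Function.comp_apply, flux, Finset.mul_sum]
  refine Finset.sum_congr rfl fun j _ ↦ ?_
  rw [inv_gramMatrix, Matrix.smul_apply, smul_eq_mul, toE3_mk, pd_mk, basisVec]
  field_simp

lemma contDiffAt_pd {f : Model k p → ℝ} {m n : WithTop ℕ∞} {y : Cover k}
    (hf : ContDiffAt ℝ n (f ∘ mk k p) y) (hmn : m + 1 ≤ n) (i : Fin (k + 3)) :
    ContDiffAt ℝ m (pd i f ∘ mk k p) y := by
  rw [pd_comp_mk]
  exact (hf.fderiv_right hmn).clm_apply contDiffAt_const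

lemma contDiffAt_flux {f : Model k p → ℝ} {y : Cover k}
    (hf : ContDiffAt ℝ 2 (f ∘ mk k p) y) (i : Fin (k + 3)) :
    ContDiffAt ℝ 1 (flux f i ∘ mk k p) y := by
  have h : flux f i ∘ mk k p =
      fun y ↦ ∑ j, coeff k p (proj k y) i j * (pd j f ∘ mk k p) y := rfl
  rw [h]
  refine ContDiffAt.sum fun j _ ↦ ContDiffAt.mul ?_ (contDiffAt_pd hf (by norm_num) j)
  exact ((contDiff_coeff i j).comp (proj k).contDiff).contDiffAt.of_le (by norm_num)

lemma pd_mul {f g : Model k p → ℝ} {y : Cover k} (hf : DifferentiableAt ℝ (f ∘ mk k p) y)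
    (hg : DifferentiableAt ℝ (g ∘ mk k p) y) (i : Fin (k + 3)) :
    pd i (fun x ↦ f x * g x) (mk k p y) =
      f (mk k p y) * pd i g (mk k p y) + g (mk k p y) * pd i f (mk k p y) := by
  rw [pd_mk, pd_mk, pd_mk]
  have h := fderiv_mul hf hg
  have h2 : (fun x ↦ f x * g x) ∘ mk k p = (f ∘ mk k p) * (g ∘ mk k p) := rfl
  rw [h2, h]
  rfl

lemma pd_sub {f g : Model k p → ℝ} {y : Cover k} (hf : DifferentiableAt ℝ (f ∘ mk k p) y)
    (hg : DifferentiableAt ℝ (g ∘ mk k p) y) (i : Fin (k + 3)) :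
    pd i (fun x ↦ f x - g x) (mk k p y) = pd i f (mk k p y) - pd i g (mk k p y) := by
  rw [pd_mk, pd_mk, pd_mk]
  have h := fderiv_sub hf hg
  have h2 : (fun x ↦ f x - g x) ∘ mk k p = (f ∘ mk k p) - (g ∘ mk k p) := rfl
  rw [h2, h]
  rfl

/-- The components of `√(det g) (f ∇g - g ∇f)`. -/
def crossFlux (f g : Model k p → ℝ) (i : Fin (k + 3)) (x : Model k p) : ℝ :=
  f x * flux g i x - g x * flux f i x

/-- Green's identity in divergence form. -/
lemma sum_pd_crossFlux {f g : Model k p → ℝ} {y : Cover k}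
    (hf : ContDiffAt ℝ 2 (f ∘ mk k p) y) (hg : ContDiffAt ℝ 2 (g ∘ mk k p) y) :
    ∑ i, pd i (crossFlux f g i) (mk k p y) = p.phi (‖proj k y‖ ^ 2) *
      (f (mk k p y) * Riem.laplacian (k + 3) g (mk k p y) -
        g (mk k p y) * Riem.laplacian (k + 3) f (mk k p y)) := by
  have hφ : p.phi (‖proj k y‖ ^ 2) ≠ 0 := (p.phi_pos (sq_nonneg _)).ne'
  have hfd := hf.differentiableAt two_ne_zero
  have hgd := hg.differentiableAt two_ne_zero
  have hff := fun i ↦ (contDiffAt_flux hf i).differentiableAt one_ne_zero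
  have hgf := fun i ↦ (contDiffAt_flux hg i).differentiableAt one_ne_zero
  have h1 : ∀ i, pd i (crossFlux f g i) (mk k p y) =
      (f (mk k p y) * pd i (flux g i) (mk k p y) - g (mk k p y) * pd i (flux f i) (mk k p y)) +
      (flux g i (mk k p y) * pd i f (mk k p y) - flux f i (mk k p y) * pd i g (mk k p y)) := by
    intro i
    have h := pd_sub (f := fun x ↦ f x * flux g i x) (g := fun x ↦ g x * flux f i x)
      (hfd.mul (hgf i)) (hgd.mul (hff i)) i
    rw [pd_mul hfd (hgf i), pd_mul hgd (hff i)] at h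
    exact h.trans (by ring)
  have h2 : ∑ i, (flux g i (mk k p y) * pd i f (mk k p y) -
      flux f i (mk k p y) * pd i g (mk k p y)) = 0 := by
    rw [Finset.sum_sub_distrib, sub_eq_zero]
    simp only [flux, Finset.sum_mul]
    rw [Finset.sum_comm]
    refine Finset.sum_congr rfl fun i _ ↦ Finset.sum_congr rfl fun j _ ↦ ?_
    rw [coeff_symm]
    ring
  rw [Finset.sum_congr rfl fun i _ ↦ h1 i, Finset.sum_add_distrib, h2, add_zero,
    Finset.sum_sub_distrib, ← Finset.mul_sum, ← Finset.mul_sum, laplacian_eq, laplacian_eq, toE3_mk]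
  field_simp

lemma contDiffAt_comp_norm {U : ℝ → ℝ} {m : WithTop ℕ∞} {y : Cover k} (hy : proj k y ≠ 0)
    (hU : ContDiffAt ℝ m U ‖proj k y‖) :
    ContDiffAt ℝ m ((fun x : Model k p ↦ U ‖toE3 k p x‖) ∘ mk k p) y :=
  show ContDiffAt ℝ m (fun z : Cover k ↦ U ‖proj k z‖) y from
    ContDiffAt.comp y hU (ContDiffAt.comp y (contDiffAt_norm ℝ hy) (proj k).contDiff.contDiffAt)

lemma hasFDerivAt_comp_norm {U : ℝ → ℝ} {u' : ℝ} {y : Cover k} (hy : proj k y ≠ 0)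
    (hU : HasDerivAt U u' ‖proj k y‖) :
    HasFDerivAt (fun z : Cover k ↦ U ‖proj k z‖)
      ((u' * ‖proj k y‖⁻¹) • (innerSL ℝ (proj k y)).comp (proj k)) y := by
  have h1 := (hasFDerivAt_norm hy).comp y (proj k).hasFDerivAt
  have h2 := hU.comp_hasFDerivAt y h1
  refine h2.congr_fderiv ?_
  ext v
  simp [mul_assoc]

/-- The Laplacian of a radial function: `(r² φ U')' / (r² φ)`. -/
lemma laplacian_radial {U V : ℝ → ℝ} {w : ℝ} {x : Model k p} (hx : toE3 k p x ≠ 0)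
    (hU : ∀ᶠ r in 𝓝 ‖toE3 k p x‖, HasDerivAt U (V r) r)
    (hV : HasDerivAt (fun r ↦ r ^ 2 * p.phi (r ^ 2) * V r) w ‖toE3 k p x‖) :
    Riem.laplacian (k + 3) (fun x : Model k p ↦ U ‖toE3 k p x‖) x =
      w / (‖toE3 k p x‖ ^ 2 * p.phi (‖toE3 k p x‖ ^ 2)) := by
  obtain ⟨y, rfl⟩ := mk_surjective x
  rw [laplacian_eq]
  rw [toE3_mk] at *
  set r := ‖proj k y‖ with hr
  have hr0 : r ≠ 0 := norm_ne_zero_iff.2 hx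
  set W : ℝ → ℝ := fun r ↦ r ^ 2 * p.phi (r ^ 2) * V r with hW
  -- the flux is radial: `√(det g) ∇U = φ U' x / r`
  have hflux : ∀ i, (flux (fun x : Model k p ↦ U ‖toE3 k p x‖) i ∘ mk k p) =ᶠ[𝓝 y]
      fun z ↦ (W ‖proj k z‖ / ‖proj k z‖ ^ 3) * headCoord (proj k z) i := by
    intro i
    have hc : Continuous fun z : Cover k ↦ ‖proj k z‖ := (proj k).continuous.norm
    have hne : ∀ᶠ z in 𝓝 y, proj k z ≠ 0 := (proj k).continuous.continuousAt.eventually_ne hx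
    filter_upwards [hc.continuousAt.eventually hU, hne] with z hz hz0
    have hpd : ∀ j, pd j (fun x : Model k p ↦ U ‖toE3 k p x‖) (mk k p z) =
        V ‖proj k z‖ * ‖proj k z‖⁻¹ * headCoord (proj k z) j := by
      intro j
      have h := (hasFDerivAt_comp_norm hz0 hz).fderiv
      rw [pd_mk]
      exact DFunLike.congr_fun h (basisVec j)
    rw [Function.comp_apply, flux]
    simp only [hpd, toE3_mk]
    have h1 : ∀ j, coeff k p (proj k z) i j *
        (V ‖proj k z‖ * ‖proj k z‖⁻¹ * headCoord (proj k z) j) =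
        V ‖proj k z‖ * ‖proj k z‖⁻¹ * (coeff k p (proj k z) i j * headCoord (proj k z) j) :=
      fun j ↦ by ring
    rw [Finset.sum_congr rfl fun j _ ↦ h1 j, ← Finset.mul_sum, sum_coeff_mul_headCoord, hW]
    have : ‖proj k z‖ ≠ 0 := norm_ne_zero_iff.2 hz0
    field_simp
  have hq : HasDerivAt (fun r ↦ W r / r ^ 3) ((w * r ^ 3 - W r * (3 * r ^ 2)) / (r ^ 3) ^ 2) r := by
    exact (hV.div (hasDerivAt_pow 3 r) (pow_ne_zero 3 hr0)).congr_deriv (by norm_num)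
  have hpd : ∀ i, pd i (flux (fun x : Model k p ↦ U ‖toE3 k p x‖) i) (mk k p y) =
      (w * r ^ 3 - W r * (3 * r ^ 2)) / (r ^ 3) ^ 2 * r⁻¹ *
        (headCoord (proj k y) i * headCoord (proj k y) i) + W r / r ^ 3 * headInd i := by
    intro i
    have hh : HasFDerivAt (fun z : Cover k ↦ headCoord (proj k z) i)
        ((innerSL ℝ (proj k (basisVec i))).comp (proj k)) y := by
      have := ((innerSL ℝ (proj k (basisVec i))).comp (proj k)).hasFDerivAt (x := y)
      refine this.congr_of_eventuallyEq (Eventually.of_forall fun z ↦ ?_)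
      exact real_inner_comm _ _
    have h := (hasFDerivAt_comp_norm hx hq).mul hh
    rw [pd_mk, (hflux i).fderiv_eq]
    refine (DFunLike.congr_fun h.fderiv (basisVec i)).trans ?_
    have h3 : inner ℝ (proj k (basisVec i)) (proj k (basisVec i)) = headInd i := by
      rw [inner_proj_basisVec, if_pos rfl]
    simp only [add_apply, smul_apply, ContinuousLinearMap.comp_apply, innerSL_apply_apply, h3,
      smul_eq_mul, ← hr]
    rw [headCoord]
    ring
  rw [Finset.sum_congr rfl fun i _ ↦ hpd i, Finset.sum_add_distrib, ← Finset.mul_sum,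
    ← Finset.mul_sum, sum_headCoord_mul_self, sum_headInd, ← hr]
  have hφ : p.phi (r ^ 2) ≠ 0 := (p.phi_pos (sq_nonneg _)).ne'
  field_simp
  ring

end Model
end CodimThree

/-! ### Green's identity -/

namespace CodimThree

variable {k : ℕ} {p : Profile}

namespace Model

lemma continuous_of_comp_mk {X : Type*} [TopologicalSpace X] {f : Model k p → X}
    (hf : Continuous (f ∘ mk k p)) : Continuous f :=
  isQuotientMap_mk.continuous_iff.2 hf

lemma pd_congr {f g : Model k p → ℝ} {x : Model k p} (h : f =ᶠ[𝓝 x] g) (i : Fin (k + 3)) :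
    pd i f x = pd i g x := by
  obtain ⟨y, rfl⟩ := mk_surjective x
  have h2 : f ∘ mk k p =ᶠ[𝓝 y] g ∘ mk k p := h.comp_tendsto continuous_mk.continuousAt
  rw [pd_mk, pd_mk, h2.fderiv_eq]

lemma flux_congr {f g : Model k p → ℝ} {x : Model k p} (h : f =ᶠ[𝓝 x] g) (i : Fin (k + 3)) :
    flux f i x = flux g i x := by
  simp only [flux, pd_congr h]

lemma laplacian_congr {f g : Model k p → ℝ} {x : Model k p} (h : f =ᶠ[𝓝 x] g) :
    Riem.laplacian (k + 3) f x = Riem.laplacian (k + 3) g x := by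
  have h2 : ∀ i, flux f i =ᶠ[𝓝 x] flux g i := fun i ↦
    h.eventually_nhds.mono fun z hz ↦ flux_congr hz i
  rw [laplacian_eq, laplacian_eq, Finset.sum_congr rfl fun i _ ↦ pd_congr (h2 i) i]

lemma pd_zero (i : Fin (k + 3)) (x : Model k p) : pd i (fun _ ↦ 0) x = 0 := by
  have h : (fun _ : Model k p ↦ (0 : ℝ)) ∘ mk k p = fun _ ↦ 0 := rfl
  simp [pd, h]

lemma flux_zero (i : Fin (k + 3)) : flux (fun _ : Model k p ↦ 0) i = fun _ ↦ 0 := by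
  ext x
  simp [flux, pd_zero]

lemma laplacian_zero (x : Model k p) : Riem.laplacian (k + 3) (fun _ : Model k p ↦ 0) x = 0 := by
  simp [laplacian_eq, flux_zero, pd_zero]

lemma continuous_pd {f : Model k p → ℝ} (hf : ∀ y, ContDiffAt ℝ 1 (f ∘ mk k p) y)
    (i : Fin (k + 3)) : Continuous (pd i f) :=
  continuous_of_comp_mk (continuous_iff_continuousAt.2 fun y ↦
    (contDiffAt_pd (m := 0) (hf y) (by norm_num) i).continuousAt)

lemma hasCompactSupport_pd {f : Model k p → ℝ} (hf : HasCompactSupport f) (i : Fin (k + 3)) :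
    HasCompactSupport (pd i f) :=
  HasCompactSupport.intro hf fun x hx ↦ by
    rw [pd_congr (notMem_tsupport_iff_eventuallyEq.1 hx) i]
    exact pd_zero i x

/-- A partial derivative of a compactly supported function integrates to zero, because the measure
is translation invariant. -/
lemma integral_pd {f : Model k p → ℝ} (hf : ∀ y, ContDiffAt ℝ 1 (f ∘ mk k p) y)
    (hc : HasCompactSupport f) (i : Fin (k + 3)) : ∫ x, pd i f x ∂haar k p = 0 := by
  set e : Cover k := basisVec i
  have hfc : Continuous f :=
    continuous_of_comp_mk (continuous_iff_continuousAt.2 fun y ↦ (hf y).continuousAt)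
  have hpc := continuous_pd hf i
  have hps := hasCompactSupport_pd hc i
  obtain ⟨M, hM⟩ := hps.exists_bound_of_continuous hpc
  have hM0 : 0 ≤ M := (norm_nonneg _).trans (hM 0)
  -- the translates of `f` by `t e` with `|t| ≤ 1` are supported in `B`
  let B : Set (Model k p) :=
    (fun q : Model k p × ℝ ↦ q.1 - mk k p (q.2 • e)) '' (tsupport f ×ˢ Icc (-1) 1)
  have hmkc : Continuous fun t : ℝ ↦ mk k p (t • e) :=
    continuous_mk.comp (continuous_id.smul continuous_const)
  have hB : IsCompact B := (hc.isCompact.prod isCompact_Icc).image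
    (continuous_fst.sub (hmkc.comp continuous_snd))
  have hder : ∀ (x : Model k p) (t : ℝ), HasDerivAt (fun t : ℝ ↦ f (x + mk k p (t • e)))
      (pd i f (x + mk k p (t • e))) t := by
    intro x t
    obtain ⟨y, rfl⟩ := mk_surjective x
    have h1 : HasDerivAt (fun t : ℝ ↦ y + t • e) e t := by
      simpa using ((hasDerivAt_id t).smul_const e).const_add y
    have h2 := ((hf (y + t • e)).differentiableAt one_ne_zero).hasFDerivAt.comp_hasDerivAt t h1
    rw [← map_add, pd_mk]
    refine h2.congr_of_eventuallyEq (Eventually.of_forall fun s ↦ ?_)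
    change f (mk k p y + mk k p (s • e)) = f (mk k p (y + s • e))
    rw [map_add]
  have key := hasDerivAt_integral_of_dominated_loc_of_deriv_le (μ := haar k p) (x₀ := (0 : ℝ))
    (F := fun t x ↦ f (x + mk k p (t • e))) (F' := fun t x ↦ pd i f (x + mk k p (t • e)))
    (s := Icc (-1) 1) (bound := B.indicator fun _ ↦ M) (Icc_mem_nhds (by norm_num) (by norm_num))
    (Eventually.of_forall fun t ↦
      (hfc.comp (continuous_id.add continuous_const)).aestronglyMeasurable)
    (by simpa using hfc.integrable_of_hasCompactSupport hc)
    (hpc.comp (continuous_id.add continuous_const)).aestronglyMeasurable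
    (Eventually.of_forall fun x t ht ↦ by
      by_cases hx : x ∈ B
      · rw [indicator_of_mem hx]
        exact hM _
      · rw [indicator_of_notMem hx, norm_le_zero_iff]
        by_contra hne
        refine hx ⟨(x + mk k p (t • e), t), ⟨?_, ht⟩, by simp⟩
        by_contra hxt
        refine hne ?_
        dsimp only at hxt
        rw [pd_congr (notMem_tsupport_iff_eventuallyEq.1 hxt) i]
        exact pd_zero i _)
    ((integrable_indicator_iff hB.measurableSet).2
      (integrableOn_const hB.measure_lt_top.ne (by simp)))
    (Eventually.of_forall fun x t _ ↦ hder x t)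
  -- the integral does not depend on `t`, so its derivative vanishes
  have h2 := key.2
  simp only [integral_add_right_eq_self (μ := haar k p) f, zero_smul, map_zero, add_zero] at h2
  exact h2.unique (hasDerivAt_const _ _)

/-- The core has measure zero. -/
lemma haar_core : haar k p (core k p) = 0 := by
  have h : Measure.map (toE3 k p) (haar k p) {0} = 0 := measure_singleton 0
  rwa [Measure.map_apply continuous_toE3.measurable (measurableSet_singleton _)] at h

lemma vol_core : vol k p (core k p) = 0 :=
  withDensity_absolutelyContinuous _ _ haar_core

lemma vol_restrict_compl_core : (vol k p).restrict (core k p)ᶜ = vol k p :=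
  Measure.restrict_eq_self_of_ae_mem (compl_mem_ae_iff.2 vol_core)

lemma measurable_density :
    Measurable fun x : Model k p ↦ ENNReal.ofReal (p.phi (‖toE3 k p x‖ ^ 2)) :=
  continuous_phi_toE3.measurable.ennreal_ofReal

lemma integral_vol (g : Model k p → ℝ) :
    ∫ x, g x ∂vol k p = ∫ x, p.phi (‖toE3 k p x‖ ^ 2) * g x ∂haar k p := by
  rw [vol, integral_withDensity_eq_integral_toReal_smul measurable_density (by simp)]
  refine integral_congr_ae (Eventually.of_forall fun x ↦ ?_)
  simp only [ENNReal.toReal_ofReal (p.phi_pos (sq_nonneg _)).le, smul_eq_mul]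

lemma integrable_vol {g : Model k p → ℝ} :
    Integrable g (vol k p) ↔
      Integrable (fun x ↦ p.phi (‖toE3 k p x‖ ^ 2) * g x) (haar k p) := by
  rw [vol, integrable_withDensity_iff_integrable_smul' measurable_density (by simp)]
  refine integrable_congr (Eventually.of_forall fun x ↦ ?_)
  simp only [ENNReal.toReal_ofReal (p.phi_pos (sq_nonneg _)).le, smul_eq_mul]

lemma haar_absolutelyContinuous : haar k p ≪ vol k p := by
  refine withDensity_absolutelyContinuous' measurable_density.aemeasurable
    (Eventually.of_forall fun x ↦ ?_)
  simpa using p.phi_pos (sq_nonneg _)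

instance : (vol k p).IsOpenPosMeasure :=
  haar_absolutelyContinuous.isOpenPosMeasure

instance : IsFiniteMeasureOnCompacts (vol k p) where
  lt_top_of_isCompact K hK := by
    have h : IsLocallyFiniteMeasure (vol k p) :=
      IsLocallyFiniteMeasure.withDensity_ofReal continuous_phi_toE3
    exact hK.measure_lt_top

/-- A function on the model which is `C²` off the core. -/
def SmoothOffCore (f : Model k p → ℝ) : Prop :=
  ∀ y, proj k y ≠ 0 → ContDiffAt ℝ 2 (f ∘ mk k p) y

lemma mk_mem_core {y : Cover k} : mk k p y ∈ core k p ↔ proj k y = 0 := by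
  rw [core, mem_ofPred_eq, toE3_mk]

lemma contDiffAt_of_isTest {Ω : Set (Model k p)} {ψ : Model k p → ℝ}
    (hψ : Riem.IsTest (k + 3) Ω ψ) (y : Cover k) : ContDiffAt ℝ 2 (ψ ∘ mk k p) y :=
  ((contMDiffAt_iff_comp_mk (m := (∞ : WithTop ℕ∞)) le_rfl).1 (hψ.smooth _)).of_le
    (WithTop.coe_le_coe.2 (le_top : (2 : ℕ∞) ≤ ⊤))

lemma eventuallyEq_zero_of_isTest {ψ : Model k p → ℝ}
    (hψ : Riem.IsTest (k + 3) (core k p)ᶜ ψ) {x : Model k p} (hx : x ∈ core k p) :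
    ψ =ᶠ[𝓝 x] fun _ ↦ 0 :=
  notMem_tsupport_iff_eventuallyEq.1 fun h ↦ hψ.subset h hx

lemma crossFlux_eq_zero {f g : Model k p → ℝ} {x : Model k p} (h : g =ᶠ[𝓝 x] fun _ ↦ 0)
    (i : Fin (k + 3)) : crossFlux f g i x = 0 := by
  rw [crossFlux, flux_congr h, flux_zero, h.eq_of_nhds, mul_zero, zero_mul, sub_zero]

/-- Green's identity, for a function which is `C²` off the core and a test function. -/
lemma integral_green {f ψ : Model k p → ℝ} (hf : SmoothOffCore f)
    (hψ : Riem.IsTest (k + 3) (core k p)ᶜ ψ) (V : Model k p → ℝ) :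
    ∫ x, (f x * Riem.schrodinger (k + 3) V ψ x - ψ x * Riem.schrodinger (k + 3) V f x) ∂vol k p
      = 0 := by
  -- the flux vanishes near the core, because `ψ` does, so it is `C¹` everywhere
  have hz : ∀ x : Model k p, ψ =ᶠ[𝓝 x] (fun _ ↦ 0) → ∀ i,
      crossFlux f ψ i =ᶠ[𝓝 x] fun _ ↦ 0 := fun x hx i ↦
    hx.eventually_nhds.mono fun z hz ↦ crossFlux_eq_zero hz i
  have hC1 : ∀ i y, ContDiffAt ℝ 1 (crossFlux f ψ i ∘ mk k p) y := by
    intro i y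
    by_cases hy : proj k y = 0
    · have h := (hz _ (eventuallyEq_zero_of_isTest hψ (mk_mem_core.2 hy)) i).comp_tendsto
        continuous_mk.continuousAt
      exact (contDiffAt_const (c := (0 : ℝ))).congr_of_eventuallyEq h
    · have h1 := hf y hy
      have h2 := contDiffAt_of_isTest hψ y
      exact ((h1.of_le (by norm_num)).mul (contDiffAt_flux h2 i)).sub
        ((h2.of_le (by norm_num)).mul (contDiffAt_flux h1 i))
  have hcs : ∀ i, HasCompactSupport (crossFlux f ψ i) := fun i ↦
    HasCompactSupport.intro hψ.compact fun x hx ↦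
      crossFlux_eq_zero (notMem_tsupport_iff_eventuallyEq.1 hx) i
  have hpt : ∀ x, p.phi (‖toE3 k p x‖ ^ 2) *
      (f x * Riem.schrodinger (k + 3) V ψ x - ψ x * Riem.schrodinger (k + 3) V f x) =
      -∑ i, pd i (crossFlux f ψ i) x := by
    intro x
    by_cases hx : x ∈ core k p
    · have h := eventuallyEq_zero_of_isTest hψ hx
      have h1 : ∀ i, pd i (crossFlux f ψ i) x = 0 := fun i ↦
        (pd_congr (hz x h i) i).trans (pd_zero i x)
      simp only [h1, Riem.schrodinger, laplacian_congr h, laplacian_zero, h.eq_of_nhds]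
      simp
    · obtain ⟨y, rfl⟩ := mk_surjective x
      rw [sum_pd_crossFlux (hf y fun h ↦ hx (mk_mem_core.2 h)) (contDiffAt_of_isTest hψ y),
        toE3_mk, Riem.schrodinger, Riem.schrodinger]
      ring
  rw [integral_vol, integral_congr_ae (Eventually.of_forall hpt), integral_neg,
    integral_finsetSum _ fun i _ ↦ (continuous_pd (hC1 i) i).integrable_of_hasCompactSupport
      (hasCompactSupport_pd (hcs i) i),
    Finset.sum_eq_zero fun i _ ↦ integral_pd (hC1 i) (hcs i) i, neg_zero]

lemma continuous_laplacian_of_isTest {Ω : Set (Model k p)} {ψ : Model k p → ℝ}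
    (hψ : Riem.IsTest (k + 3) Ω ψ) : Continuous (Riem.laplacian (k + 3) ψ) := by
  have h : Riem.laplacian (k + 3) ψ =
      fun x ↦ (p.phi (‖toE3 k p x‖ ^ 2))⁻¹ * ∑ i, pd i (flux ψ i) x := funext (laplacian_eq ψ)
  rw [h]
  exact (continuous_phi_toE3.inv₀ fun x ↦ (p.phi_pos (sq_nonneg _)).ne').mul
    (continuous_finsetSum _ fun i _ ↦
      continuous_pd (fun y ↦ contDiffAt_flux (contDiffAt_of_isTest hψ y) i) i)

lemma schrodinger_eq_zero {V ψ : Model k p → ℝ} {x : Model k p} (h : ψ =ᶠ[𝓝 x] fun _ ↦ 0) :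
    Riem.schrodinger (k + 3) V ψ x = 0 := by
  simp [Riem.schrodinger, laplacian_congr h, laplacian_zero, h.eq_of_nhds]

lemma continuous_schrodinger_of_isTest {V ψ : Model k p → ℝ} (hV : ContinuousOn V (core k p)ᶜ)
    (hψ : Riem.IsTest (k + 3) (core k p)ᶜ ψ) : Continuous (Riem.schrodinger (k + 3) V ψ) := by
  refine continuous_iff_continuousAt.2 fun x ↦ ?_
  by_cases hx : x ∈ core k p
  · have h : Riem.schrodinger (k + 3) V ψ =ᶠ[𝓝 x] fun _ ↦ 0 :=
      (eventuallyEq_zero_of_isTest hψ hx).eventually_nhds.mono fun z hz ↦ schrodinger_eq_zero hz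
    exact continuousAt_const.congr h.symm
  · exact (continuous_laplacian_of_isTest hψ).neg.continuousAt.add
      ((hV.continuousAt (isClosed_core.isOpen_compl.mem_nhds hx)).mul
        hψ.smooth.continuous.continuousAt)

lemma memLp_of_isTest {Ω : Set (Model k p)} {ψ : Model k p → ℝ}
    (hψ : Riem.IsTest (k + 3) Ω ψ) : MemLp ψ 2 (vol k p) :=
  hψ.smooth.continuous.memLp_of_hasCompactSupport hψ.compact

lemma memLp_schrodinger_of_isTest {V ψ : Model k p → ℝ} (hV : ContinuousOn V (core k p)ᶜ)
    (hψ : Riem.IsTest (k + 3) (core k p)ᶜ ψ) :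
    MemLp (Riem.schrodinger (k + 3) V ψ) 2 (vol k p) :=
  (continuous_schrodinger_of_isTest hV hψ).memLp_of_hasCompactSupport
    (HasCompactSupport.intro hψ.compact fun _ hx ↦
      schrodinger_eq_zero (notMem_tsupport_iff_eventuallyEq.1 hx))

/-- If `f` solves the equation off the core, it is a distributional solution. -/
lemma integral_mul_schrodinger_eq_zero {f ψ V : Model k p → ℝ} (hf : SmoothOffCore f)
    (hψ : Riem.IsTest (k + 3) (core k p)ᶜ ψ)
    (hsol : ∀ x ∈ (core k p)ᶜ, Riem.schrodinger (k + 3) V f x = 0) :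
    ∫ x, f x * Riem.schrodinger (k + 3) V ψ x ∂vol k p = 0 := by
  rw [← integral_green hf hψ V]
  refine integral_congr_ae ?_
  filter_upwards [compl_mem_ae_iff.2 (vol_core (k := k) (p := p))] with x hx
  rw [hsol x hx, mul_zero, sub_zero]

/-- The operator is symmetric on pairs of an `L²` function which is `C²` off the core, with image
in `L²`, and a test function. -/
lemma integral_mul_schrodinger_comm {f ψ V : Model k p → ℝ} (hf : SmoothOffCore f)
    (hV : ContinuousOn V (core k p)ᶜ)
    (hψ : Riem.IsTest (k + 3) (core k p)ᶜ ψ) (hf2 : MemLp f 2 (vol k p))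
    (hHf : MemLp (Riem.schrodinger (k + 3) V f) 2 (vol k p)) :
    ∫ x, f x * Riem.schrodinger (k + 3) V ψ x ∂vol k p =
      ∫ x, ψ x * Riem.schrodinger (k + 3) V f x ∂vol k p := by
  have h := integral_green hf hψ V
  exact sub_eq_zero.1 ((integral_sub (hf2.integrable_mul (memLp_schrodinger_of_isTest hV hψ))
    ((memLp_of_isTest hψ).integrable_mul hHf)).symm.trans h)

end Model
end CodimThree

/-! ### The Schrödinger operator on `L²` -/

namespace CodimThree

variable {k : ℕ} {p : Profile}

lemma Profile.continuous_phi_sq (p : Profile) : Continuous fun r : ℝ ↦ p.phi (r ^ 2) :=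
  continuous_iff_continuousAt.2 fun r ↦ ContinuousAt.comp (f := fun r : ℝ ↦ r ^ 2)
    (p.contDiffAt_phi (sq_nonneg r)).continuousAt (continuous_pow 2).continuousAt

namespace Model

lemma aestronglyMeasurable_comp_norm {F : ℝ → ℝ} (hF : ContinuousOn F (Ioi 0)) {μ : Measure E3}
    [NullSingletonClass μ] : AEStronglyMeasurable (fun a : E3 ↦ F ‖a‖) μ := by
  have h : μ.restrict {0}ᶜ = μ := Measure.restrict_eq_self_of_ae_mem
    (compl_mem_ae_iff.2 (measure_singleton 0))
  rw [← h]
  refine ContinuousOn.aestronglyMeasurable ?_ (measurableSet_singleton _).compl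
  exact hF.comp continuous_norm.continuousOn fun a ha ↦ norm_pos_iff.2 ha

lemma map_vol_absolutelyContinuous_map_haar :
    Measure.map (toE3 k p) (vol k p) ≪ Measure.map (toE3 k p) (haar k p) :=
  (withDensity_absolutelyContinuous _ _).map continuous_toE3.measurable

lemma aestronglyMeasurable_radial {F : ℝ → ℝ} (hF : ContinuousOn F (Ioi 0)) :
    AEStronglyMeasurable (fun x : Model k p ↦ F ‖toE3 k p x‖) (vol k p) :=
  ((aestronglyMeasurable_comp_norm hF).mono_ac
    map_vol_absolutelyContinuous_map_haar).comp_measurable continuous_toE3.measurable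

lemma continuousOn_phi_mul {F : ℝ → ℝ} (hF : ContinuousOn F (Ioi 0)) :
    ContinuousOn (fun r ↦ p.phi (r ^ 2) * F r) (Ioi 0) :=
  p.continuous_phi_sq.continuousOn.mul hF

/-- Integrability of a radial function, in polar coordinates. -/
lemma integrable_radial {F : ℝ → ℝ} (hF : ContinuousOn F (Ioi 0)) :
    Integrable (fun x : Model k p ↦ F ‖toE3 k p x‖) (vol k p) ↔
      IntegrableOn (fun r ↦ r ^ 2 * (p.phi (r ^ 2) * F r)) (Ioi 0) := by
  rw [integrable_vol]
  have h1 := integrable_map_measure (μ := haar k p)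
    (aestronglyMeasurable_comp_norm (continuousOn_phi_mul (p := p) hF))
    (continuous_toE3 (k := k) (p := p)).aemeasurable
  have h2 := integrable_fun_norm_addHaar (Measure.map (toE3 k p) (haar k p))
    (f := fun r ↦ p.phi (r ^ 2) * F r)
  have hd : Module.finrank ℝ E3 - 1 = 2 := by simp
  simp only [hd, smul_eq_mul] at h2
  exact h1.symm.trans h2

/-- The integral of a radial function, in polar coordinates. -/
lemma integral_radial {F : ℝ → ℝ} (hF : ContinuousOn F (Ioi 0)) :
    ∫ x : Model k p, F ‖toE3 k p x‖ ∂vol k p =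
      3 * ((Measure.map (toE3 k p) (haar k p)).real (Metric.ball 0 1) *
        ∫ r in Ioi 0, r ^ 2 * (p.phi (r ^ 2) * F r)) := by
  rw [integral_vol]
  have h1 := integral_map (μ := haar k p) (continuous_toE3 (k := k) (p := p)).aemeasurable
    (aestronglyMeasurable_comp_norm (continuousOn_phi_mul (p := p) hF))
  have h2 := integral_fun_norm_addHaar (Measure.map (toE3 k p) (haar k p))
    (fun r ↦ p.phi (r ^ 2) * F r)
  have hd : Module.finrank ℝ E3 = 3 := by simp
  rw [hd] at h2
  simp only [smul_eq_mul, nsmul_eq_mul, Nat.cast_ofNat, Nat.add_one_sub_one] at h2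
  exact h1.symm.trans h2

lemma memLp_radial {F : ℝ → ℝ} (hF : ContinuousOn F (Ioi 0))
    (hi : IntegrableOn (fun r ↦ r ^ 2 * (p.phi (r ^ 2) * F r ^ 2)) (Ioi 0)) :
    MemLp (fun x : Model k p ↦ F ‖toE3 k p x‖) 2 (vol k p) :=
  (memLp_two_iff_integrable_sq (aestronglyMeasurable_radial hF)).2
    ((integrable_radial (hF.pow 2)).2 hi)

/-- The volume of a tube around the core is at most a multiple of the cube of its radius. -/
lemma exists_vol_thickening_le : ∃ E : ℝ, 1 ≤ E ∧ ∀ᶠ r in 𝓝[>] (0 : ℝ),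
    vol k p (Metric.thickening r (core k p)) ≤ ENNReal.ofReal (E * r ^ 3) := by
  set ν := Measure.map (toE3 k p) (haar k p) with hν
  obtain ⟨M, hM⟩ := (isCompact_closedBall (0 : E3) 1).exists_bound_of_continuousOn
    (f := fun a ↦ p.phi (‖a‖ ^ 2)) contDiff_phi_norm_sq.continuous.continuousOn
  have hb : ν (Metric.ball 0 1) < ⊤ := measure_ball_lt_top
  refine ⟨max 1 (M * (ν (Metric.ball 0 1)).toReal), le_max_left _ _, ?_⟩
  filter_upwards [Ioo_mem_nhdsGT (zero_lt_one (α := ℝ))] with r hr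
  have hset : Metric.thickening r (core k p) = toE3 k p ⁻¹' Metric.ball 0 r := by
    rw [thickening_core]
    ext x
    simp
  have hmeas : MeasurableSet (toE3 k p ⁻¹' Metric.ball 0 r) :=
    continuous_toE3.measurable Metric.isOpen_ball.measurableSet
  have hle : ∀ x ∈ toE3 k p ⁻¹' Metric.ball 0 r,
      ENNReal.ofReal (p.phi (‖toE3 k p x‖ ^ 2)) ≤ ENNReal.ofReal M := by
    intro x hx
    refine ENNReal.ofReal_le_ofReal ((le_abs_self _).trans (hM _ ?_))
    exact Metric.ball_subset_closedBall (Metric.ball_subset_ball hr.2.le hx)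
  have hM0 : 0 ≤ M := (norm_nonneg _).trans (hM 0 (by simp))
  rw [hset, vol, withDensity_apply _ hmeas]
  refine (setLIntegral_mono measurable_const hle).trans ?_
  rw [setLIntegral_const, ← Measure.map_apply continuous_toE3.measurable
    Metric.isOpen_ball.measurableSet, ← hν, Measure.addHaar_ball ν 0 hr.1.le]
  have hd : Module.finrank ℝ E3 = 3 := by simp
  rw [hd, ← ENNReal.ofReal_toReal hb.ne, ← ENNReal.ofReal_mul (pow_nonneg hr.1.le 3),
    ← ENNReal.ofReal_mul hM0]
  refine ENNReal.ofReal_le_ofReal ?_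
  have h1 := le_max_right 1 (M * (ν (Metric.ball 0 1)).toReal)
  have h2 := mul_le_mul_of_nonneg_right h1 (pow_nonneg hr.1.le 3)
  simp only [ENNReal.toReal_ofReal ENNReal.toReal_nonneg]
  linarith

lemma pd_linear {f g : Model k p → ℝ} {y : Cover k} (hf : DifferentiableAt ℝ (f ∘ mk k p) y)
    (hg : DifferentiableAt ℝ (g ∘ mk k p) y) (c : ℝ) (i : Fin (k + 3)) :
    pd i (fun x ↦ c * f x + g x) (mk k p y) = c * pd i f (mk k p y) + pd i g (mk k p y) := by
  rw [pd_mk, pd_mk, pd_mk]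
  have h := fderiv_add (hf.const_smul c) hg
  have h2 : (fun x ↦ c * f x + g x) ∘ mk k p = c • (f ∘ mk k p) + (g ∘ mk k p) := rfl
  rw [h2, h, fderiv_const_smul hf]
  rfl

lemma laplacian_linear {f g : Model k p → ℝ} (hf : ∀ y, ContDiffAt ℝ 2 (f ∘ mk k p) y)
    (hg : ∀ y, ContDiffAt ℝ 2 (g ∘ mk k p) y) (c : ℝ) (x : Model k p) :
    Riem.laplacian (k + 3) (fun x ↦ c * f x + g x) x =
      c * Riem.laplacian (k + 3) f x + Riem.laplacian (k + 3) g x := by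
  have h1 : ∀ i, flux (fun x ↦ c * f x + g x) i = fun x ↦ c * flux f i x + flux g i x := by
    intro i
    ext x
    obtain ⟨y, rfl⟩ := mk_surjective x
    simp only [flux, pd_linear ((hf y).differentiableAt two_ne_zero)
      ((hg y).differentiableAt two_ne_zero), Finset.mul_sum, mul_add, Finset.sum_add_distrib]
    congr 1
    exact Finset.sum_congr rfl fun j _ ↦ by ring
  obtain ⟨y, rfl⟩ := mk_surjective x
  have h2 := fun i ↦ pd_linear ((contDiffAt_flux (hf y) i).differentiableAt one_ne_zero)
    ((contDiffAt_flux (hg y) i).differentiableAt one_ne_zero) c i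
  simp only [laplacian_eq, h1, h2, Finset.sum_add_distrib, ← Finset.mul_sum]
  ring

lemma isTest_linear {Ω : Set (Model k p)} {ψ χ : Model k p → ℝ} (hψ : Riem.IsTest (k + 3) Ω ψ)
    (hχ : Riem.IsTest (k + 3) Ω χ) (c : ℝ) : Riem.IsTest (k + 3) Ω (fun x ↦ c * ψ x + χ x) where
  smooth := (contMDiff_const.mul hψ.smooth).add hχ.smooth
  compact := (hψ.compact.mul_left (f := fun _ ↦ c)).add hχ.compact
  subset := (tsupport_add (fun x ↦ c * ψ x) χ).trans
    (union_subset ((tsupport_mul_subset_right (f := fun _ ↦ c)).trans hψ.subset) hχ.subset)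

lemma isTest_zero {Ω : Set (Model k p)} : Riem.IsTest (k + 3) Ω (fun _ : Model k p ↦ 0) where
  smooth := contMDiff_const
  compact := HasCompactSupport.zero
  subset := by
    have : tsupport (fun _ : Model k p ↦ (0 : ℝ)) = ∅ := tsupport_eq_empty_iff.2 rfl
    simp [this]

/-- The graph of the Schrödinger operator on test functions. -/
def testGraph (k : ℕ) (p : Profile) (V : Model k p → ℝ) :
    Submodule ℝ (Lp ℝ 2 ((vol k p).restrict (core k p)ᶜ) ×
      Lp ℝ 2 ((vol k p).restrict (core k p)ᶜ)) where
  carrier := {q | ∃ ψ, Riem.IsTest (k + 3) (core k p)ᶜ ψ ∧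
    q.1 =ᵐ[(vol k p).restrict (core k p)ᶜ] ψ ∧
    q.2 =ᵐ[(vol k p).restrict (core k p)ᶜ] Riem.schrodinger (k + 3) V ψ}
  zero_mem' := ⟨fun _ ↦ 0, isTest_zero, Lp.coeFn_zero _ _ _, (Lp.coeFn_zero _ _ _).trans
    (Eventually.of_forall fun _ ↦ (schrodinger_eq_zero (Eventually.of_forall fun _ ↦ rfl)).symm)⟩
  add_mem' := by
    rintro a b ⟨ψ, hψ, h1, h2⟩ ⟨χ, hχ, h3, h4⟩
    refine ⟨_, isTest_linear hψ hχ 1, ?_, ?_⟩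
    · filter_upwards [h1, h3, Lp.coeFn_add a.1 b.1] with x e1 e2 e3
      rw [Prod.fst_add, e3, Pi.add_apply, e1, e2, one_mul]
    · filter_upwards [h2, h4, Lp.coeFn_add a.2 b.2] with x e1 e2 e3
      rw [Prod.snd_add, e3, Pi.add_apply, e1, e2]
      simp only [Riem.schrodinger, laplacian_linear (contDiffAt_of_isTest hψ)
        (contDiffAt_of_isTest hχ)]
      ring
  smul_mem' := by
    rintro c a ⟨ψ, hψ, h1, h2⟩
    refine ⟨_, isTest_linear hψ isTest_zero c, ?_, ?_⟩
    · filter_upwards [h1, Lp.coeFn_smul c a.1] with x e1 e3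
      rw [Prod.smul_fst, e3, Pi.smul_apply, e1, add_zero, smul_eq_mul]
    · filter_upwards [h2, Lp.coeFn_smul c a.2] with x e1 e3
      rw [Prod.smul_snd, e3, Pi.smul_apply, e1]
      rw [Riem.schrodinger, Riem.schrodinger, laplacian_linear (contDiffAt_of_isTest hψ)
        (contDiffAt_of_isTest (isTest_zero (Ω := univ))), laplacian_zero, smul_eq_mul]
      ring

/-- The Schrödinger operator on test functions, as a partially defined operator on `L²`. -/
def schrodingerOp (k : ℕ) (p : Profile) (V : Model k p → ℝ) :
    Lp ℝ 2 ((vol k p).restrict (core k p)ᶜ) →ₗ.[ℝ] Lp ℝ 2 ((vol k p).restrict (core k p)ᶜ) :=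
  (testGraph k p V).toLinearPMap

lemma isSchrodingerOnTest_schrodingerOp (V : Model k p → ℝ) :
    Riem.IsSchrodingerOnTest (k + 3) (vol k p) (core k p)ᶜ V (schrodingerOp k p V) := by
  have h : (schrodingerOp k p V).graph = testGraph k p V := by
    refine Submodule.toLinearPMap_graph_eq _ ?_
    rintro ⟨f, g⟩ ⟨ψ, hψ, h1, h2⟩ (rfl : f = 0)
    have h3 : ψ =ᵐ[vol k p] fun _ ↦ 0 := by
      have h := h1.symm.trans (Lp.coeFn_zero _ _ _)
      rwa [vol_restrict_compl_core] at h
    have h4 : ψ = fun _ ↦ 0 := (hψ.smooth.continuous.ae_eq_iff_eq (vol k p) continuous_const).1 h3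
    refine Lp.ext (h2.trans ((Lp.coeFn_zero _ _ _).trans (Eventually.of_forall fun x ↦ ?_)).symm)
    rw [schrodinger_eq_zero (h4 ▸ Eventually.of_forall fun _ ↦ rfl)]
    rfl
  intro f g
  rw [h]
  rfl

end Model

/-- An operator is not essentially self-adjoint if the boundary form `⟪A f₁, f₂⟫ - ⟪f₁, A f₂⟫` of
its adjoint `A` is not zero. -/
lemma not_isSelfAdjoint_closure {H : Type*} [NormedAddCommGroup H] [InnerProductSpace ℝ H]
    [CompleteSpace H] {T : H →ₗ.[ℝ] H} {f₁ g₁ f₂ g₂ : H}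
    (h₁ : ∀ a b, (a, b) ∈ T.graph → inner ℝ b f₁ = inner ℝ a g₁)
    (h₂ : ∀ a b, (a, b) ∈ T.graph → inner ℝ b f₂ = inner ℝ a g₂)
    (hne : inner ℝ g₂ f₁ ≠ inner ℝ f₂ g₁) : ¬ IsSelfAdjoint T.closure := by
  intro hT
  have hgraph : T.closure.graph = T.closure.graph.adjoint := by
    rw [← LinearPMap.adjoint_graph_eq_graph_adjoint hT.dense_domain,
      LinearPMap.isSelfAdjoint_def.1 hT]
  have key : ∀ f g : H, (∀ a b, (a, b) ∈ T.graph → inner ℝ b f = inner ℝ a g) →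
      ∀ a b, (a, b) ∈ T.closure.graph → inner ℝ b f = inner ℝ a g := by
    intro f g h a b hab
    by_cases hc : T.IsClosable
    · rw [← hc.graph_closure_eq_closure_graph, ← SetLike.mem_coe,
        Submodule.topologicalClosure_coe] at hab
      have hcl : IsClosed {q : H × H | inner ℝ q.2 f = inner ℝ q.1 g} :=
        isClosed_eq (by fun_prop) (by fun_prop)
      exact closure_minimal (fun q hq ↦ h q.1 q.2 hq) hcl hab
    · rw [LinearPMap.closure_def' hc] at hab
      exact h a b hab
  have hmem : ∀ f g : H, (∀ a b, (a, b) ∈ T.graph → inner ℝ b f = inner ℝ a g) →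
      (f, g) ∈ T.closure.graph := fun f g h ↦ by
    rw [hgraph, Submodule.mem_adjoint_iff]
    exact fun a b hab ↦ sub_eq_zero.2 (key f g h a b hab)
  exact hne (key f₁ g₁ h₁ f₂ g₂ (hmem f₂ g₂ h₂))

namespace Model

lemma inner_toLp {μ : Measure (Model k p)} {f g : Model k p → ℝ} {a b : Lp ℝ 2 μ}
    (hf : a =ᵐ[μ] f) (hg : b =ᵐ[μ] g) : inner ℝ a b = ∫ x, f x * g x ∂μ := by
  rw [L2.inner_def]
  refine integral_congr_ae ?_
  filter_upwards [hf, hg] with x e1 e2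
  rw [e1, e2]
  exact mul_comm _ _

/-- The operator is not essentially self-adjoint if Green's identity fails, because of the
behaviour at the core, for a solution `u` and another function `g` in the maximal domain. -/
lemma not_essentiallySelfAdjoint {V u g : Model k p → ℝ} (hV : ContinuousOn V (core k p)ᶜ)
    (hu : SmoothOffCore u) (hu2 : MemLp u 2 (vol k p))
    (hsol : ∀ x ∈ (core k p)ᶜ, Riem.schrodinger (k + 3) V u x = 0)
    (hg : SmoothOffCore g) (hg2 : MemLp g 2 (vol k p))
    (hHg : MemLp (Riem.schrodinger (k + 3) V g) 2 (vol k p))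
    (hne : ∫ x, Riem.schrodinger (k + 3) V g x * u x ∂vol k p ≠ 0) :
    ¬ Riem.EssentiallySelfAdjoint (schrodingerOp k p V) := by
  have hvol := vol_restrict_compl_core (k := k) (p := p)
  have hu2' : MemLp u 2 ((vol k p).restrict (core k p)ᶜ) := hvol.symm ▸ hu2
  have hg2' : MemLp g 2 ((vol k p).restrict (core k p)ᶜ) := hvol.symm ▸ hg2
  have hHg' : MemLp (Riem.schrodinger (k + 3) V g) 2 ((vol k p).restrict (core k p)ᶜ) :=
    hvol.symm ▸ hHg
  refine fun h ↦ not_isSelfAdjoint_closure (f₁ := hu2'.toLp) (g₁ := 0) (f₂ := hg2'.toLp)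
    (g₂ := hHg'.toLp) ?_ ?_ ?_ h.2
  · intro a b hab
    obtain ⟨ψ, hψ, h1, h2⟩ := (isSchrodingerOnTest_schrodingerOp V a b).1 hab
    rw [inner_zero_right, inner_toLp h2 hu2'.coeFn_toLp, hvol,
      ← integral_mul_schrodinger_eq_zero hu hψ hsol]
    simp only [mul_comm]
  · intro a b hab
    obtain ⟨ψ, hψ, h1, h2⟩ := (isSchrodingerOnTest_schrodingerOp V a b).1 hab
    rw [inner_toLp h2 hg2'.coeFn_toLp, inner_toLp h1 hHg'.coeFn_toLp, hvol,
      ← integral_mul_schrodinger_comm hg hV hψ hg2 hHg]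
    simp only [mul_comm]
  · rw [inner_zero_right, inner_toLp hHg'.coeFn_toLp hu2'.coeFn_toLp, hvol]
    exact hne

end Model
end CodimThree

/-! ### Radial solutions and self-adjointness -/

namespace CodimThree

variable {k : ℕ} {p : Profile}

/-- The area density `r² φ(r²)`, up to a constant, of the tube of radius `r` around the core. -/
def Profile.area (p : Profile) (r : ℝ) : ℝ := r ^ 2 * p.phi (r ^ 2)

lemma Profile.area_pos (p : Profile) {r : ℝ} (hr : 0 < r) : 0 < p.area r :=
  mul_pos (by positivity) (p.phi_pos (sq_nonneg r))

lemma Profile.contDiffAt_area (p : Profile) (r : ℝ) : ContDiffAt ℝ 2 p.area r :=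
  (contDiff_id.pow 2).contDiffAt.mul (ContDiffAt.comp (f := fun r : ℝ ↦ r ^ 2) r
    (p.contDiffAt_phi (sq_nonneg r)) (contDiff_id.pow 2).contDiffAt)

/-- `V` is the derivative of `U` and `U` solves the radial equation
`(r² φ U')' = C φ U` for the potential `C / r²`, on the set `I` of radii. -/
structure IsRadialSolution (p : Profile) (C : ℝ) (U V : ℝ → ℝ) (I : Set ℝ) : Prop where
  contDiffAt : ∀ r ∈ I, ContDiffAt ℝ 2 U r
  hasDerivAt : ∀ r ∈ I, HasDerivAt U (V r) r
  equation : ∀ r ∈ I, HasDerivAt (fun r ↦ p.area r * V r) (C * p.phi (r ^ 2) * U r) r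
  integrableOn : IntegrableOn (fun r ↦ p.area r * U r ^ 2) I

/-- The cut-off, equal to `1` for `r ≤ 1/2` and to `0` for `r ≥ 3/4`. -/
def cutoff (r : ℝ) : ℝ := Real.smoothTransition (3 - 4 * r)

lemma contDiff_cutoff : ContDiff ℝ 2 cutoff :=
  Real.smoothTransition.contDiff.comp (contDiff_const.sub (contDiff_const.mul contDiff_id))

lemma cutoff_eq_one {r : ℝ} (hr : r ≤ 1 / 2) : cutoff r = 1 :=
  Real.smoothTransition.one_of_one_le (by linarith)

lemma cutoff_eq_zero {r : ℝ} (hr : 3 / 4 ≤ r) : cutoff r = 0 :=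
  Real.smoothTransition.zero_of_nonpos (by linarith)

lemma contDiffAt_deriv {f : ℝ → ℝ} {m n : WithTop ℕ∞} {r : ℝ} (hf : ContDiffAt ℝ n f r)
    (hmn : m + 1 ≤ n) : ContDiffAt ℝ m (deriv f) r :=
  (hf.fderiv_right hmn).clm_apply contDiffAt_const

/-- Cutting off a second solution near the core gives a function `G` which solves the equation
outside a compact set of radii and for which Green's identity with the first solution fails. The
function `A'` is the derivative of `r² φ G'`. -/
lemma exists_truncation {C w : ℝ} {U V U₁ V₁ : ℝ → ℝ} (h : IsRadialSolution p C U V (Ioi 0))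
    (h₁ : IsRadialSolution p C U₁ V₁ (Ioo 0 1))
    (hw : w ≠ 0) (hW : ∀ r ∈ Ioo (0 : ℝ) 1, p.area r * (U r * V₁ r - U₁ r * V r) = w) :
    ∃ G G' A' : ℝ → ℝ, (∀ r > 0, ContDiffAt ℝ 2 G r) ∧ (∀ r > 0, HasDerivAt G (G' r) r) ∧
      (∀ r > 0, HasDerivAt (fun r ↦ p.area r * G' r) (A' r) r) ∧ ContinuousOn A' (Ioi 0) ∧
      IntegrableOn (fun r ↦ p.area r * G r ^ 2) (Ioi 0) ∧
      (∀ r > 0, r ∉ Icc (1 / 4 : ℝ) (7 / 8) → A' r = C * p.phi (r ^ 2) * G r) ∧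
      ∫ r in (1 / 4 : ℝ)..(7 / 8), (U r * A' r - C * p.phi (r ^ 2) * U r * G r) ≠ 0 := by
  set G : ℝ → ℝ := fun r ↦ cutoff r * U₁ r with hG
  have hnear : ∀ r < (1 / 2 : ℝ), G =ᶠ[𝓝 r] U₁ := fun r hr ↦ by
    filter_upwards [gt_mem_nhds hr] with s hs
    rw [hG]
    dsimp only
    rw [cutoff_eq_one (le_of_lt hs), one_mul]
  have hfar : ∀ r > (3 / 4 : ℝ), G =ᶠ[𝓝 r] fun _ ↦ 0 := fun r hr ↦ by
    filter_upwards [lt_mem_nhds hr] with s hs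
    rw [hG]
    dsimp only
    rw [cutoff_eq_zero (le_of_lt hs), zero_mul]
  have hG2 : ∀ r > 0, ContDiffAt ℝ 2 G r := by
    intro r hr
    rcases lt_or_ge r 1 with h1 | h1
    · exact contDiff_cutoff.contDiffAt.mul (h₁.contDiffAt r ⟨hr, h1⟩)
    · exact contDiffAt_const.congr_of_eventuallyEq (hfar r (by linarith))
  have hGd : ∀ r > 0, HasDerivAt G (deriv G r) r := fun r hr ↦
    ((hG2 r hr).differentiableAt two_ne_zero).hasDerivAt
  have hG' : ∀ r > 0, ContDiffAt ℝ 1 (deriv G) r := fun r hr ↦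
    contDiffAt_deriv (hG2 r hr) (by norm_num)
  set A : ℝ → ℝ := fun r ↦ p.area r * deriv G r with hA
  have hA1 : ∀ r > 0, ContDiffAt ℝ 1 A r := fun r hr ↦
    ((p.contDiffAt_area r).of_le (by norm_num)).mul (hG' r hr)
  have hAd : ∀ r > 0, HasDerivAt A (deriv A r) r := fun r hr ↦
    ((hA1 r hr).differentiableAt one_ne_zero).hasDerivAt
  have hAc : ContinuousOn (deriv A) (Ioi 0) := fun r hr ↦
    (contDiffAt_deriv (m := 0) (hA1 r hr) (by norm_num)).continuousAt.continuousWithinAt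
  have hGc : ContinuousOn G (Ioi 0) := fun r hr ↦ (hG2 r hr).continuousAt.continuousWithinAt
  have hUc : ContinuousOn U (Ioi 0) := fun r hr ↦
    (h.contDiffAt r hr).continuousAt.continuousWithinAt
  have hSc : ContinuousOn p.area (Ioi 0) := fun r _ ↦
    (p.contDiffAt_area r).continuousAt.continuousWithinAt
  -- near the core, `G` is the second solution
  have hnear' : ∀ r, 0 < r → r < (1 / 2 : ℝ) → deriv G r = V₁ r := fun r h0 h1 ↦
    ((hnear r h1).deriv_eq).trans (h₁.hasDerivAt r ⟨h0, by linarith⟩).deriv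
  have hAnear : ∀ r, 0 < r → r < (1 / 2 : ℝ) → A =ᶠ[𝓝 r] fun r ↦ p.area r * V₁ r :=
    fun r h0 h1 ↦ by
      filter_upwards [Ioo_mem_nhds h0 h1] with s hs
      rw [hA]
      dsimp only
      rw [hnear' s hs.1 hs.2]
  -- far from the core, `G` vanishes
  have hfar' : ∀ r > (3 / 4 : ℝ), A =ᶠ[𝓝 r] fun _ ↦ 0 := fun r hr ↦ by
    filter_upwards [lt_mem_nhds hr] with s hs
    rw [hA]
    dsimp only
    rw [(hfar s hs).deriv_eq, deriv_const, mul_zero]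
  refine ⟨G, deriv G, deriv A, hG2, hGd, hAd, hAc, ?_, ?_, ?_⟩
  · have hi : IntegrableOn (fun r ↦ p.area r * G r ^ 2) (Ioo 0 1) := by
      refine h₁.integrableOn.mono' (((hSc.mul (hGc.pow 2)).mono fun r hr ↦ hr.1).aestronglyMeasurable
        measurableSet_Ioo) ?_
      refine (ae_restrict_mem measurableSet_Ioo).mono fun r hr ↦ ?_
      have h1 := (p.area_pos hr.1).le
      have h2 : cutoff r ^ 2 ≤ 1 := pow_le_one₀ (Real.smoothTransition.nonneg _)
        (Real.smoothTransition.le_one _)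
      rw [Real.norm_of_nonneg (by positivity), hG]
      refine mul_le_mul_of_nonneg_left ?_ h1
      rw [mul_pow]
      exact mul_le_of_le_one_left (sq_nonneg _) h2
    refine hi.of_forall_sdiff_eq_zero measurableSet_Ioi fun r hr ↦ ?_
    have h1 : 1 ≤ r := not_lt.1 fun hlt ↦ hr.2 ⟨hr.1, hlt⟩
    rw [(hfar r (by linarith)).eq_of_nhds]
    simp
  · intro r hr hn
    rcases lt_or_ge r (1 / 4) with h1 | h1
    · rw [(hAnear r hr (by linarith)).deriv_eq, (hnear r (by linarith)).eq_of_nhds]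
      exact (h₁.equation r ⟨hr, by linarith⟩).deriv
    · have h2 : 7 / 8 < r := not_le.1 fun hle ↦ hn ⟨h1, hle⟩
      rw [(hfar' r (by linarith)).deriv_eq, (hfar r (by linarith)).eq_of_nhds, deriv_const,
        mul_zero]
  · have hsub : uIcc (1 / 4 : ℝ) (7 / 8) ⊆ Ioi 0 := by
      rw [uIcc_of_le (by norm_num)]
      exact fun r hr ↦ lt_of_lt_of_le (by norm_num) hr.1
    -- the integrand is the derivative of `r² φ (U G' - G U')`, which is `w` near the core and `0`
    -- far from it
    have hder : ∀ r ∈ uIcc (1 / 4 : ℝ) (7 / 8),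
        HasDerivAt (fun r ↦ U r * A r - G r * (p.area r * V r))
          (U r * deriv A r - C * p.phi (r ^ 2) * U r * G r) r := fun r hr ↦ by
      have h0 := hsub hr
      refine (((h.hasDerivAt r h0).mul (hAd r h0)).sub
        ((hGd r h0).mul (h.equation r h0))).congr_deriv ?_
      rw [hA]
      ring
    rw [intervalIntegral.integral_eq_sub_of_hasDerivAt hder
      (ContinuousOn.intervalIntegrable (((hUc.mul hAc).sub
        (((continuousOn_const.mul p.continuous_phi_sq.continuousOn).mul hUc).mul hGc)).mono hsub))]
    have e1 : U (7 / 8) * A (7 / 8) - G (7 / 8) * (p.area (7 / 8) * V (7 / 8)) = 0 := by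
      rw [(hfar' (7 / 8) (by norm_num)).eq_of_nhds, (hfar (7 / 8) (by norm_num)).eq_of_nhds]
      ring
    have e2 : U (1 / 4) * A (1 / 4) - G (1 / 4) * (p.area (1 / 4) * V (1 / 4)) = w := by
      rw [(hAnear (1 / 4) (by norm_num) (by norm_num)).eq_of_nhds,
        (hnear (1 / 4) (by norm_num)).eq_of_nhds, ← hW (1 / 4) (by norm_num)]
      ring
    rw [e1, e2, zero_sub]
    exact neg_ne_zero.2 hw

namespace Model

lemma smoothOffCore_radial {F : ℝ → ℝ} (hF : ∀ r > 0, ContDiffAt ℝ 2 F r) :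
    SmoothOffCore fun x : Model k p ↦ F ‖toE3 k p x‖ := fun _ hy ↦
  contDiffAt_comp_norm hy (hF _ (norm_pos_iff.2 hy))

/-- The potential `C / r²`, where `r` is the distance to the core. -/
def potential (k : ℕ) (p : Profile) (C : ℝ) (x : Model k p) : ℝ :=
  C / Metric.infDist x (core k p) ^ 2

lemma potential_eq (C : ℝ) (x : Model k p) : potential k p C x = C / ‖toE3 k p x‖ ^ 2 := by
  rw [potential, infDist_core]

lemma continuousOn_potential (C : ℝ) : ContinuousOn (potential k p C) (core k p)ᶜ := by
  have h : potential k p C = fun x ↦ C / ‖toE3 k p x‖ ^ 2 := funext (potential_eq C)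
  rw [h]
  exact continuousOn_const.div (continuous_toE3.norm.pow 2).continuousOn fun x hx ↦
    pow_ne_zero 2 (norm_ne_zero_iff.2 hx)

lemma schrodinger_radial {C : ℝ} {F F' A' : ℝ → ℝ} (hF : ∀ r > 0, HasDerivAt F (F' r) r)
    (hA : ∀ r > 0, HasDerivAt (fun r ↦ p.area r * F' r) (A' r) r) {x : Model k p}
    (hx : x ∈ (core k p)ᶜ) :
    Riem.schrodinger (k + 3) (potential k p C) (fun x ↦ F ‖toE3 k p x‖) x =
      (C * p.phi (‖toE3 k p x‖ ^ 2) * F ‖toE3 k p x‖ - A' ‖toE3 k p x‖) /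
        p.area ‖toE3 k p x‖ := by
  have h0 : 0 < ‖toE3 k p x‖ := norm_pos_iff.2 hx
  have h1 := p.phi_pos (sq_nonneg ‖toE3 k p x‖)
  rw [Riem.schrodinger, laplacian_radial hx
    (by filter_upwards [lt_mem_nhds h0] with r hr using hF r hr) (hA _ h0), potential_eq,
    Profile.area]
  field_simp
  ring

/-- The operator `-Δ + C / r²` is not essentially self-adjoint if the radial equation has two
square-integrable solutions near the core with non-zero Wronskian, the first of which is
square-integrable on the whole model. -/
lemma not_essentiallySelfAdjoint_of_radial {C w : ℝ} {U V U₁ V₁ : ℝ → ℝ}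
    (h : IsRadialSolution p C U V (Ioi 0)) (h₁ : IsRadialSolution p C U₁ V₁ (Ioo 0 1))
    (hw : w ≠ 0) (hW : ∀ r ∈ Ioo (0 : ℝ) 1, p.area r * (U r * V₁ r - U₁ r * V r) = w) :
    ¬ Riem.EssentiallySelfAdjoint (schrodingerOp k p (potential k p C)) := by
  obtain ⟨G, G', A', hG2, hG, hA, hAc, hGi, hout, hint⟩ := exists_truncation h h₁ hw hW
  -- `Q` is the image of `G` under the radial part of the operator
  set Q : ℝ → ℝ := fun r ↦ (C * p.phi (r ^ 2) * G r - A' r) / p.area r with hQ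
  have hGc : ContinuousOn G (Ioi 0) := fun r hr ↦ (hG2 r hr).continuousAt.continuousWithinAt
  have hUc : ContinuousOn U (Ioi 0) := fun r hr ↦
    (h.contDiffAt r hr).continuousAt.continuousWithinAt
  have hSc : ContinuousOn p.area (Ioi 0) := fun r _ ↦
    (p.contDiffAt_area r).continuousAt.continuousWithinAt
  have hQc : ContinuousOn Q (Ioi 0) := by
    exact (((continuousOn_const.mul p.continuous_phi_sq.continuousOn).mul hGc).sub hAc).div hSc
      fun r hr ↦ (p.area_pos hr).ne'
  have hQ0 : ∀ r > 0, r ∉ Icc (1 / 4 : ℝ) (7 / 8) → Q r = 0 := fun r hr hn ↦ by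
    rw [hQ]
    dsimp only
    rw [hout r hr hn, sub_self, zero_div]
  have hsub : Icc (1 / 4 : ℝ) (7 / 8) ⊆ Ioi 0 := fun r hr ↦ lt_of_lt_of_le (by norm_num) hr.1
  have hHg : Riem.schrodinger (k + 3) (potential k p C) (fun x ↦ G ‖toE3 k p x‖)
      =ᵐ[vol k p] fun x ↦ Q ‖toE3 k p x‖ := by
    filter_upwards [compl_mem_ae_iff.2 (vol_core (k := k) (p := p))] with x hx
    exact schrodinger_radial hG hA hx
  have harea : ∀ F : ℝ → ℝ, (fun r ↦ r ^ 2 * (p.phi (r ^ 2) * F r)) = fun r ↦ p.area r * F r :=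
    fun F ↦ funext fun r ↦ (mul_assoc _ _ _).symm
  refine not_essentiallySelfAdjoint (continuousOn_potential C)
    (smoothOffCore_radial h.contDiffAt) (memLp_radial hUc ?_) (fun x hx ↦ ?_)
    (smoothOffCore_radial hG2) (memLp_radial hGc ?_)
    ((memLp_congr_ae hHg).2 (memLp_radial hQc ?_)) ?_
  · simpa only [harea fun r ↦ U r ^ 2] using h.integrableOn
  · rw [schrodinger_radial h.hasDerivAt h.equation hx, sub_self, zero_div]
  · simpa only [harea fun r ↦ G r ^ 2] using hGi
  · rw [harea fun r ↦ Q r ^ 2]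
    refine IntegrableOn.of_forall_sdiff_eq_zero (s := Icc (1 / 4) (7 / 8))
      (ContinuousOn.integrableOn_Icc ((hSc.mul (hQc.pow 2)).mono hsub)) measurableSet_Ioi ?_
    intro r hr
    rw [hQ0 r hr.1 hr.2]
    simp
  · have h1 : ∫ x, Riem.schrodinger (k + 3) (potential k p C) (fun x ↦ G ‖toE3 k p x‖) x *
        U ‖toE3 k p x‖ ∂vol k p = ∫ x : Model k p, Q ‖toE3 k p x‖ * U ‖toE3 k p x‖ ∂vol k p :=
      integral_congr_ae (hHg.mono fun x hx ↦ by simp only [hx])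
    rw [h1, integral_radial (F := fun r ↦ Q r * U r) (hQc.mul hUc), harea fun r ↦ Q r * U r]
    have h2 : ∫ r in Ioi 0, p.area r * (Q r * U r) =
        ∫ r in Icc (1 / 4 : ℝ) (7 / 8), p.area r * (Q r * U r) :=
      setIntegral_eq_of_subset_of_forall_sdiff_eq_zero measurableSet_Ioi hsub fun r hr ↦ by
        rw [hQ0 r hr.1 hr.2]
        simp
    have h3 : ∫ r in Icc (1 / 4 : ℝ) (7 / 8), p.area r * (Q r * U r) =
        -∫ r in (1 / 4 : ℝ)..(7 / 8), (U r * A' r - C * p.phi (r ^ 2) * U r * G r) := by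
      rw [integral_Icc_eq_integral_Ioc, ← intervalIntegral.integral_of_le (by norm_num),
        ← intervalIntegral.integral_neg]
      refine intervalIntegral.integral_congr fun r hr ↦ ?_
      rw [uIcc_of_le (by norm_num)] at hr
      have := (p.area_pos (hsub hr)).ne'
      rw [hQ]
      field_simp
      ring
    have h4 : (Measure.map (toE3 k p) (haar k p)).real (Metric.ball 0 1) ≠ 0 :=
      (ENNReal.toReal_pos (Metric.measure_ball_pos _ _ one_pos).ne' measure_ball_lt_top.ne).ne'
    rw [h2, h3]
    exact mul_ne_zero three_ne_zero (mul_ne_zero h4 (neg_ne_zero.2 hint))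

end Model
end CodimThree

/-! ### Polar coordinates -/

namespace CodimThree

variable {k : ℕ} {p : Profile}

/-- The metric in polar coordinates: `dr² + r² φ(r²) g_{𝕊²} + g_𝕋`. -/
lemma metricForm_polar {r a : ℝ} {θ η : E3} (τ : EuclideanSpace ℝ (Fin k)) (hθ : ‖θ‖ = 1)
    (hη : inner ℝ θ η = 0) :
    metricForm k p (r • θ) (splitEquiv k (a • θ + r • η, τ)) (splitEquiv k (a • θ + r • η, τ)) =
      a ^ 2 + p.area r * ‖η‖ ^ 2 + ‖τ‖ ^ 2 := by
  have h1 : ‖a • θ + r • η‖ ^ 2 = a ^ 2 + r ^ 2 * ‖η‖ ^ 2 := by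
    rw [norm_add_sq_real, norm_smul, norm_smul, mul_pow, mul_pow, hθ, real_inner_smul_left,
      real_inner_smul_right, hη, Real.norm_eq_abs, Real.norm_eq_abs, sq_abs, sq_abs]
    ring
  have h2 : ‖r • θ‖ ^ 2 = r ^ 2 := by
    rw [norm_smul, mul_pow, hθ, Real.norm_eq_abs, sq_abs]
    ring
  have h3 : inner ℝ (r • θ) (a • θ + r • η) = r * a := by
    rw [inner_add_right, real_inner_smul_left, real_inner_smul_right, real_inner_smul_left,
      real_inner_smul_right, hη, real_inner_self_eq_norm_sq, hθ]
    ring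
  rw [metricForm_apply, real_inner_self_eq_norm_sq, norm_sq_splitEquiv, proj_splitEquiv,
    real_inner_self_eq_norm_sq, h1, h2, h3, Profile.area, Profile.phi]
  ring

namespace Model

/-- The covering `ℝ³ × ℝᵏ → ℝ³ × 𝕋ᵏ`. -/
def splitMk (k : ℕ) (p : Profile) (q : E3 × EuclideanSpace ℝ (Fin k)) : Model k p :=
  mk k p (splitEquiv k q)

lemma contMDiff_splitMk :
    ContMDiff 𝓘(ℝ, E3 × EuclideanSpace ℝ (Fin k)) (𝓡 (k + 3)) ∞ (splitMk k p) :=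
  contMDiff_mk.comp (splitEquiv k).contDiff.contMDiff

lemma isLocalDiffeomorph_splitMk :
    IsLocalDiffeomorph 𝓘(ℝ, E3 × EuclideanSpace ℝ (Fin k)) (𝓡 (k + 3)) ∞ (splitMk k p) := by
  intro q
  set c := splitEquiv k q
  refine ⟨{ toPartialEquiv := ((splitEquiv k).toHomeomorph.toOpenPartialHomeomorph.trans
              (chart p c).symm).toPartialEquiv
            open_source := OpenPartialHomeomorph.open_source _
            open_target := OpenPartialHomeomorph.open_target _
            contMDiffOn_toFun := contMDiff_splitMk.contMDiffOn
            contMDiffOn_invFun := ?_ }, ?_, fun _ _ ↦ rfl⟩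
  · have h : ContMDiffOn (𝓡 (k + 3)) (𝓡 (k + 3)) ∞ (chart p c) (chart p c).source :=
      contMDiffOn_of_mem_maximalAtlas
        (IsManifold.subset_maximalAtlas (mem_range_self c))
    refine (splitEquiv k).symm.contDiff.contMDiff.comp_contMDiffOn (h.mono ?_)
    intro x hx
    exact hx.1
  · exact ⟨mem_univ _, Metric.mem_ball_self (by norm_num)⟩

lemma splitMk_surjective : Function.Surjective (splitMk k p) :=
  mk_surjective.comp (splitEquiv k).surjective

lemma splitMk_eq_iff (q q' : E3 × EuclideanSpace ℝ (Fin k)) :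
    splitMk k p q = splitMk k p q' ↔ q.1 = q'.1 ∧ ∀ i, ∃ m : ℤ, q.2 i - q'.2 i = m := by
  rw [eq_comm, splitMk, splitMk, mk_eq_mk, ← map_sub, mem_lattice_iff, proj_splitEquiv,
    Prod.fst_sub, sub_eq_zero]
  simp only [splitEquiv_apply_succ, Prod.snd_sub, PiLp.sub_apply]

lemma core_eq_image : core k p = splitMk k p '' {q | q.1 = 0} := by
  ext x
  constructor
  · intro hx
    obtain ⟨q, rfl⟩ := splitMk_surjective x
    exact ⟨q, (proj_splitEquiv q).symm.trans (mk_mem_core.1 hx), rfl⟩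
  · rintro ⟨q, hq, rfl⟩
    exact mk_mem_core.2 ((proj_splitEquiv q).trans hq)

lemma mfderiv_splitMk (q v : E3 × EuclideanSpace ℝ (Fin k)) :
    mfderiv 𝓘(ℝ, E3 × EuclideanSpace ℝ (Fin k)) (𝓡 (k + 3)) (splitMk k p) q v =
      splitEquiv k v := by
  have h1 : HasMFDerivAt 𝓘(ℝ, E3 × EuclideanSpace ℝ (Fin k)) (𝓡 (k + 3)) (splitEquiv k) q
      ((splitEquiv k : (E3 × EuclideanSpace ℝ (Fin k)) →L[ℝ] Cover k)) :=
    (splitEquiv k).hasFDerivAt.hasMFDerivAt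
  exact DFunLike.congr_fun ((hasMFDerivAt_mk (p := p) (splitEquiv k q)).comp q h1).mfderiv v

/-- The model is the product of `ℝ³_σ` and a flat torus if `σ² = r² φ(r²)`. -/
lemma isModelTimesTorus {σ : ℝ → ℝ} (hσ : ∀ r > 0, σ r ^ 2 = p.area r) :
    Riem.IsModelTimesTorus (k + 3) σ (core k p) (splitMk k p) where
  localDiffeo := isLocalDiffeomorph_splitMk
  surjective := splitMk_surjective
  fiber := splitMk_eq_iff
  metric r a θ η t τ hr hθ hη := by
    rw [norm_sq_eq]
    have h := mfderiv_splitMk (k := k) (p := p) (r • θ, t) (a • θ + r • η, τ)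
    have h2 : toE3 k p (splitMk k p (r • θ, t)) = r • θ := proj_splitEquiv (k := k) (r • θ, t)
    rw [hσ r hr]
    refine Eq.trans ?_ (metricForm_polar (k := k) (p := p) (r := r) (a := a) τ hθ hη)
    exact congrArg₂ (fun b v ↦ metricForm k p b v v) h2 h
  core := core_eq_image

end Model
end CodimThree

/-! ### Power solutions, for `C ≥ -1/4` -/

namespace CodimThree

/-- The profile with a given `φ`: the function `κ(s) = (1 - φ(s)) / s` is extended analytically
to `s = 0`. -/
def Profile.ofPhi (φ : ℝ → ℝ) (h0 : φ 0 = 1) (ha : AnalyticAt ℝ φ 0)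
    (hs : ∀ s > 0, ContDiffAt ℝ 2 φ s) (hp : ∀ s, 0 ≤ s → 0 < φ s) : Profile where
  kappa s := -dslope φ 0 s
  contDiffAt_kappa s h := by
    refine ContDiffAt.neg ?_
    rcases h.eq_or_lt with rfl | h
    · obtain ⟨q, hq⟩ := ha
      exact AnalyticAt.contDiffAt ⟨_, hq.has_fpower_series_dslope_fslope⟩
    · refine ContDiffAt.congr_of_eventuallyEq ?_ (dslope_eventuallyEq_slope_of_ne φ h.ne')
      simp only [slope_fun_def, vsub_eq_sub, sub_zero, smul_eq_mul]
      exact (contDiffAt_id.inv h.ne').mul ((hs s h).sub contDiffAt_const)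
  one_sub_pos s h := by
    have := sub_smul_dslope φ 0 s
    rw [sub_zero, smul_eq_mul, h0] at this
    have h2 := hp s h
    linarith

lemma Profile.phi_ofPhi {φ : ℝ → ℝ} (h0 : φ 0 = 1) (ha : AnalyticAt ℝ φ 0)
    (hs : ∀ s > 0, ContDiffAt ℝ 2 φ s) (hp : ∀ s, 0 ≤ s → 0 < φ s) (s : ℝ) :
    (Profile.ofPhi φ h0 ha hs hp).phi s = φ s := by
  have := sub_smul_dslope φ 0 s
  rw [sub_zero, smul_eq_mul, h0] at this
  simp only [Profile.phi, Profile.ofPhi]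
  linarith

/-- The function `φ = σ² / r²`, at `s = r²`, for the warping function `σ` with parameter `b`. -/
def powerPhi (b s : ℝ) : ℝ := (1 + s) ^ 2 * (1 + (2 / b + 1) * s) ^ (-(3 / (2 + b)))

lemma powerBase_pos {b s : ℝ} (hb : 0 < b) (hs : 0 ≤ s) : 0 < 1 + (2 / b + 1) * s := by
  positivity

lemma contDiffAt_powerPhi {b s : ℝ} (hb : 0 < b) (hs : 0 ≤ s) {m : WithTop ℕ∞} :
    ContDiffAt ℝ m (powerPhi b) s :=
  ((contDiff_const.add contDiff_id).pow 2).contDiffAt.mul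
    ((contDiff_const.add (contDiff_const.mul contDiff_id)).contDiffAt.rpow_const_of_ne
      (powerBase_pos hb hs).ne')

/-- The profile of the warping function with parameter `b`. -/
def powerProfile (b : ℝ) (hb : 0 < b) : Profile :=
  Profile.ofPhi (powerPhi b) (by simp [powerPhi]) (contDiffAt_powerPhi hb le_rfl).analyticAt
    (fun _ hs ↦ contDiffAt_powerPhi hb hs.le)
    (fun s hs ↦ mul_pos (by positivity) (Real.rpow_pos_of_pos (powerBase_pos hb hs) _))

@[simp] lemma phi_powerProfile {b : ℝ} (hb : 0 < b) (s : ℝ) :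
    (powerProfile b hb).phi s = powerPhi b s := Profile.phi_ofPhi _ _ _ _ s

/-- The warping function of the statement has `σ² = r² φ(r²)`. -/
lemma warp_sq {b r : ℝ} (hb : 0 < b) : Riem.warp b r ^ 2 = (powerProfile b hb).area r := by
  have h := powerBase_pos hb (sq_nonneg r)
  have h2 : ((1 + (2 / b + 1) * r ^ 2) ^ (-(3 / (2 * (2 + b))))) ^ 2 =
      (1 + (2 / b + 1) * r ^ 2) ^ (-(3 / (2 + b))) := by
    have : 2 + b ≠ 0 := by positivity
    rw [← Real.rpow_natCast, ← Real.rpow_mul h.le]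
    congr 1
    push_cast
    field_simp
  rw [Riem.warp, Profile.area, phi_powerProfile, powerPhi, mul_pow, mul_pow, h2, mul_assoc]

/-- The solution `r^{-b} (1 + r²)⁻¹`. -/
def powerSol (b r : ℝ) : ℝ := r ^ (-b) * (1 + r ^ 2)⁻¹

/-- The derivative of `powerSol`. -/
def powerSol' (b r : ℝ) : ℝ := -b * r ^ (-b - 1) * (1 + (2 / b + 1) * r ^ 2) / (1 + r ^ 2) ^ 2

lemma contDiffAt_powerSol {b r : ℝ} (hr : 0 < r) : ContDiffAt ℝ 2 (powerSol b) r :=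
  (contDiffAt_id.rpow_const_of_ne hr.ne').mul
    ((contDiff_const.add (contDiff_id.pow 2)).contDiffAt.inv (by positivity))

lemma hasDerivAt_one_add_mul_sq (a r : ℝ) :
    HasDerivAt (fun r : ℝ ↦ 1 + a * r ^ 2) (2 * a * r) r :=
  (((hasDerivAt_pow 2 r).const_mul a).const_add 1).congr_deriv (by norm_num; ring)

lemma hasDerivAt_powerSol {b r : ℝ} (hb : 0 < b) (hr : 0 < r) :
    HasDerivAt (powerSol b) (powerSol' b r) r := by
  have h0 : 1 + r ^ 2 ≠ 0 := by positivity
  have h1 : HasDerivAt (fun r : ℝ ↦ 1 + r ^ 2) (2 * r) r := by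
    simpa using hasDerivAt_one_add_mul_sq 1 r
  refine ((Real.hasDerivAt_rpow_const (p := -b) (.inl hr.ne')).mul (h1.inv h0)).congr_deriv ?_
  have h2 : r ^ (-b) = r ^ (-b - 1) * r := by
    rw [← Real.rpow_add_one hr.ne', sub_add_cancel]
  rw [powerSol', h2]
  simp only [Pi.inv_apply]
  field_simp
  ring

lemma area_powerProfile {b : ℝ} (hb : 0 < b) (r : ℝ) : (powerProfile b hb).area r =
    r ^ 2 * ((1 + r ^ 2) ^ 2 * (1 + (2 / b + 1) * r ^ 2) ^ (-(3 / (2 + b)))) := by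
  rw [Profile.area, phi_powerProfile, powerPhi]

/-- The flux of the solution, in which the factors `1 + r²` cancel; this is what makes the equation
explicitly solvable. -/
lemma area_mul_powerSol' {b r : ℝ} (hb : 0 < b) (hr : 0 < r) :
    (powerProfile b hb).area r * powerSol' b r =
      -b * (r ^ (1 - b) * (1 + (2 / b + 1) * r ^ 2) ^ (1 - 3 / (2 + b))) := by
  have h := powerBase_pos hb (sq_nonneg r)
  have h1 : r ^ (1 - b) = r ^ (-b - 1) * r ^ 2 := by
    rw [← Real.rpow_natCast, ← Real.rpow_add hr]
    congr 1
    push_cast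
    ring
  have h2 : (1 + (2 / b + 1) * r ^ 2) ^ (1 - 3 / (2 + b)) =
      (1 + (2 / b + 1) * r ^ 2) ^ (-(3 / (2 + b))) * (1 + (2 / b + 1) * r ^ 2) := by
    rw [← Real.rpow_add_one h.ne']
    congr 1
    ring
  rw [area_powerProfile, powerSol', h1, h2]
  have h3 : 1 + r ^ 2 ≠ 0 := by positivity
  generalize (1 + (2 / b + 1) * r ^ 2) ^ (-(3 / (2 + b))) = X
  generalize 1 + (2 / b + 1) * r ^ 2 = Y
  field_simp

lemma equation_powerSol {b r : ℝ} (hb : 0 < b) (hr : 0 < r) :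
    HasDerivAt (fun r ↦ (powerProfile b hb).area r * powerSol' b r)
      ((b ^ 2 - b) * (powerProfile b hb).phi (r ^ 2) * powerSol b r) r := by
  have h := powerBase_pos hb (sq_nonneg r)
  have h1 : HasDerivAt (fun r : ℝ ↦ -b * (r ^ (1 - b) *
      (1 + (2 / b + 1) * r ^ 2) ^ (1 - 3 / (2 + b)))) _ r :=
    ((Real.hasDerivAt_rpow_const (p := 1 - b) (.inl hr.ne')).mul
      ((hasDerivAt_one_add_mul_sq (2 / b + 1) r).rpow_const (p := 1 - 3 / (2 + b))
        (.inl h.ne'))).const_mul (-b)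
  have h2 := h1.congr_of_eventuallyEq (f₁ := fun r ↦ (powerProfile b hb).area r * powerSol' b r)
    (by filter_upwards [lt_mem_nhds hr] with s hs using area_mul_powerSol' hb hs)
  refine h2.congr_deriv ?_
  have e1 : r ^ (1 - b) = r ^ (-b) * r := by
    rw [← Real.rpow_add_one hr.ne']
    congr 1
    ring
  have e2 : r ^ (1 - b - 1) = r ^ (-b) := by
    congr 1
    ring
  have e3 : (1 + (2 / b + 1) * r ^ 2) ^ (1 - 3 / (2 + b)) =
      (1 + (2 / b + 1) * r ^ 2) ^ (-(3 / (2 + b))) * (1 + (2 / b + 1) * r ^ 2) := by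
    rw [← Real.rpow_add_one h.ne']
    congr 1
    ring
  have e4 : (1 + (2 / b + 1) * r ^ 2) ^ (1 - 3 / (2 + b) - 1) =
      (1 + (2 / b + 1) * r ^ 2) ^ (-(3 / (2 + b))) := by
    congr 1
    ring
  rw [phi_powerProfile, powerPhi, powerSol, e1, e2, e3, e4]
  generalize (1 + (2 / b + 1) * r ^ 2) ^ (-(3 / (2 + b))) = X
  have h3 : 1 + r ^ 2 ≠ 0 := by positivity
  have h4 : 2 + b ≠ 0 := by positivity
  field_simp
  ring

lemma area_mul_powerSol_sq {b r : ℝ} (hb : 0 < b) (hr : 0 < r) :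
    (powerProfile b hb).area r * powerSol b r ^ 2 =
      r ^ (2 - 2 * b) * (1 + (2 / b + 1) * r ^ 2) ^ (-(3 / (2 + b))) := by
  have h1 : r ^ (2 - 2 * b) = (r ^ (-b)) ^ 2 * r ^ 2 := by
    rw [← Real.rpow_natCast r 2, ← Real.rpow_natCast (r ^ (-b)), ← Real.rpow_mul hr.le,
      ← Real.rpow_add hr]
    congr 1
    push_cast
    ring
  have h3 : 1 + r ^ 2 ≠ 0 := by positivity
  rw [area_powerProfile, powerSol, h1]
  field_simp

lemma continuousOn_area_mul_sq {p : Profile} {f : ℝ → ℝ} {s : Set ℝ} (hf : ContinuousOn f s) :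
    ContinuousOn (fun r ↦ p.area r * f r ^ 2) s :=
  ContinuousOn.mul (fun r _ ↦ (p.contDiffAt_area r).continuousAt.continuousWithinAt) (hf.pow 2)

lemma integrableOn_powerSol {b : ℝ} (hb : 0 < b) (hb2 : b < 3 / 2) :
    IntegrableOn (fun r ↦ (powerProfile b hb).area r * powerSol b r ^ 2) (Ioi 0) := by
  have hc : ContinuousOn (fun r ↦ (powerProfile b hb).area r * powerSol b r ^ 2) (Ioi 0) :=
    continuousOn_area_mul_sq fun r hr ↦ (contDiffAt_powerSol hr).continuousAt.continuousWithinAt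
  have hβ : 0 < 3 / (2 + b) := by positivity
  rw [← Ioc_union_Ioi_eq_Ioi (zero_le_one (α := ℝ))]
  refine IntegrableOn.union ?_ ?_
  · have h1 : IntegrableOn (fun r : ℝ ↦ r ^ (2 - 2 * b)) (Ioc 0 1) :=
      (intervalIntegrable_iff_integrableOn_Ioc_of_le zero_le_one).1
        (intervalIntegral.intervalIntegrable_rpow' (by linarith))
    refine h1.mono' ((hc.mono fun r hr ↦ hr.1).aestronglyMeasurable measurableSet_Ioc) ?_
    refine (ae_restrict_mem measurableSet_Ioc).mono fun r hr ↦ ?_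
    have h := powerBase_pos hb (sq_nonneg r)
    have hr0 : 0 < r := hr.1
    rw [area_mul_powerSol_sq hb hr0, Real.norm_of_nonneg (by positivity)]
    refine mul_le_of_le_one_right (by positivity)
      (Real.rpow_le_one_of_one_le_of_nonpos ?_ (by linarith))
    have : 0 ≤ (2 / b + 1) * r ^ 2 := by positivity
    linarith
  · -- at infinity the density is `r ^ (2 - 2 b - 6 / (2 + b))`, up to a constant
    have hexp : 2 - 2 * b + 2 * (-(3 / (2 + b))) < -1 := by
      have h4 : 0 < 2 + b := by positivity
      have h5 : 3 / (2 + b) > (3 - 2 * b) / 2 := by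
        rw [gt_iff_lt, div_lt_div_iff₀ two_pos h4]
        nlinarith
      linarith
    refine (integrableOn_Ioi_rpow_of_lt hexp one_pos).mono'
      ((hc.mono (Ioi_subset_Ioi zero_le_one)).aestronglyMeasurable measurableSet_Ioi) ?_
    refine (ae_restrict_mem measurableSet_Ioi).mono fun r hr ↦ ?_
    have hr0 : 0 < r := one_pos.trans hr
    have h := powerBase_pos hb (sq_nonneg r)
    rw [area_mul_powerSol_sq hb hr0, Real.norm_of_nonneg (by positivity), Real.rpow_add hr0,
      Real.rpow_mul hr0.le]
    refine mul_le_mul_of_nonneg_left (Real.rpow_le_rpow_of_nonpos (by positivity) ?_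
      (by linarith)) (by positivity)
    have : 0 ≤ 2 / b * r ^ 2 := by positivity
    rw [Real.rpow_two]
    linarith

lemma isRadialSolution_powerSol {b : ℝ} (hb : 0 < b) (hb2 : b < 3 / 2) :
    IsRadialSolution (powerProfile b hb) (b ^ 2 - b) (powerSol b) (powerSol' b) (Ioi 0) where
  contDiffAt _ hr := contDiffAt_powerSol hr
  hasDerivAt _ hr := hasDerivAt_powerSol hb hr
  equation _ hr := equation_powerSol hb hr
  integrableOn := integrableOn_powerSol hb hb2

/-- The function `1 / (r² φ u²)`, for the solution `u = powerSol b`. -/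
def powerKernel (b r : ℝ) : ℝ := r ^ (2 * b - 2) * (1 + (2 / b + 1) * r ^ 2) ^ (3 / (2 + b))

lemma contDiffAt_powerKernel {b r : ℝ} (hb : 0 < b) (hr : 0 < r) {m : WithTop ℕ∞} :
    ContDiffAt ℝ m (powerKernel b) r :=
  (contDiffAt_id.rpow_const_of_ne hr.ne').mul
    ((contDiff_const.add (contDiff_const.mul (contDiff_id.pow 2))).contDiffAt.rpow_const_of_ne
      (powerBase_pos hb (sq_nonneg r)).ne')

lemma area_mul_powerKernel {b r : ℝ} (hb : 0 < b) (hr : 0 < r) :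
    (powerProfile b hb).area r * powerSol b r ^ 2 * powerKernel b r = 1 := by
  have h := powerBase_pos hb (sq_nonneg r)
  rw [area_mul_powerSol_sq hb hr, powerKernel, mul_mul_mul_comm, ← Real.rpow_add hr,
    ← Real.rpow_add h]
  simp

/-- The antiderivative of `powerKernel b` vanishing at `1`. -/
def powerFactor (b r : ℝ) : ℝ := ∫ ρ in (1 : ℝ)..r, powerKernel b ρ

lemma hasDerivAt_powerFactor {b r : ℝ} (hb : 0 < b) (hr : 0 < r) :
    HasDerivAt (powerFactor b) (powerKernel b r) r := by
  have hc : ContinuousOn (powerKernel b) (Ioi 0) := fun ρ hρ ↦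
    (contDiffAt_powerKernel (m := 0) hb hρ).continuousAt.continuousWithinAt
  have hsub : uIcc 1 r ⊆ Ioi 0 := fun ρ hρ ↦ (lt_min one_pos hr).trans_le hρ.1
  exact intervalIntegral.integral_hasDerivAt_right (hc.mono hsub).intervalIntegrable
    (hc.stronglyMeasurableAtFilter isOpen_Ioi r hr) (hc.continuousAt (Ioi_mem_nhds hr))

lemma contDiffAt_powerFactor {b r : ℝ} (hb : 0 < b) (hr : 0 < r) :
    ContDiffAt ℝ 2 (powerFactor b) r := by
  have h : ContDiffOn ℝ (1 + 1) (powerFactor b) (Ioi 0) := by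
    refine (contDiffOn_succ_iff_deriv_of_isOpen isOpen_Ioi).2 ⟨fun ρ hρ ↦
      (hasDerivAt_powerFactor hb hρ).differentiableAt.differentiableWithinAt, by simp, ?_⟩
    refine ContDiffOn.congr (f := powerKernel b)
      (fun ρ hρ ↦ (contDiffAt_powerKernel hb hρ).contDiffWithinAt)
      fun ρ hρ ↦ (hasDerivAt_powerFactor hb hρ).deriv
  exact h.contDiffAt (Ioi_mem_nhds hr)

/-- The factor `∫ 1 / (r² φ u²)` of the second solution is at most logarithmic at the core if
`b = 1/2`, and bounded otherwise; in all cases it is dominated by any negative power of `r`. -/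
lemma norm_powerFactor_le {b ε r : ℝ} (hb : 1 / 2 ≤ b) (hε : 0 < ε) (hr : r ∈ Ioo (0 : ℝ) 1) :
    |powerFactor b r| ≤ (1 + (2 / b + 1)) ^ (3 / (2 + b)) / ε * r ^ (-ε) := by
  have hb0 : 0 < b := by linarith
  have hr0 : 0 < r := hr.1
  set M := (1 + (2 / b + 1)) ^ (3 / (2 + b)) with hM
  have hM0 : 0 < M := by positivity
  have h0 : (0 : ℝ) ∉ uIcc r 1 := fun h ↦
    (lt_min hr0 one_pos).not_ge h.1
  have hi : IntervalIntegrable (fun ρ : ℝ ↦ M * ρ ^ (-ε - 1)) volume r 1 :=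
    (intervalIntegral.intervalIntegrable_rpow (.inr h0)).const_mul M
  rw [powerFactor, intervalIntegral.integral_symm, abs_neg, ← Real.norm_eq_abs]
  refine (intervalIntegral.norm_integral_le_of_norm_le (g := fun ρ ↦ M * ρ ^ (-ε - 1)) hr.2.le
    (Eventually.of_forall fun ρ hρ ↦ ?_) hi).trans ?_
  · have hρ0 : 0 < ρ := hr0.trans hρ.1
    have h := powerBase_pos hb0 (sq_nonneg ρ)
    rw [powerKernel, Real.norm_of_nonneg (by positivity), mul_comm]
    -- here `b ≥ 1/2` is used: the exponent `2 b - 2` is at least `-1`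
    refine mul_le_mul (Real.rpow_le_rpow h.le ?_ (by positivity))
      (Real.rpow_le_rpow_of_exponent_ge hρ0 hρ.2 (by linarith)) (by positivity) hM0.le
    have : ρ ^ 2 ≤ 1 := pow_le_one₀ hρ0.le hρ.2
    have h3 : 0 < 2 / b + 1 := by positivity
    nlinarith
  · rw [intervalIntegral.integral_const_mul, integral_rpow (.inr ⟨by linarith, h0⟩),
      sub_add_cancel, Real.one_rpow, div_mul_eq_mul_div, mul_div_assoc]
    refine mul_le_mul_of_nonneg_left ?_ hM0.le
    rw [div_neg, ← neg_div, neg_sub]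
    gcongr
    linarith

/-- Reduction of order: the second solution is `u ∫ 1 / (r² φ u²)`. -/
lemma isRadialSolution_powerSol_mul {b : ℝ} (hb : 0 < b) (hb1 : 1 / 2 ≤ b) (hb2 : b < 3 / 2) :
    IsRadialSolution (powerProfile b hb) (b ^ 2 - b) (fun r ↦ powerSol b r * powerFactor b r)
      (fun r ↦ powerSol' b r * powerFactor b r + powerSol b r * powerKernel b r) (Ioo 0 1) where
  contDiffAt r hr := (contDiffAt_powerSol hr.1).mul (contDiffAt_powerFactor hb hr.1)
  hasDerivAt r hr := (hasDerivAt_powerSol hb hr.1).mul (hasDerivAt_powerFactor hb hr.1)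
  equation r hr := by
    have hu : ∀ r, 0 < r → powerSol b r ≠ 0 := fun r hr ↦ by
      rw [powerSol]
      positivity
    have h1 := (equation_powerSol hb hr.1).mul (hasDerivAt_powerFactor hb hr.1)
    have h2 := (hasDerivAt_powerSol hb hr.1).inv (hu r hr.1)
    refine ((h1.add h2).congr_of_eventuallyEq ?_).congr_deriv ?_
    · filter_upwards [lt_mem_nhds hr.1] with s hs
      have h3 := area_mul_powerKernel hb hs
      have h4 := hu s hs
      simp only [Pi.add_apply, Pi.mul_apply, Pi.inv_apply]
      field_simp
      linear_combination h3
    · have h3 := area_mul_powerKernel hb hr.1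
      have h4 := hu r hr.1
      field_simp
      linear_combination powerSol' b r * h3
  integrableOn := by
    -- with this `ε` the exponent `2 - 2 b - 2 ε` of the bound is `1/2 - b > -1`
    set ε := (3 - 2 * b) / 4 with hε
    set M := (1 + (2 / b + 1)) ^ (3 / (2 + b)) / ε
    have hε0 : 0 < ε := by
      rw [hε]
      linarith
    have h1 : IntegrableOn (fun r : ℝ ↦ M ^ 2 * r ^ (1 / 2 - b)) (Ioo 0 1) :=
      ((intervalIntegral.integrableOn_Ioo_rpow_iff one_pos).2 (by linarith)).const_mul _
    refine h1.mono' (ContinuousOn.aestronglyMeasurable (continuousOn_area_mul_sq fun r hr ↦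
      ((contDiffAt_powerSol hr.1).mul (contDiffAt_powerFactor
        hb hr.1)).continuousAt.continuousWithinAt) measurableSet_Ioo) ?_
    refine (ae_restrict_mem measurableSet_Ioo).mono fun r hr ↦ ?_
    have hr0 : 0 < r := hr.1
    have h := powerBase_pos hb (sq_nonneg r)
    have h3 : (powerProfile b hb).area r * (powerSol b r * powerFactor b r) ^ 2 =
        r ^ (2 - 2 * b) * (1 + (2 / b + 1) * r ^ 2) ^ (-(3 / (2 + b))) * powerFactor b r ^ 2 := by
      rw [← area_mul_powerSol_sq hb hr0]
      ring
    rw [h3, Real.norm_of_nonneg (by positivity)]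
    have h4 : (1 + (2 / b + 1) * r ^ 2) ^ (-(3 / (2 + b))) ≤ 1 := by
      refine Real.rpow_le_one_of_one_le_of_nonpos ?_ (neg_nonpos.2 (by positivity))
      have : 0 ≤ (2 / b + 1) * r ^ 2 := by positivity
      linarith
    have h5 : powerFactor b r ^ 2 ≤ (M * r ^ (-ε)) ^ 2 := by
      rw [← sq_abs]
      exact pow_le_pow_left₀ (abs_nonneg _) (norm_powerFactor_le hb1 hε0 hr) 2
    calc r ^ (2 - 2 * b) * (1 + (2 / b + 1) * r ^ 2) ^ (-(3 / (2 + b))) * powerFactor b r ^ 2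
        ≤ r ^ (2 - 2 * b) * 1 * (M * r ^ (-ε)) ^ 2 := by gcongr
      _ = M ^ 2 * r ^ (1 / 2 - b) := by
        have h6 : r ^ (1 / 2 - b) = r ^ (2 - 2 * b) * (r ^ (-ε)) ^ 2 := by
          rw [← Real.rpow_natCast (r ^ (-ε)), ← Real.rpow_mul hr0.le, ← Real.rpow_add hr0, hε]
          congr 1
          push_cast
          ring
        rw [h6]
        ring

lemma wronskian_powerSol {b r : ℝ} (hb : 0 < b) (hr : 0 < r) :
    (powerProfile b hb).area r * (powerSol b r *
      (powerSol' b r * powerFactor b r + powerSol b r * powerKernel b r) -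
      powerSol b r * powerFactor b r * powerSol' b r) = 1 := by
  rw [← area_mul_powerKernel hb hr]
  ring

end CodimThree

/-! ### Oscillating solutions, for `C < -1/4` -/

namespace CodimThree

/-- The function equal to `f` on `(-∞, 0]` and to `g` on `(0, ∞)`. -/
def glue (f g : ℝ → ℝ) (t : ℝ) : ℝ := if t ≤ 0 then f t else g t

lemma glue_of_nonpos {f g : ℝ → ℝ} {t : ℝ} (ht : t ≤ 0) : glue f g t = f t := if_pos ht

lemma glue_of_nonneg {f g : ℝ → ℝ} (h : f 0 = g 0) {t : ℝ} (ht : 0 ≤ t) : glue f g t = g t := by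
  rcases ht.eq_or_lt with rfl | ht
  · rw [glue_of_nonpos le_rfl, h]
  · exact if_neg ht.not_ge

lemma hasDerivAt_glue {f g f' g' : ℝ → ℝ} (hf : ∀ t ≤ 0, HasDerivAt f (f' t) t)
    (hg : ∀ t ≥ 0, HasDerivAt g (g' t) t) (h : f 0 = g 0) (h' : f' 0 = g' 0) (t : ℝ) :
    HasDerivAt (glue f g) (glue f' g' t) t := by
  have hl : ∀ t ≤ 0, HasDerivWithinAt (glue f g) (f' t) (Iic 0) t := fun t ht ↦
    (hf t ht).hasDerivWithinAt.congr (fun s hs ↦ glue_of_nonpos hs) (glue_of_nonpos ht)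
  have hr : ∀ t ≥ 0, HasDerivWithinAt (glue f g) (g' t) (Ici 0) t := fun t ht ↦
    (hg t ht).hasDerivWithinAt.congr (fun s hs ↦ glue_of_nonneg h hs) (glue_of_nonneg h ht)
  rcases lt_trichotomy t 0 with ht | rfl | ht
  · rw [glue_of_nonpos ht.le]
    exact (hl t ht.le).hasDerivAt (Iic_mem_nhds ht)
  · rw [glue_of_nonpos le_rfl]
    have h1 := (hl 0 le_rfl).union (h' ▸ hr 0 le_rfl)
    rwa [Iic_union_Ici, hasDerivWithinAt_univ] at h1
  · rw [glue_of_nonneg h' ht.le]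
    exact (hr t ht.le).hasDerivAt (Ici_mem_nhds ht)

lemma contDiff_two_of_hasDerivAt {f f' f'' : ℝ → ℝ} (h1 : ∀ t, HasDerivAt f (f' t) t)
    (h2 : ∀ t, HasDerivAt f' (f'' t) t) (h3 : Continuous f'') : ContDiff ℝ 2 f := by
  have e1 : deriv f = f' := funext fun t ↦ (h1 t).deriv
  have e2 : deriv f' = f'' := funext fun t ↦ (h2 t).deriv
  have h4 : ContDiff ℝ (1 + 1) f := by
    refine contDiff_succ_iff_deriv.2 ⟨fun t ↦ (h1 t).differentiableAt, by simp, ?_⟩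
    rw [e1, contDiff_one_iff_deriv, e2]
    exact ⟨fun t ↦ (h2 t).differentiableAt, h3⟩
  exact h4

lemma continuous_glue {f g : ℝ → ℝ} (hf : Continuous f) (hg : ContinuousOn g (Ici 0))
    (h : f 0 = g 0) : Continuous (glue f g) := by
  rw [← continuousOn_univ, ← Iic_union_Ici (a := (0 : ℝ))]
  exact ContinuousOn.union_of_isClosed
    (hf.continuousOn.congr fun t ht ↦ glue_of_nonpos ht)
    (hg.congr fun t ht ↦ glue_of_nonneg h ht) isClosed_Iic isClosed_Ici

/-- The function `Λ = log φ` for `t ≥ 0`, where `t = log r`. It is found from the equation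
`c'' + Λ' (c' - c/2) + ν² c = 0` for the amplitude of a solution `u = exp (-t/2) c`, by prescribing
`c = exp (-ν² t² / 2)`, and it vanishes to third order at `t = 0`. -/
def logPhi (ν t : ℝ) : ℝ :=
  -t / 2 + ν ^ 2 * t ^ 2 / 2 + (4 * ν ^ 2)⁻¹ * Real.log (1 + 2 * ν ^ 2 * t)

/-- The derivative of `logPhi`. -/
def logPhi' (ν t : ℝ) : ℝ := -1 / 2 + ν ^ 2 * t + (2 * (1 + 2 * ν ^ 2 * t))⁻¹

/-- The second derivative of `logPhi`. -/
def logPhi'' (ν t : ℝ) : ℝ := ν ^ 2 - ν ^ 2 * ((1 + 2 * ν ^ 2 * t) ^ 2)⁻¹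

lemma logBase_pos (ν : ℝ) {t : ℝ} (ht : 0 ≤ t) : 0 < 1 + 2 * ν ^ 2 * t := by positivity

lemma hasDerivAt_logBase (ν t : ℝ) : HasDerivAt (fun t ↦ 1 + 2 * ν ^ 2 * t) (2 * ν ^ 2) t := by
  simpa using ((hasDerivAt_id t).const_mul (2 * ν ^ 2)).const_add 1

lemma hasDerivAt_logPhi {ν t : ℝ} (hν : ν ≠ 0) (ht : 0 ≤ t) :
    HasDerivAt (logPhi ν) (logPhi' ν t) t := by
  have h := logBase_pos ν ht
  refine (((((hasDerivAt_id t).neg.div_const 2).add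
    (((hasDerivAt_pow 2 t).const_mul (ν ^ 2)).div_const 2)).add
    (((hasDerivAt_logBase ν t).log h.ne').const_mul (4 * ν ^ 2)⁻¹))).congr_deriv ?_
  rw [logPhi']
  field_simp
  norm_num
  ring

lemma hasDerivAt_logPhi' {ν t : ℝ} (ht : 0 ≤ t) : HasDerivAt (logPhi' ν) (logPhi'' ν t) t := by
  have h := logBase_pos ν ht
  refine ((((hasDerivAt_id t).const_mul (ν ^ 2)).const_add (-1 / 2)).add
    (((hasDerivAt_logBase ν t).const_mul 2).inv (by positivity))).congr_deriv ?_
  rw [logPhi'']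
  field_simp
  ring

/-- The function `Λ = log φ` in the variable `t = log r`. -/
def bigLogPhi (ν : ℝ) : ℝ → ℝ := glue (fun _ ↦ 0) (logPhi ν)

/-- The derivative of `bigLogPhi`. -/
def bigLogPhi' (ν : ℝ) : ℝ → ℝ := glue (fun _ ↦ 0) (logPhi' ν)

lemma hasDerivAt_bigLogPhi {ν : ℝ} (hν : ν ≠ 0) (t : ℝ) :
    HasDerivAt (bigLogPhi ν) (bigLogPhi' ν t) t :=
  hasDerivAt_glue (fun t _ ↦ hasDerivAt_const t 0) (fun _ ht ↦ hasDerivAt_logPhi hν ht)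
    (by simp [logPhi]) (by norm_num [logPhi']) t

lemma contDiff_bigLogPhi {ν : ℝ} (hν : ν ≠ 0) : ContDiff ℝ 2 (bigLogPhi ν) := by
  have h0 : (fun _ : ℝ ↦ (0 : ℝ)) 0 = logPhi'' ν 0 := by simp [logPhi'']
  refine contDiff_two_of_hasDerivAt (f'' := glue (fun _ ↦ 0) (logPhi'' ν))
    (hasDerivAt_bigLogPhi hν) (hasDerivAt_glue (fun t _ ↦ hasDerivAt_const t 0)
      (fun _ ht ↦ hasDerivAt_logPhi' ht) (by norm_num [logPhi']) h0)
    (continuous_glue continuous_const ?_ h0)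
  refine continuousOn_const.sub (continuousOn_const.mul (ContinuousOn.inv₀ (by fun_prop) ?_))
  exact fun t ht ↦ (pow_pos (logBase_pos ν ht) 2).ne'

/-- The function `φ` at `s = r²`. -/
def oscPhi (ν s : ℝ) : ℝ := Real.exp (bigLogPhi ν (Real.log s / 2))

lemma oscPhi_of_abs_le {ν s : ℝ} (hs : |s| ≤ 1) : oscPhi ν s = 1 := by
  have h : Real.log s / 2 ≤ 0 := by
    rw [← Real.log_abs]
    linarith [Real.log_nonpos (abs_nonneg s) hs]
  rw [oscPhi, bigLogPhi, glue_of_nonpos h, Real.exp_zero]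

lemma oscPhi_pos (ν s : ℝ) : 0 < oscPhi ν s := Real.exp_pos _

lemma contDiffAt_oscPhi {ν s : ℝ} (hν : ν ≠ 0) (hs : 0 < s) : ContDiffAt ℝ 2 (oscPhi ν) s :=
  Real.contDiff_exp.contDiffAt.comp s ((contDiff_bigLogPhi hν).contDiffAt.comp s
    ((Real.contDiffAt_log.2 hs.ne').div_const 2))

/-- The profile used for `C = -1/4 - ν²`. It is flat for `r ≤ 1`. -/
def oscProfile (ν : ℝ) (hν : ν ≠ 0) : Profile :=
  Profile.ofPhi (oscPhi ν) (oscPhi_of_abs_le (by simp))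
    (analyticAt_const.congr (f := fun _ ↦ 1) (by
      filter_upwards [Metric.ball_mem_nhds (0 : ℝ) one_pos] with s hs
      rw [oscPhi_of_abs_le]
      simpa using (mem_ball_zero_iff.1 hs).le))
    (fun _ hs ↦ contDiffAt_oscPhi hν hs)
    (fun s _ ↦ oscPhi_pos ν s)

/-- For `t = log r` one has `log φ(r²) = Λ(t)`, because `oscPhi` takes `s = r²` as its argument. -/
lemma phi_oscProfile {ν r : ℝ} (hν : ν ≠ 0) :
    (oscProfile ν hν).phi (r ^ 2) = Real.exp (bigLogPhi ν (Real.log r)) := by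
  rw [oscProfile, Profile.phi_ofPhi, oscPhi, Real.log_pow]
  congr 2
  push_cast
  ring

/-- A function `r ↦ r^{-1/2} c(log r)`. -/
def logSol (c : ℝ → ℝ) (r : ℝ) : ℝ := r ^ (-(1 / 2) : ℝ) * c (Real.log r)

/-- The derivative of `logSol c`, for a function `c` with derivative `c'`. -/
def logSol' (c c' : ℝ → ℝ) (r : ℝ) : ℝ :=
  r ^ (-(3 / 2) : ℝ) * (c' (Real.log r) - c (Real.log r) / 2)

lemma hasDerivAt_logSol {c c' : ℝ → ℝ} {r : ℝ} (hr : 0 < r)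
    (hc : HasDerivAt c (c' (Real.log r)) (Real.log r)) :
    HasDerivAt (logSol c) (logSol' c c' r) r := by
  refine ((Real.hasDerivAt_rpow_const (p := -(1 / 2)) (.inl hr.ne')).mul
    (hc.comp r (Real.hasDerivAt_log hr.ne'))).congr_deriv ?_
  have e1 : r ^ (-(1 / 2) : ℝ) = r ^ (-(3 / 2) : ℝ) * r := by
    rw [← Real.rpow_add_one hr.ne']
    norm_num
  have e2 : r ^ (-(1 / 2) - 1 : ℝ) = r ^ (-(3 / 2) : ℝ) := by norm_num
  rw [logSol', e1, e2]
  simp only [Function.comp_apply]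
  field_simp
  ring

/-- The radial equation in the variable `t = log r` is `c'' + Λ' (c' - c/2) + ν² c = 0`. -/
lemma equation_logSol {ν : ℝ} (hν : ν ≠ 0) {c c' c'' : ℝ → ℝ} {r : ℝ} (hr : 0 < r)
    (hc : HasDerivAt c (c' (Real.log r)) (Real.log r))
    (hc' : HasDerivAt c' (c'' (Real.log r)) (Real.log r))
    (heq : c'' (Real.log r) + bigLogPhi' ν (Real.log r) *
      (c' (Real.log r) - c (Real.log r) / 2) + ν ^ 2 * c (Real.log r) = 0) :
    HasDerivAt (fun r ↦ (oscProfile ν hν).area r * logSol' c c' r)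
      ((-1 / 4 - ν ^ 2) * (oscProfile ν hν).phi (r ^ 2) * logSol c r) r := by
  have hlog := Real.hasDerivAt_log hr.ne'
  have h1 : HasDerivAt (fun r : ℝ ↦ r ^ (1 / 2 : ℝ) * (Real.exp (bigLogPhi ν (Real.log r)) *
      (c' (Real.log r) - c (Real.log r) / 2))) _ r :=
    (Real.hasDerivAt_rpow_const (p := 1 / 2) (.inl hr.ne')).mul
      ((((hasDerivAt_bigLogPhi hν (Real.log r)).comp r hlog).exp).mul
        ((hc'.comp r hlog).sub ((hc.comp r hlog).div_const 2)))
  refine (h1.congr_of_eventuallyEq ?_).congr_deriv ?_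
  · filter_upwards [lt_mem_nhds hr] with s hs
    have e1 : s ^ (1 / 2 : ℝ) = s ^ (-(3 / 2) : ℝ) * s ^ 2 := by
      rw [← Real.rpow_natCast, ← Real.rpow_add hs]
      norm_num
    rw [Profile.area, phi_oscProfile, logSol', e1]
    ring
  · have e1 : r ^ (1 / 2 : ℝ) = r ^ (-(1 / 2) : ℝ) * r := by
      rw [← Real.rpow_add_one hr.ne']
      norm_num
    have e2 : r ^ (1 / 2 - 1 : ℝ) = r ^ (-(1 / 2) : ℝ) := by norm_num
    rw [phi_oscProfile, logSol, e1, e2]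
    simp only [Function.comp_apply]
    generalize Real.exp (bigLogPhi ν (Real.log r)) = X
    field_simp
    linear_combination (16 * X) * heq

lemma area_mul_logSol_sq {ν : ℝ} (hν : ν ≠ 0) (c : ℝ → ℝ) {r : ℝ} (hr : 0 < r) :
    (oscProfile ν hν).area r * logSol c r ^ 2 =
      r * Real.exp (bigLogPhi ν (Real.log r)) * c (Real.log r) ^ 2 := by
  have e1 : (r ^ (-(1 / 2) : ℝ)) ^ 2 = r⁻¹ := by
    rw [← Real.rpow_natCast, ← Real.rpow_mul hr.le, ← Real.rpow_neg_one]
    norm_num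
  rw [Profile.area, phi_oscProfile, logSol, mul_pow, e1]
  field_simp

lemma contDiffAt_logSol {c : ℝ → ℝ} (hc : ContDiff ℝ 2 c) {r : ℝ} (hr : 0 < r) :
    ContDiffAt ℝ 2 (logSol c) r :=
  (contDiffAt_id.rpow_const_of_ne hr.ne').mul (hc.contDiffAt.comp r (Real.contDiffAt_log.2 hr.ne'))

lemma hasDerivAt_cos_mul (ν t : ℝ) :
    HasDerivAt (fun t ↦ Real.cos (ν * t)) (-ν * Real.sin (ν * t)) t :=
  (((hasDerivAt_id t).const_mul ν).cos).congr_deriv (by simp [mul_comm])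

lemma hasDerivAt_sin_mul (ν t : ℝ) :
    HasDerivAt (fun t ↦ Real.sin (ν * t)) (ν * Real.cos (ν * t)) t :=
  (((hasDerivAt_id t).const_mul ν).sin).congr_deriv (by simp [mul_comm])

lemma hasDerivAt_gauss (ν t : ℝ) : HasDerivAt (fun t ↦ Real.exp (-(ν ^ 2 * t ^ 2 / 2)))
    (-(ν ^ 2 * t) * Real.exp (-(ν ^ 2 * t ^ 2 / 2))) t :=
  (((((hasDerivAt_pow 2 t).const_mul (ν ^ 2)).div_const 2).neg).exp).congr_deriv
    (by norm_num; ring)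

/-- The amplitude `c` of the global solution: oscillating for `t ≤ 0`, Gaussian for `t ≥ 0`. -/
def amp (ν : ℝ) : ℝ → ℝ :=
  glue (fun t ↦ Real.cos (ν * t)) fun t ↦ Real.exp (-(ν ^ 2 * t ^ 2 / 2))

/-- The derivative of `amp`. -/
def amp' (ν : ℝ) : ℝ → ℝ :=
  glue (fun t ↦ -ν * Real.sin (ν * t)) fun t ↦ -(ν ^ 2 * t) * Real.exp (-(ν ^ 2 * t ^ 2 / 2))

/-- The second derivative of `amp`. -/
def amp'' (ν : ℝ) : ℝ → ℝ :=
  glue (fun t ↦ -ν ^ 2 * Real.cos (ν * t))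
    fun t ↦ (ν ^ 4 * t ^ 2 - ν ^ 2) * Real.exp (-(ν ^ 2 * t ^ 2 / 2))

lemma hasDerivAt_amp (ν t : ℝ) : HasDerivAt (amp ν) (amp' ν t) t :=
  hasDerivAt_glue (fun t _ ↦ hasDerivAt_cos_mul ν t) (fun t _ ↦ hasDerivAt_gauss ν t)
    (by simp) (by simp) t

lemma hasDerivAt_amp' (ν t : ℝ) : HasDerivAt (amp' ν) (amp'' ν t) t :=
  hasDerivAt_glue
    (fun t _ ↦ ((hasDerivAt_sin_mul ν t).const_mul (-ν)).congr_deriv (by ring))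
    (fun t _ ↦ ((((hasDerivAt_id t).const_mul (ν ^ 2)).neg).mul
      (hasDerivAt_gauss ν t)).congr_deriv (by simp; ring))
    (by simp) (by simp) t

lemma contDiff_amp (ν : ℝ) : ContDiff ℝ 2 (amp ν) :=
  contDiff_two_of_hasDerivAt (hasDerivAt_amp ν) (hasDerivAt_amp' ν)
    (continuous_glue (by fun_prop) (by fun_prop) (by simp))

lemma amp_of_nonneg {ν t : ℝ} (ht : 0 ≤ t) : amp ν t = Real.exp (-(ν ^ 2 * t ^ 2 / 2)) :=
  glue_of_nonneg (by simp) ht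

lemma equation_amp {ν : ℝ} (t : ℝ) :
    amp'' ν t + bigLogPhi' ν t * (amp' ν t - amp ν t / 2) + ν ^ 2 * amp ν t = 0 := by
  rcases le_total t 0 with ht | ht
  · rw [amp, amp', amp'', bigLogPhi', glue_of_nonpos ht, glue_of_nonpos ht, glue_of_nonpos ht,
      glue_of_nonpos ht]
    ring
  · have h := logBase_pos ν ht
    have e1 : amp' ν t = -(ν ^ 2 * t) * Real.exp (-(ν ^ 2 * t ^ 2 / 2)) :=
      glue_of_nonneg (by simp) ht
    have e2 : amp'' ν t = (ν ^ 4 * t ^ 2 - ν ^ 2) * Real.exp (-(ν ^ 2 * t ^ 2 / 2)) :=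
      glue_of_nonneg (by simp) ht
    have e3 : bigLogPhi' ν t = logPhi' ν t := glue_of_nonneg (by norm_num [logPhi']) ht
    rw [e1, e2, e3, amp_of_nonneg ht, logPhi']
    field_simp
    ring

lemma exp_bigLogPhi_of_nonpos {ν t : ℝ} (ht : t ≤ 0) : Real.exp (bigLogPhi ν t) = 1 := by
  rw [bigLogPhi, glue_of_nonpos ht, Real.exp_zero]

/-- The `L²` density of the global solution decays like `r⁻²`. -/
lemma exp_mul_amp_sq_le {ν t : ℝ} (hν : ν ≠ 0) (ht : 0 ≤ t) :
    Real.exp t * Real.exp (bigLogPhi ν t) * amp ν t ^ 2 ≤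
      Real.exp (9 / (2 * ν ^ 2)) * Real.exp (-2 * t) := by
  have h := logBase_pos ν ht
  have hν2 : 0 < ν ^ 2 := by positivity
  have e1 : bigLogPhi ν t = logPhi ν t := glue_of_nonneg (by simp [logPhi]) ht
  rw [amp_of_nonneg ht, e1, ← Real.exp_nat_mul, ← Real.exp_add, ← Real.exp_add, ← Real.exp_add,
    Real.exp_le_exp, logPhi]
  have h1 : (4 * ν ^ 2)⁻¹ * Real.log (1 + 2 * ν ^ 2 * t) ≤ t / 2 := by
    have h2 := Real.log_le_sub_one_of_pos h
    rw [inv_mul_le_iff₀ (by positivity)]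
    linarith
  -- completing the square in `3 t - ν² t² / 2`
  have h3 : 9 / (2 * ν ^ 2) = 3 * t - ν ^ 2 * t ^ 2 / 2 + (ν ^ 2 * t - 3) ^ 2 / (2 * ν ^ 2) := by
    field_simp
    ring
  have h4 : 0 ≤ (ν ^ 2 * t - 3) ^ 2 / (2 * ν ^ 2) := by positivity
  push_cast
  linarith

lemma integrableOn_of_norm_le {f : ℝ → ℝ} {M : ℝ} {s : Set ℝ} (hs : MeasurableSet s)
    (hs2 : volume s ≠ ⊤) (hf : ContinuousOn f s) (h : ∀ r ∈ s, ‖f r‖ ≤ M) : IntegrableOn f s :=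
  (integrableOn_const (C := M) hs2).mono' (hf.aestronglyMeasurable hs)
    ((ae_restrict_mem hs).mono h)

lemma isRadialSolution_amp {ν : ℝ} (hν : ν ≠ 0) :
    IsRadialSolution (oscProfile ν hν) (-1 / 4 - ν ^ 2) (logSol (amp ν))
      (logSol' (amp ν) (amp' ν)) (Ioi 0) where
  contDiffAt _ hr := contDiffAt_logSol (contDiff_amp ν) hr
  hasDerivAt _ hr := hasDerivAt_logSol hr (hasDerivAt_amp ν _)
  equation _ hr := equation_logSol hν hr (hasDerivAt_amp ν _) (hasDerivAt_amp' ν _)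
    (equation_amp _)
  integrableOn := by
    have hc : ContinuousOn (fun r ↦ (oscProfile ν hν).area r * logSol (amp ν) r ^ 2) (Ioi 0) :=
      continuousOn_area_mul_sq fun r hr ↦
        (contDiffAt_logSol (contDiff_amp ν) hr).continuousAt.continuousWithinAt
    rw [← Ioc_union_Ioi_eq_Ioi (zero_le_one (α := ℝ))]
    refine IntegrableOn.union ?_ ?_
    · refine integrableOn_of_norm_le (M := 1) measurableSet_Ioc (by simp)
        (hc.mono fun r hr ↦ hr.1) fun r hr ↦ ?_
      have hl : Real.log r ≤ 0 := Real.log_nonpos hr.1.le hr.2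
      have hr0 : 0 < r := hr.1
      rw [area_mul_logSol_sq hν _ hr.1, exp_bigLogPhi_of_nonpos hl, amp, glue_of_nonpos hl,
        Real.norm_of_nonneg (by positivity), mul_one]
      exact mul_le_one₀ hr.2 (sq_nonneg _) (Real.cos_sq_le_one _)
    · have h1 : IntegrableOn (fun r : ℝ ↦ Real.exp (9 / (2 * ν ^ 2)) * r ^ (-2 : ℝ)) (Ioi 1) :=
        (integrableOn_Ioi_rpow_of_lt (by norm_num) one_pos).const_mul _
      refine h1.mono' ((hc.mono (Ioi_subset_Ioi zero_le_one)).aestronglyMeasurable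
        measurableSet_Ioi) ?_
      refine (ae_restrict_mem measurableSet_Ioi).mono fun r hr ↦ ?_
      have hr0 : 0 < r := one_pos.trans hr
      have hl : 0 ≤ Real.log r := Real.log_nonneg (le_of_lt hr)
      have h2 := exp_mul_amp_sq_le hν hl
      rw [Real.exp_log hr0] at h2
      rw [area_mul_logSol_sq hν _ hr0, Real.norm_of_nonneg (by positivity),
        Real.rpow_def_of_pos hr0, mul_comm (Real.log r)]
      exact h2

lemma contDiff_sin_mul (ν : ℝ) : ContDiff ℝ 2 fun t ↦ Real.sin (ν * t) := by fun_prop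

lemma isRadialSolution_sin {ν : ℝ} (hν : ν ≠ 0) :
    IsRadialSolution (oscProfile ν hν) (-1 / 4 - ν ^ 2) (logSol fun t ↦ Real.sin (ν * t))
      (logSol' (fun t ↦ Real.sin (ν * t)) fun t ↦ ν * Real.cos (ν * t)) (Ioo 0 1) where
  contDiffAt _ hr := contDiffAt_logSol (contDiff_sin_mul ν) hr.1
  hasDerivAt _ hr := hasDerivAt_logSol hr.1 (hasDerivAt_sin_mul ν _)
  equation r hr := by
    have hl : Real.log r ≤ 0 := Real.log_nonpos hr.1.le hr.2.le
    refine equation_logSol hν (c'' := fun t ↦ -ν ^ 2 * Real.sin (ν * t)) hr.1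
      (hasDerivAt_sin_mul ν _)
      (((hasDerivAt_cos_mul ν _).const_mul ν).congr_deriv (by ring)) ?_
    rw [bigLogPhi', glue_of_nonpos hl]
    ring
  integrableOn := by
    refine integrableOn_of_norm_le (M := 1) measurableSet_Ioo (by simp)
      (continuousOn_area_mul_sq fun r hr ↦
        (contDiffAt_logSol (contDiff_sin_mul ν) hr.1).continuousAt.continuousWithinAt)
      fun r hr ↦ ?_
    have hl : Real.log r ≤ 0 := Real.log_nonpos hr.1.le hr.2.le
    have hr0 : 0 < r := hr.1
    rw [area_mul_logSol_sq hν _ hr.1, exp_bigLogPhi_of_nonpos hl,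
      Real.norm_of_nonneg (by positivity), mul_one]
    exact mul_le_one₀ hr.2.le (sq_nonneg _) (Real.sin_sq_le_one _)

lemma wronskian_amp {ν r : ℝ} (hν : ν ≠ 0) (hr : r ∈ Ioo (0 : ℝ) 1) :
    (oscProfile ν hν).area r *
      (logSol (amp ν) r * logSol' (fun t ↦ Real.sin (ν * t)) (fun t ↦ ν * Real.cos (ν * t)) r -
        logSol (fun t ↦ Real.sin (ν * t)) r * logSol' (amp ν) (amp' ν) r) = ν := by
  have hl : Real.log r ≤ 0 := Real.log_nonpos hr.1.le hr.2.le
  have e1 : r ^ (-(1 / 2) : ℝ) * r ^ (-(3 / 2) : ℝ) = (r ^ 2)⁻¹ := by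
    rw [← Real.rpow_add hr.1, ← Real.rpow_natCast, ← Real.rpow_neg hr.1.le]
    norm_num
  have hr0 := hr.1.ne'
  rw [Profile.area, phi_oscProfile, exp_bigLogPhi_of_nonpos hl, logSol, logSol, logSol', logSol',
    amp, amp', glue_of_nonpos hl, glue_of_nonpos hl]
  have h2 := Real.sin_sq_add_cos_sq (ν * Real.log r)
  have e2 : r ^ 2 * (r ^ (-(1 / 2) : ℝ) * r ^ (-(3 / 2) : ℝ)) = 1 := by
    rw [e1]
    field_simp
  linear_combination (ν * (Real.cos (ν * Real.log r) ^ 2 + Real.sin (ν * Real.log r) ^ 2)) * e2 +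
    ν * h2

end CodimThree

/-! ### The theorem -/

namespace CodimThree

/-- The model with profile `p` has the required properties, given a square-integrable solution of the
radial equation and a second one, square-integrable near the core, with non-zero Wronskian. -/
theorem exists_of_radial (k : ℕ) {p : Profile} {C w : ℝ} {U V U₁ V₁ : ℝ → ℝ}
    (h : IsRadialSolution p C U V (Ioi 0)) (h₁ : IsRadialSolution p C U₁ V₁ (Ioo 0 1))
    (hw : w ≠ 0) (hW : ∀ r ∈ Ioo (0 : ℝ) 1, p.area r * (U r * V₁ r - U₁ r * V r) = w)
    (hne : ∃ r > 0, U r ≠ 0)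
    (hmodel : ∀ b : ℝ, 1 < b → b < 3 / 2 → b ^ 2 - b = C →
      (∀ r > 0, Riem.warp b r ^ 2 = p.area r) ∧ ∀ r > 0, U r = r ^ (-b) * (1 + r ^ 2)⁻¹) :
    ∃ (N : Type) (_ : MetricSpace N) (_ : MeasurableSpace N) (_ : BorelSpace N)
      (_ : SecondCountableTopology N) (_ : ConnectedSpace N) (_ : CompleteSpace N)
      (_ : ChartedSpace (EuclideanSpace ℝ (Fin (k + 3))) N) (_ : IsManifold (𝓡 (k + 3)) ∞ N)
      (_ : RiemannianBundle (fun x : N ↦ TangentSpace (𝓡 (k + 3)) x))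
      (_ : IsContMDiffRiemannianBundle (𝓡 (k + 3)) 2 (EuclideanSpace ℝ (Fin (k + 3)))
        (fun x : N ↦ TangentSpace (𝓡 (k + 3)) x))
      (_ : IsRiemannianManifold (𝓡 (k + 3)) N)
      (vol : Measure N) (K : Set N) (u : N → ℝ)
      (T : Lp ℝ 2 (vol.restrict Kᶜ) →ₗ.[ℝ] Lp ℝ 2 (vol.restrict Kᶜ)),
      Riem.IsRiemannianVolume (k + 3) vol ∧ IsCompact K ∧ K.Nonempty ∧
      -- the volume of the tubular neighbourhoods
      (∃ E : ℝ, 1 ≤ E ∧ ∀ᶠ r in 𝓝[>] (0 : ℝ),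
        vol (Metric.thickening r K) ≤ ENNReal.ofReal (E * r ^ 3)) ∧
      -- `u` is a nonzero `L²` solution, classically and in the sense of distributions
      ContMDiffOn (𝓡 (k + 3)) 𝓘(ℝ) 2 u Kᶜ ∧
      MemLp u 2 (vol.restrict Kᶜ) ∧
      ¬ (u =ᵐ[vol.restrict Kᶜ] 0) ∧
      (∀ x ∈ Kᶜ, Riem.schrodinger (k + 3) (fun x ↦ C / Metric.infDist x K ^ 2) u x = 0) ∧
      (∀ ψ : N → ℝ, Riem.IsTest (k + 3) Kᶜ ψ →
        ∫ x in Kᶜ, u x * Riem.schrodinger (k + 3) (fun x ↦ C / Metric.infDist x K ^ 2) ψ x ∂vol = 0) ∧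
      -- the operator is not essentially self-adjoint
      Riem.IsSchrodingerOnTest (k + 3) vol Kᶜ (fun x ↦ C / Metric.infDist x K ^ 2) T ∧
      ¬ Riem.EssentiallySelfAdjoint T ∧
      -- the explicit model
      (∀ b : ℝ, 1 < b → b < 3 / 2 → b ^ 2 - b = C →
        (∃ P : EuclideanSpace ℝ (Fin 3) × EuclideanSpace ℝ (Fin (k + 3 - 3)) → N,
          Riem.IsModelTimesTorus (k + 3) (Riem.warp b) K P) ∧
        ∀ x ∈ Kᶜ, u x = Metric.infDist x K ^ (-b) * (1 + Metric.infDist x K ^ 2)⁻¹) := by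
  set u : Model k p → ℝ := fun x ↦ U ‖Model.toE3 k p x‖ with hu
  have hUc : ContinuousOn U (Ioi 0) := fun r hr ↦
    (h.contDiffAt r hr).continuousAt.continuousWithinAt
  have hvol := Model.vol_restrict_compl_core (k := k) (p := p)
  have hpos : ∀ x ∈ (Model.core k p)ᶜ, 0 < ‖Model.toE3 k p x‖ := fun x hx ↦ norm_pos_iff.2 hx
  have hsol : ∀ x ∈ (Model.core k p)ᶜ,
      Riem.schrodinger (k + 3) (Model.potential k p C) u x = 0 := fun x hx ↦ by
    rw [Model.schrodinger_radial h.hasDerivAt h.equation hx, sub_self, zero_div]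
  have hu2 : MemLp u 2 (Model.vol k p) := by
    refine Model.memLp_radial hUc (h.integrableOn.congr_fun (fun r _ ↦ ?_) measurableSet_Ioi)
    exact mul_assoc _ _ _
  refine ⟨Model k p, inferInstance, inferInstance, inferInstance, inferInstance, inferInstance,
    inferInstance, inferInstance, inferInstance, inferInstance, inferInstance, inferInstance,
    Model.vol k p, Model.core k p, u, Model.schrodingerOp k p (Model.potential k p C),
    Model.isRiemannianVolume_vol, Model.isCompact_core, Model.core_nonempty,
    Model.exists_vol_thickening_le, ?_, ?_, ?_, hsol, ?_,
    Model.isSchrodingerOnTest_schrodingerOp _,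
    Model.not_essentiallySelfAdjoint_of_radial h h₁ hw hW, ?_⟩
  · intro x hx
    obtain ⟨y, rfl⟩ := Model.mk_surjective x
    exact ((Model.contMDiffAt_iff_comp_mk (WithTop.coe_le_coe.2 (le_top : (2 : ℕ∞) ≤ ⊤))).2
      (Model.smoothOffCore_radial h.contDiffAt y fun h0 ↦
        hx (Model.mk_mem_core.2 h0))).contMDiffWithinAt
  · rwa [hvol]
  · rw [hvol]
    intro hae
    obtain ⟨r, hr, hUr⟩ := hne
    obtain ⟨θ, hθ⟩ := exists_norm_eq E3 hr.le
    obtain ⟨x, hx⟩ := Model.toE3_surjective (k := k) (p := p) θ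
    have hxr : ‖Model.toE3 k p x‖ = r := by rw [hx, hθ]
    have huc : ContinuousAt u x :=
      ContinuousAt.comp (f := fun x ↦ ‖Model.toE3 k p x‖)
        (hUc.continuousAt (Ioi_mem_nhds (hxr ▸ hr))) Model.continuous_toE3.norm.continuousAt
    have hmem : {z | u z ≠ 0} ∈ 𝓝 x := huc.eventually_ne (by
      rw [hu]
      dsimp only
      rwa [hxr])
    have h0 : Model.vol k p {z | u z ≠ 0} = 0 := hae
    exact (Measure.measure_pos_of_mem_nhds _ hmem).ne' h0
  · intro ψ hψ
    rw [hvol]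
    exact Model.integral_mul_schrodinger_eq_zero
      (Model.smoothOffCore_radial h.contDiffAt) hψ hsol
  · intro b hb1 hb2 hbC
    obtain ⟨hσ, hU⟩ := hmodel b hb1 hb2 hbC
    refine ⟨⟨Model.splitMk k p, Model.isModelTimesTorus hσ⟩, fun x hx ↦ ?_⟩
    rw [Model.infDist_core]
    exact hU _ (hpos x hx)

end CodimThree

open CodimThree

theorem mainTheorem7 (n : ℕ) (hn : 3 ≤ n) (C : ℝ) (hC : C < 3 / 4) :
    ∃ (N : Type) (_ : MetricSpace N) (_ : MeasurableSpace N) (_ : BorelSpace N)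
      (_ : SecondCountableTopology N) (_ : ConnectedSpace N) (_ : CompleteSpace N)
      (_ : ChartedSpace (EuclideanSpace ℝ (Fin n)) N) (_ : IsManifold (𝓡 n) ∞ N)
      (_ : RiemannianBundle (fun x : N ↦ TangentSpace (𝓡 n) x))
      (_ : IsContMDiffRiemannianBundle (𝓡 n) 2 (EuclideanSpace ℝ (Fin n))
        (fun x : N ↦ TangentSpace (𝓡 n) x))
      (_ : IsRiemannianManifold (𝓡 n) N)
      (vol : Measure N) (K : Set N) (u : N → ℝ)
      (T : Lp ℝ 2 (vol.restrict Kᶜ) →ₗ.[ℝ] Lp ℝ 2 (vol.restrict Kᶜ)),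
      Riem.IsRiemannianVolume n vol ∧ IsCompact K ∧ K.Nonempty ∧
      -- the volume of the tubular neighbourhoods
      (∃ E : ℝ, 1 ≤ E ∧ ∀ᶠ r in 𝓝[>] (0 : ℝ),
        vol (Metric.thickening r K) ≤ ENNReal.ofReal (E * r ^ 3)) ∧
      -- `u` is a nonzero `L²` solution, classically and in the sense of distributions
      ContMDiffOn (𝓡 n) 𝓘(ℝ) 2 u Kᶜ ∧
      MemLp u 2 (vol.restrict Kᶜ) ∧
      ¬ (u =ᵐ[vol.restrict Kᶜ] 0) ∧
      (∀ x ∈ Kᶜ, Riem.schrodinger n (fun x ↦ C / Metric.infDist x K ^ 2) u x = 0) ∧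
      (∀ ψ : N → ℝ, Riem.IsTest n Kᶜ ψ →
        ∫ x in Kᶜ, u x * Riem.schrodinger n (fun x ↦ C / Metric.infDist x K ^ 2) ψ x ∂vol = 0) ∧
      -- the operator is not essentially self-adjoint
      Riem.IsSchrodingerOnTest n vol Kᶜ (fun x ↦ C / Metric.infDist x K ^ 2) T ∧
      ¬ Riem.EssentiallySelfAdjoint T ∧
      -- the explicit model
      (∀ b : ℝ, 1 < b → b < 3 / 2 → b ^ 2 - b = C →
        (∃ P : EuclideanSpace ℝ (Fin 3) × EuclideanSpace ℝ (Fin (n - 3)) → N,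
          Riem.IsModelTimesTorus n (Riem.warp b) K P) ∧
        ∀ x ∈ Kᶜ, u x = Metric.infDist x K ^ (-b) * (1 + Metric.infDist x K ^ 2)⁻¹) := by
  obtain ⟨k, rfl⟩ := Nat.exists_eq_add_of_le' hn
  rcases le_or_gt (-1 / 4) C with hC4 | hC4
  · -- `b` is the larger root of `b² - b = C`
    obtain ⟨b, hb1, hb2, rfl⟩ : ∃ b : ℝ, 1 / 2 ≤ b ∧ b < 3 / 2 ∧ b ^ 2 - b = C := by
      have h0 : 0 ≤ C + 1 / 4 := by linarith
      have h1 := Real.sqrt_nonneg (C + 1 / 4)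
      have h2 := Real.sq_sqrt h0
      exact ⟨1 / 2 + √(C + 1 / 4), by linarith, by nlinarith, by nlinarith⟩
    have hb : 0 < b := by linarith
    refine exists_of_radial k (isRadialSolution_powerSol hb hb2)
      (isRadialSolution_powerSol_mul hb hb1 hb2) one_ne_zero
      (fun r hr ↦ wronskian_powerSol hb hr.1) ⟨1, one_pos, by norm_num [powerSol]⟩ ?_
    intro b' hb1' _ hbb'
    have h1 : (b' - b) * (b' + b - 1) = 0 := by linarith
    obtain rfl : b' = b := by
      rcases mul_eq_zero.1 h1 with h2 | h2 <;> linarith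
    exact ⟨fun r _ ↦ warp_sq hb, fun r _ ↦ rfl⟩
  · -- the solutions oscillate at the core, and no `b > 1` satisfies `b² - b = C`
    obtain ⟨ν, hν, rfl⟩ : ∃ ν : ℝ, ν ≠ 0 ∧ -1 / 4 - ν ^ 2 = C := by
      have h0 : 0 < -1 / 4 - C := by linarith
      exact ⟨√(-1 / 4 - C), (Real.sqrt_pos.2 h0).ne', by rw [Real.sq_sqrt h0.le]; ring⟩
    refine exists_of_radial k (isRadialSolution_amp hν) (isRadialSolution_sin hν) hν
      (fun r hr ↦ wronskian_amp hν hr) ⟨1, one_pos, ?_⟩ ?_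
    · simp [logSol, amp_of_nonneg]
    · intro b hb1 _ hbC
      nlinarith [sq_nonneg ν]

end
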